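/- Let $X$ be a locally compact Hausdorff space with a "real" structure, that is, a continuous involution $\mathfrak r$, and let $C_0(X)$ carry the conjugate-linear involution $\mathfrak r(f)(x)=\overline{f(\mathfrak r(x))}$. Let $E\twoheadrightarrow X$ be a $\mathbb Z/2$-equivariant real vector bundle of finite (locally constant) rank with an invariant continuous Euclidean inner product. Let $\mathrm{Cl}_E$ be the bundle over $X$ of complex Clifford algebras of the fibres of $E$, generated by self-adjoint odd elements $v\in E_x$ with $v^2=\|v\|^2$; the "real" structure on $C_0(X,\mathrm{Cl}_E)$ is induced by the conjugate-linear maps $\mathrm{Cl}_{E_x}\to\mathrm{Cl}_{E_{\mathfrak r(x)}}$ that extend the $\mathbb Z/2$-action on $E$. For $a,b\in\mathbb N$, let $\mathrm{Cl}_{a,b}$ be the complex Clifford algebra of $\mathbb R^{a+b}$, with anticommuting odd self-adjoint unitary generators $\gamma_1,\dots,\gamma_{a+b}$ and the "real" structure for which $\gamma_1,\dots,\gamma_a,i\gamma_{a+1},\dots,i\gamma_{a+b}$ are real. A *$\mathrm{KR}$-orientation* of $E$ with parameters $(a,b)$ is a $\mathbb Z/2$-graded, "real", $C_0(X)$-linear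 Morita equivalence between $C_0(X,\mathrm{Cl}_E)$ and $C_0(X)\otimes\mathrm{Cl}_{a,b}$, that is, a full Hilbert bimodule $M$ over these two $\mathrm C^*$-algebras with a compatible $\mathbb Z/2$-grading and "real" structure, such that the left and right multiplication actions of $C_0(X)$ on $M$ agree. Let $M_1$ and $M_2$ be two $\mathrm{KR}$-orientations of $E$ with the same parameters $(a,b)$. Then there is a $\mathbb Z/2$-graded "real" (Hermitian) complex line bundle $L\twoheadrightarrow X$ such that $$L\mathbin{\hat\otimes}_X M_1\cong M_2$$ as $\mathbb Z/2$-graded "real" Hilbert bimodules over $C_0(X,\mathrm{Cl}_E)$ and $C_0(X)\otimes\mathrm{Cl}_{a,b}$. Here $L\mathbin{\hat\otimes}_X M_1$ is the graded tensor product $C_0(X,L)\mathbin{\hat\otimes}_{C_0(X)}M_1$, whose left action is given by the sign rule $f\cdot(l\otimes m)=(-1)^{|f|\,|l|}\,l\otimes fm$ for homogeneous $f$ and $l$. The line bundle $L$ is unique up to isomorphism of $\mathbb Z/2$-graded "real" complex line bundles: if $L'$ is another such line bundle with $L'\mathbin{\hat\otimes}_X M_1\cong M_2$, then $L\cong L'$.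 -/

import Mathlib

noncomputable section

namespace KR

open scoped TensorProduct

section Clifford

set_option linter.unusedSectionVars false

/-- The quadratic form `v ↦ ⟪v, v⟫ = ‖v‖ ^ 2` of a Euclidean vector space. -/
abbrev normForm (V : Type*) [NormedAddCommGroup V] [InnerProductSpace ℝ V] : QuadraticForm ℝ V :=
  LinearMap.BilinMap.toQuadraticMap (innerₗ V)

/-- The complex Clifford algebra of a Euclidean vector space `V`, that is, the complexification of
the real Clifford algebra with `v ^ 2 = ‖v‖ ^ 2`. -/
def Cl (V : Type*) [NormedAddCommGroup V] [InnerProductSpace ℝ V] : Type _ :=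
  ℂ ⊗[ℝ] CliffordAlgebra (normForm V)

namespace Cl

variable {V : Type*} [NormedAddCommGroup V] [InnerProductSpace ℝ V]
  {W : Type*} [NormedAddCommGroup W] [InnerProductSpace ℝ W]

instance : Ring (Cl V) := inferInstanceAs (Ring (ℂ ⊗[ℝ] CliffordAlgebra (normForm V)))

instance : Algebra ℂ (Cl V) := inferInstanceAs (Algebra ℂ (ℂ ⊗[ℝ] CliffordAlgebra (normForm V)))

/-- The elementary tensor `z ⊗ c` in the complexified Clifford algebra. -/
def mk (z : ℂ) (c : CliffordAlgebra (normForm V)) : Cl V := z ⊗ₜ[ℝ] c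

/-- The canonical inclusion of `V` into its Clifford algebra. -/
def γ (v : V) : Cl V := mk 1 (CliffordAlgebra.ι (normForm V) v)

lemma mk_mul_mk (z w : ℂ) (c d : CliffordAlgebra (normForm V)) :
    mk z c * mk w d = mk (z * w) (c * d) := Algebra.TensorProduct.tmul_mul_tmul z w c d

lemma one_def : (1 : Cl V) = mk 1 1 := rfl

lemma algebraMap_def (z : ℂ) : algebraMap ℂ (Cl V) z = mk z 1 := rfl

lemma γ_mul_self (v : V) : γ v * γ v = algebraMap ℂ (Cl V) ((‖v‖ ^ 2 : ℝ) : ℂ) := by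
  rw [γ, mk_mul_mk, CliffordAlgebra.ι_sq_scalar, Algebra.algebraMap_eq_smul_one, algebraMap_def, mk,
    mk, TensorProduct.tmul_smul, TensorProduct.smul_tmul']
  simp
  rfl

lemma γ_anticomm {v w : V} (h : inner ℝ v w = 0) : γ v * γ w = - (γ w * γ v) := by
  have : CliffordAlgebra.ι (normForm V) v * CliffordAlgebra.ι (normForm V) w
      = - (CliffordAlgebra.ι (normForm V) w * CliffordAlgebra.ι (normForm V) v) := by
    apply CliffordAlgebra.ι_mul_ι_comm_of_isOrtho
    rw [QuadraticMap.isOrtho_def]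
    simp [inner_add_right, h, real_inner_comm v w]
  rw [γ, γ, mk_mul_mk, this, mk_mul_mk, mk, mk, TensorProduct.tmul_neg]
  rfl

@[elab_as_elim]
lemma induction {p : Cl V → Prop} (x : Cl V) (hmk : ∀ z c, p (mk z c))
    (hadd : ∀ x y, p x → p y → p (x + y)) : p x :=
  TensorProduct.induction_on (motive := p) x
    (by simpa [mk] using hmk 0 0) (fun z c => hmk z c) (fun x y => hadd x y)

/-- The isometry of quadratic forms underlying a linear isometry. -/
def isom (u : V ≃ₗᵢ[ℝ] W) : (normForm V) →qᵢ (normForm W) where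
  toLinearMap := u.toLinearEquiv.toLinearMap
  map_app' v := by simp

/-- The complex-linear algebra homomorphism of Clifford algebras induced by an isometry. -/
def map (u : V ≃ₗᵢ[ℝ] W) : Cl V →ₐ[ℂ] Cl W :=
  Algebra.TensorProduct.map (AlgHom.id ℂ ℂ) (CliffordAlgebra.map (isom u))

/-- The conjugate-linear ring homomorphism of Clifford algebras induced by an isometry. -/
def conjMap (u : V ≃ₗᵢ[ℝ] W) : Cl V →+* Cl W :=
  (Algebra.TensorProduct.map (Complex.conjAe : ℂ →ₐ[ℝ] ℂ)
    (CliffordAlgebra.map (isom u))).toRingHom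

/-- The grading automorphism of the Clifford algebra: `γ v ↦ - γ v`. -/
def grade : Cl V →ₐ[ℂ] Cl V :=
  Algebra.TensorProduct.map (AlgHom.id ℂ ℂ) (CliffordAlgebra.involute)

lemma map_mk (u : V ≃ₗᵢ[ℝ] W) (z : ℂ) (c) :
    map u (mk z c) = mk z (CliffordAlgebra.map (isom u) c) := rfl

lemma conjMap_mk (u : V ≃ₗᵢ[ℝ] W) (z : ℂ) (c) :
    conjMap u (mk z c) = mk (starRingEnd ℂ z) (CliffordAlgebra.map (isom u) c) := rfl

lemma grade_mk (z : ℂ) (c : CliffordAlgebra (normForm V)) :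
    grade (mk z c) = mk z (CliffordAlgebra.involute c) := rfl

lemma map_γ (u : V ≃ₗᵢ[ℝ] W) (v : V) : map u (γ v) = γ (u v) := by
  rw [γ, map_mk, CliffordAlgebra.map_apply_ι]; rfl

lemma conjMap_γ (u : V ≃ₗᵢ[ℝ] W) (v : V) : conjMap u (γ v) = γ (u v) := by
  rw [γ, conjMap_mk, CliffordAlgebra.map_apply_ι, map_one]; rfl

lemma grade_γ (v : V) : grade (γ v) = - γ v := by
  rw [γ, grade_mk, CliffordAlgebra.involute_ι, mk, mk, TensorProduct.tmul_neg]
  rfl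

lemma conjMap_smul (u : V ≃ₗᵢ[ℝ] W) (z : ℂ) (x : Cl V) :
    conjMap u (z • x) = starRingEnd ℂ z • conjMap u x := by
  rw [Algebra.smul_def, map_mul, algebraMap_def, conjMap_mk, map_one, ← algebraMap_def,
    ← Algebra.smul_def]

/-- The involution: the conjugate-linear antiautomorphism with `star (γ v) = γ v`. -/
instance : Star (Cl V) :=
  ⟨fun x => TensorProduct.map (Complex.conjAe.toLinearMap : ℂ →ₗ[ℝ] ℂ)
    (CliffordAlgebra.reverse (Q := normForm V)) x⟩

lemma star_mk (z : ℂ) (c : CliffordAlgebra (normForm V)) :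
    star (mk z c) = mk (starRingEnd ℂ z) (CliffordAlgebra.reverse c) := rfl

lemma star_add' (x y : Cl V) : star (x + y) = star x + star y :=
  (TensorProduct.map (Complex.conjAe.toLinearMap : ℂ →ₗ[ℝ] ℂ)
    (CliffordAlgebra.reverse (Q := normForm V))).map_add x y

instance : StarRing (Cl V) where
  star_involutive x := by
    induction x using Cl.induction with
    | hmk z c => simp [star_mk]
    | hadd x y hx hy => rw [star_add', star_add', hx, hy]
  star_mul x y := by
    induction x using Cl.induction with
    | hadd x x' hx hx' => rw [add_mul, star_add', hx, hx', star_add', mul_add]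
    | hmk z c =>
      induction y using Cl.induction with
      | hadd y y' hy hy' => rw [mul_add, star_add', hy, hy', star_add', add_mul]
      | hmk w d =>
        rw [mk_mul_mk, star_mk, star_mk, star_mk, mk_mul_mk, map_mul,
          CliffordAlgebra.reverse.map_mul, mul_comm]
  star_add := star_add'

instance : StarModule ℂ (Cl V) where
  star_smul z x := by
    rw [Algebra.smul_def, star_mul, algebraMap_def, star_mk, CliffordAlgebra.reverse.map_one,
      ← algebraMap_def, ← Algebra.commutes, ← Algebra.smul_def]
    rfl

@[simp] lemma star_γ (v : V) : star (γ v) = γ v := by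
  rw [γ, star_mk, CliffordAlgebra.reverse_ι, map_one]

lemma adjoin_γ : Algebra.adjoin ℂ (Set.range (γ : V → Cl V)) = ⊤ := by
  rw [eq_top_iff]
  rintro x -
  induction x using Cl.induction with
  | hadd x y hx hy => exact add_mem hx hy
  | hmk z c =>
    have h1 : ∀ c : CliffordAlgebra (normForm V),
        mk 1 c ∈ Algebra.adjoin ℂ (Set.range (γ : V → Cl V)) := by
      intro c
      induction c using CliffordAlgebra.induction with
      | algebraMap r =>
        have : mk 1 (algebraMap ℝ (CliffordAlgebra (normForm V)) r)
            = algebraMap ℂ (Cl V) (r : ℂ) := by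
          rw [Algebra.algebraMap_eq_smul_one, algebraMap_def, mk, mk, TensorProduct.tmul_smul,
            TensorProduct.smul_tmul']
          simp
          rfl
        rw [this]
        exact Subalgebra.algebraMap_mem _ _
      | ι v => exact Algebra.subset_adjoin ⟨v, rfl⟩
      | mul a b ha hb => simpa [mk_mul_mk] using mul_mem ha hb
      | add a b ha hb =>
        have : mk 1 (a + b) = mk 1 a + mk 1 b := TensorProduct.tmul_add _ _ _
        rw [this]; exact add_mem ha hb
    have : mk z c = z • mk 1 c := by
      rw [Algebra.smul_def, algebraMap_def, mk_mul_mk, mul_one, one_mul]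
    rw [this]
    exact Subalgebra.smul_mem _ (h1 c) z

@[ext]
lemma algHom_ext {A : Type*} [Semiring A] [Algebra ℂ A] {f g : Cl V →ₐ[ℂ] A}
    (h : ∀ v, f (γ v) = g (γ v)) : f = g :=
  AlgHom.ext_of_adjoin_eq_top adjoin_γ (by rintro _ ⟨v, rfl⟩; exact h v)

lemma map_star (u : V ≃ₗᵢ[ℝ] W) (x : Cl V) : map u (star x) = star (map u x) := by
  induction x using Cl.induction with
  | hadd x y hx hy => simp [hx, hy]
  | hmk z c =>
    rw [star_mk, map_mk, map_mk, star_mk]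
    congr 1
    induction c using CliffordAlgebra.induction with
    | algebraMap r => simp
    | ι v => simp
    | mul a b ha hb => simp [ha, hb]
    | add a b ha hb => simp [ha, hb]

lemma map_refl : map (LinearIsometryEquiv.refl ℝ V) = AlgHom.id ℂ (Cl V) := by
  ext v; simp [map_γ]

lemma map_trans {U : Type*} [NormedAddCommGroup U] [InnerProductSpace ℝ U]
    (u : V ≃ₗᵢ[ℝ] W) (w : W ≃ₗᵢ[ℝ] U) : (map w).comp (map u) = map (u.trans w) := by
  ext v; simp [map_γ]

lemma map_map {U : Type*} [NormedAddCommGroup U] [InnerProductSpace ℝ U]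
    (u : V ≃ₗᵢ[ℝ] W) (w : W ≃ₗᵢ[ℝ] U) (x : Cl V) : map w (map u x) = map (u.trans w) x := by
  rw [← map_trans]; rfl

/-- The isomorphism of Clifford algebras induced by an isometry. -/
def mapEquiv (u : V ≃ₗᵢ[ℝ] W) : Cl V ≃ₐ[ℂ] Cl W :=
  AlgEquiv.ofAlgHom (map u) (map u.symm) (by rw [map_trans]; simp [map_refl])
    (by rw [map_trans]; simp [map_refl])

/-! ### The C⋆-norm -/

section Gen

variable {ι : Type*} [DecidableEq ι] {e : ι → V}

/-- The subalgebra generated by the vectors `e i`, `i ∈ s`. -/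
def gen (e : ι → V) (s : Finset ι) : Subalgebra ℂ (Cl V) :=
  Algebra.adjoin ℂ ((fun i => γ (e i)) '' (s : Set ι))

lemma gen_mono {s t : Finset ι} (h : s ⊆ t) : gen e s ≤ gen e t :=
  Algebra.adjoin_mono (Set.image_mono (by simpa using h))

lemma γ_mem_gen {s : Finset ι} {i : ι} (h : i ∈ s) : γ (e i) ∈ gen e s :=
  Algebra.subset_adjoin ⟨i, by simpa using h, rfl⟩

lemma star_mem_gen {s : Finset ι} {x : Cl V} (hx : x ∈ gen e s) : star x ∈ gen e s := by
  induction hx using Algebra.adjoin_induction with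
  | mem x hx =>
    obtain ⟨i, hi, rfl⟩ := hx
    rw [star_γ]; exact γ_mem_gen (by simpa using hi)
  | algebraMap r =>
    rw [← algebraMap_star_comm]; exact Subalgebra.algebraMap_mem _ _
  | add x y _ _ hx hy => rw [star_add]; exact add_mem hx hy
  | mul x y _ _ hx hy => rw [star_mul]; exact mul_mem hy hx

lemma grade_mem_gen {s : Finset ι} {x : Cl V} (hx : x ∈ gen e s) : grade x ∈ gen e s := by
  induction hx using Algebra.adjoin_induction with
  | mem x hx =>
    obtain ⟨i, hi, rfl⟩ := hx
    rw [grade_γ]; exact neg_mem (γ_mem_gen (by simpa using hi))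
  | algebraMap r => rw [AlgHom.commutes]; exact Subalgebra.algebraMap_mem _ _
  | add x y _ _ hx hy => rw [map_add]; exact add_mem hx hy
  | mul x y _ _ hx hy => rw [map_mul]; exact mul_mem hx hy

lemma gen_mul_γ {s : Finset ι} {v : V} (hv : ∀ i ∈ s, inner ℝ v (e i) = 0) {x : Cl V}
    (hx : x ∈ gen e s) : x * γ v = γ v * grade x := by
  induction hx using Algebra.adjoin_induction with
  | mem x hx =>
    obtain ⟨i, hi, rfl⟩ := hx
    rw [grade_γ, mul_neg, γ_anticomm (hv i (by simpa using hi)), neg_neg]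
  | algebraMap r => rw [AlgHom.commutes, Algebra.commutes]
  | add x y _ _ hx hy => rw [map_add, add_mul, mul_add, hx, hy]
  | mul x y _ _ hx hy => rw [map_mul, mul_assoc, hy, ← mul_assoc, hx, mul_assoc]

lemma exists_of_mem_gen_insert (he : Orthonormal ℝ e) {s : Finset ι} {k : ι} (hk : k ∉ s)
    {x : Cl V} (hx : x ∈ gen e (insert k s)) :
    ∃ a ∈ gen e s, ∃ b ∈ gen e s, x = a + γ (e k) * b := by
  have ho : ∀ i ∈ s, inner ℝ (e k) (e i) = 0 := fun i hi =>
    he.2 (by rintro rfl; exact hk hi)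
  have hsq : γ (e k) * γ (e k) = 1 := by rw [γ_mul_self, he.1 k]; simp
  induction hx using Algebra.adjoin_induction with
  | mem x hx =>
    obtain ⟨i, hi, rfl⟩ := hx
    rcases Finset.mem_insert.1 (by simpa using hi) with rfl | hi
    · exact ⟨0, zero_mem _, 1, one_mem _, by simp⟩
    · exact ⟨_, γ_mem_gen hi, 0, zero_mem _, by simp⟩
  | algebraMap r => exact ⟨_, Subalgebra.algebraMap_mem _ r, 0, zero_mem _, by simp⟩
  | add x y _ _ hx hy =>
    obtain ⟨a, ha, b, hb, rfl⟩ := hx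
    obtain ⟨c, hc, d, hd, rfl⟩ := hy
    exact ⟨a + c, add_mem ha hc, b + d, add_mem hb hd, by rw [mul_add]; abel⟩
  | mul x y _ _ hx hy =>
    obtain ⟨a, ha, b, hb, rfl⟩ := hx
    obtain ⟨c, hc, d, hd, rfl⟩ := hy
    refine ⟨a * c + grade b * d, add_mem (mul_mem ha hc) (mul_mem (grade_mem_gen hb) hd),
      grade a * d + b * c, add_mem (mul_mem (grade_mem_gen ha) hd) (mul_mem hb hc), ?_⟩
    have h1 : a * (γ (e k) * d) = γ (e k) * (grade a * d) := by
      rw [← mul_assoc, gen_mul_γ ho ha, mul_assoc]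
    have h2 : γ (e k) * b * (γ (e k) * d) = grade b * d := by
      rw [mul_assoc, ← mul_assoc b, gen_mul_γ ho hb, mul_assoc, ← mul_assoc, hsq, one_mul]
    rw [add_mul, mul_add, mul_add, h1, h2, mul_add]
    rw [mul_assoc]; abel

lemma gen_empty {x : Cl V} (hx : x ∈ gen e ∅) : ∃ z : ℂ, x = algebraMap ℂ (Cl V) z := by
  simp only [gen, Finset.coe_empty, Set.image_empty, Algebra.adjoin_empty] at hx
  obtain ⟨z, rfl⟩ := Algebra.mem_bot.1 hx
  exact ⟨z, rfl⟩

lemma finite_gen (he : Orthonormal ℝ e) (s : Finset ι) :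
    (Subalgebra.toSubmodule (gen e s)).FG := by
  induction s using Finset.induction_on with
  | empty =>
    simp only [gen, Finset.coe_empty, Set.image_empty, Algebra.adjoin_empty]
    exact Subalgebra.fg_bot_toSubmodule
  | insert k s hk ih =>
    have : Subalgebra.toSubmodule (gen e (insert k s)) ≤ Subalgebra.toSubmodule (gen e s) ⊔
        (Subalgebra.toSubmodule (gen e s)).map (LinearMap.mulLeft ℂ (γ (e k))) := by
      intro x hx
      obtain ⟨a, ha, b, hb, rfl⟩ := exists_of_mem_gen_insert he hk hx
      exact Submodule.add_mem_sup ha ⟨b, hb, rfl⟩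
    exact Submodule.FG.of_le (ih.sup (ih.map _)) this

end Gen

section FiniteDim

variable [FiniteDimensional ℝ V]

lemma gen_basis_univ :
    gen (stdOrthonormalBasis ℝ V) (Finset.univ) = (⊤ : Subalgebra ℂ (Cl V)) := by
  rw [← adjoin_γ, eq_comm]
  apply le_antisymm
  · rw [Algebra.adjoin_le_iff]
    rintro _ ⟨v, rfl⟩
    have hlin : γ v = ∑ i, ((stdOrthonormalBasis ℝ V).repr v i : ℂ) •
        γ (stdOrthonormalBasis ℝ V i) := by
      have hγ : ∀ (c : ℝ) (w : V), γ (c • w) = (c : ℂ) • γ w := by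
        intro c w
        rw [Algebra.smul_def, algebraMap_def, γ, γ, mk_mul_mk, map_smul, mk, mk,
          TensorProduct.tmul_smul, TensorProduct.smul_tmul']
        simp
        rfl
      have hs : ∀ (f : Fin (Module.finrank ℝ V) → V), γ (∑ i, f i) = ∑ i, γ (f i) := fun f => by
        let g : V →+ Cl V :=
          { toFun := γ
            map_zero' := by rw [γ, map_zero, mk, TensorProduct.tmul_zero]; rfl
            map_add' := fun a b => by
              rw [γ, map_add, mk, TensorProduct.tmul_add]; rfl }
        exact map_sum g f _
      conv_lhs => rw [← (stdOrthonormalBasis ℝ V).sum_repr v]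
      rw [hs]
      simp [hγ]
    rw [hlin]
    exact sum_mem fun i _ => Subalgebra.smul_mem _ (γ_mem_gen (by simp)) _
  · refine Algebra.adjoin_mono ?_
    rintro _ ⟨i, -, rfl⟩
    exact ⟨_, rfl⟩

instance : Module.Finite ℂ (Cl V) := by
  constructor
  have := finite_gen (stdOrthonormalBasis ℝ V).orthonormal Finset.univ
  rwa [gen_basis_univ, Algebra.top_toSubmodule] at this

instance : Nontrivial (Cl V) := by
  have : Function.Injective (algebraMap ℂ (Cl V)) := by
    let f : Cl V →ₐ[ℂ] ℂ ⊗[ℝ] CliffordAlgebra (normForm V) := AlgHom.id ℂ _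
    have h := Algebra.TensorProduct.includeLeft_injective (S := ℂ) (R := ℝ) (A := ℂ)
      (B := CliffordAlgebra (normForm V)) (FaithfulSMul.algebraMap_injective ℝ (CliffordAlgebra (normForm V)))
    exact h
  exact this.nontrivial

/-- The normalised trace of left multiplication. -/
def tr : Cl V →ₗ[ℂ] ℂ :=
  (Module.finrank ℂ (Cl V) : ℂ)⁻¹ • LinearMap.trace ℂ (Cl V) ∘ₗ LinearMap.mul ℂ (Cl V)

lemma tr_apply (x : Cl V) : tr x = (Module.finrank ℂ (Cl V) : ℂ)⁻¹ *
    LinearMap.trace ℂ (Cl V) (LinearMap.mulLeft ℂ x) := rfl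

lemma tr_mul_comm (x y : Cl V) : tr (x * y) = tr (y * x) := by
  rw [tr_apply, tr_apply, LinearMap.mulLeft_mul, LinearMap.mulLeft_mul]
  rw [← Module.End.mul_eq_comp, ← Module.End.mul_eq_comp, LinearMap.trace_mul_comm]

lemma tr_algebraMap (z : ℂ) : tr (algebraMap ℂ (Cl V) z) = z := by
  have h : LinearMap.mulLeft ℂ (algebraMap ℂ (Cl V) z) = z • LinearMap.id := by
    ext x; simp [Algebra.smul_def]
  have h0 : (Module.finrank ℂ (Cl V) : ℂ) ≠ 0 := by
    exact_mod_cast (Module.finrank_pos).ne'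
  rw [tr_apply, h, map_smul, LinearMap.trace_id, smul_eq_mul]
  field_simp

lemma tr_mapEquiv (u : V ≃ₗᵢ[ℝ] V) (x : Cl V) : tr (map u x) = tr x := by
  have h : LinearMap.mulLeft ℂ (map u x) =
      (mapEquiv u).toLinearEquiv.conj (LinearMap.mulLeft ℂ x) := by
    ext y
    have h1 : (mapEquiv u).toLinearEquiv.conj (LinearMap.mulLeft ℂ x) y =
      map u (x * map u.symm y) := rfl
    have h2 : map u (map u.symm y) = y := (mapEquiv u).apply_symm_apply y
    rw [h1, map_mul, h2]; rfl
  rw [tr_apply, tr_apply, h, LinearMap.trace_conj']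

lemma tr_γ_mul {ι : Type*} [DecidableEq ι] {e : ι → V} {s : Finset ι} {v : V}
    (hv : ∀ i ∈ s, inner ℝ v (e i) = 0) {x : Cl V} (hx : x ∈ gen e s) : tr (γ v * x) = 0 := by
  let u : V ≃ₗᵢ[ℝ] V := (ℝ ∙ v)ᗮ.reflection
  have huv : u v = - v := Submodule.reflection_orthogonalComplement_singleton_eq_neg v
  have hx' : map u x = x := by
    induction hx using Algebra.adjoin_induction with
    | mem x hx =>
      obtain ⟨i, hi, rfl⟩ := hx
      rw [map_γ]
      congr 1
      exact Submodule.reflection_mem_subspace_eq_self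
        (Submodule.mem_orthogonal_singleton_iff_inner_right.2 (hv i (by simpa using hi)))
    | algebraMap r => simp
    | add x y _ _ hx hy => rw [map_add, hx, hy]
    | mul x y _ _ hx hy => rw [map_mul, hx, hy]
  have hneg : γ (-v) = - γ v := by
    rw [γ, map_neg, mk, TensorProduct.tmul_neg]; rfl
  have h := tr_mapEquiv u (γ v * x)
  rw [map_mul, map_γ, huv, hx', hneg, neg_mul, map_neg] at h
  exact self_eq_neg.1 h.symm

lemma tr_star (x : Cl V) : tr (star x) = starRingEnd ℂ (tr x) := by
  let e := stdOrthonormalBasis ℝ V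
  have key : ∀ s : Finset (Fin (Module.finrank ℝ V)), ∀ x ∈ gen e s,
      tr (star x) = starRingEnd ℂ (tr x) := by
    intro s
    induction s using Finset.induction_on with
    | empty =>
      intro x hx
      obtain ⟨z, rfl⟩ := gen_empty hx
      rw [← algebraMap_star_comm, tr_algebraMap, tr_algebraMap]; rfl
    | insert k s hk ih =>
      intro x hx
      obtain ⟨a, ha, b, hb, rfl⟩ := exists_of_mem_gen_insert e.orthonormal hk hx
      have ho : ∀ i ∈ s, inner ℝ (e k) (e i) = 0 := fun i hi =>
        e.orthonormal.2 (by rintro rfl; exact hk hi)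
      rw [star_add, star_mul, star_γ, map_add, map_add, map_add, ih a ha, tr_mul_comm,
        tr_γ_mul ho hb, tr_γ_mul ho (star_mem_gen hb), map_zero]
  exact key Finset.univ x (by rw [gen_basis_univ]; trivial)

open scoped ComplexOrder in
lemma tr_star_mul_self_pos {x : Cl V} (hx : x ≠ 0) : 0 < tr (star x * x) := by
  let e := stdOrthonormalBasis ℝ V
  have key : ∀ s : Finset (Fin (Module.finrank ℝ V)), ∀ x ∈ gen e s, x ≠ 0 →
      0 < tr (star x * x) := by
    intro s
    induction s using Finset.induction_on with
    | empty =>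
      intro x hx h0
      obtain ⟨z, rfl⟩ := gen_empty hx
      have hz : z ≠ 0 := by rintro rfl; simp at h0
      rw [← algebraMap_star_comm, ← map_mul, tr_algebraMap]
      exact star_mul_self_pos (IsRegular.of_ne_zero hz)
    | insert k s hk ih =>
      intro x hx h0
      obtain ⟨a, ha, b, hb, rfl⟩ := exists_of_mem_gen_insert e.orthonormal hk hx
      have ho : ∀ i ∈ s, inner ℝ (e k) (e i) = 0 := fun i hi =>
        e.orthonormal.2 (by rintro rfl; exact hk hi)
      have hsq : γ (e k) * γ (e k) = 1 := by rw [γ_mul_self, e.orthonormal.1 k]; simp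
      have hb2 : star b * γ (e k) * (γ (e k) * b) = star b * b := by
        rw [mul_assoc, ← mul_assoc (γ (e k)), hsq, one_mul]
      have h1 : tr (star a * (γ (e k) * b)) = 0 := by
        rw [tr_mul_comm, mul_assoc]; exact tr_γ_mul ho (mul_mem hb (star_mem_gen ha))
      have h2 : tr (star b * γ (e k) * a) = 0 := by
        rw [mul_assoc, tr_mul_comm, mul_assoc]
        exact tr_γ_mul ho (mul_mem ha (star_mem_gen hb))
      have hn : ∀ y ∈ gen e s, 0 ≤ tr (star y * y) := fun y hy => by
        by_cases h : y = 0
        · simp [h]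
        · exact (ih y hy h).le
      rw [star_add, star_mul, star_γ, add_mul, mul_add, mul_add, map_add, map_add, map_add, hb2,
        h1, h2, add_zero, zero_add]
      by_cases h : a = 0
      · have hb0 : b ≠ 0 := by rintro rfl; simp [h] at h0
        exact add_pos_of_nonneg_of_pos (hn a ha) (ih b hb hb0)
      · exact add_pos_of_pos_of_nonneg (ih a ha h) (hn b hb)
  exact key Finset.univ x (by rw [gen_basis_univ]; trivial) hx

variable (V) in
/-- The Clifford algebra as a Hilbert space with the inner product `⟪x, y⟫ = tr (star x * y)`. -/
def Hilb : Type _ := Cl V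

instance : AddCommGroup (Hilb V) := inferInstanceAs (AddCommGroup (Cl V))
instance : Module ℂ (Hilb V) := inferInstanceAs (Module ℂ (Cl V))

/-- The identity map. -/
def toHilb : Cl V ≃ₗ[ℂ] Hilb V := LinearEquiv.refl ℂ (Cl V)

instance : Module.Finite ℂ (Hilb V) := Module.Finite.equiv toHilb

open scoped ComplexOrder in
variable (V) in
/-- The trace inner product. -/
@[reducible] def hilbCore : InnerProductSpace.Core ℂ (Hilb V) where
  inner x y := tr (star (toHilb.symm x) * toHilb.symm y)
  conj_inner_symm x y := by
    rw [← tr_star, star_mul, star_star]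
  re_inner_nonneg x := by
    by_cases h : toHilb.symm x = 0
    · simp [h]
    · exact (Complex.pos_iff.1 (tr_star_mul_self_pos h)).1.le
  add_left x y z := by
    rw [map_add, star_add, add_mul, map_add]
  smul_left x y z := by
    rw [map_smul, star_smul, smul_mul_assoc, map_smul]; rfl
  definite x h := by
    by_contra h0
    have h0' : toHilb.symm x ≠ 0 := by simpa using h0
    exact (tr_star_mul_self_pos h0').ne' h

instance : NormedAddCommGroup (Hilb V) := (hilbCore V).toNormedAddCommGroup
instance : InnerProductSpace ℂ (Hilb V) := InnerProductSpace.ofCore (hilbCore V).toCore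
instance : CompleteSpace (Hilb V) := FiniteDimensional.complete ℂ _

lemma inner_hilb (x y : Hilb V) : inner ℂ x y = tr (star (toHilb.symm x) * toHilb.symm y) := rfl

/-- The left regular representation of the Clifford algebra on its Hilbert space. -/
def leftReg : Cl V →ₐ[ℂ] (Hilb V →L[ℂ] Hilb V) :=
  AlgHom.ofLinearMap
    ((LinearMap.toContinuousLinearMap : (Hilb V →ₗ[ℂ] Hilb V) ≃ₗ[ℂ] _).toLinearMap ∘ₗ
      (toHilb (V := V)).conj.toLinearMap ∘ₗ LinearMap.mul ℂ (Cl V))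
    (by ext x; simp [LinearEquiv.conj_apply])
    (fun x y => by ext z; simp [LinearEquiv.conj_apply, mul_assoc])

lemma leftReg_apply (x : Cl V) (y : Hilb V) : leftReg x y = toHilb (x * toHilb.symm y) := rfl

lemma leftReg_injective : Function.Injective (leftReg (V := V)) := fun x y h => by
  have := congrArg (fun f => f (toHilb (1 : Cl V))) h
  simpa [leftReg_apply] using this

lemma leftReg_star (x : Cl V) : leftReg (star x) = star (leftReg x) := by
  rw [ContinuousLinearMap.star_eq_adjoint, ContinuousLinearMap.eq_adjoint_iff]
  intro a b
  simp [leftReg_apply, inner_hilb, mul_assoc]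

/-- The C⋆-norm on the Clifford algebra: the operator norm in the left regular representation. -/
instance : NormedRing (Cl V) :=
  NormedRing.induced (Cl V) (Hilb V →L[ℂ] Hilb V) leftReg leftReg_injective

lemma norm_def (x : Cl V) : ‖x‖ = ‖leftReg x‖ := rfl

instance : NormedAlgebra ℂ (Cl V) where
  norm_smul_le z x := by rw [norm_def, norm_def, map_smul]; exact norm_smul_le z (leftReg x)

instance : CStarRing (Cl V) where
  norm_mul_self_le x := by
    rw [norm_def, norm_def, map_mul, leftReg_star]
    exact CStarRing.norm_mul_self_le (leftReg x)

instance : CompleteSpace (Cl V) := FiniteDimensional.complete ℂ _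

instance : CStarAlgebra (Cl V) where


/-! ### Isometries induce isometries -/

variable [FiniteDimensional ℝ W]

lemma norm_map (u : V ≃ₗᵢ[ℝ] W) (x : Cl V) : ‖map u x‖ = ‖x‖ := by
  let φ : Cl V →⋆ₐ[ℂ] Cl W := { map u with map_star' := map_star u }
  exact NonUnitalStarAlgHom.norm_map φ (mapEquiv u).injective x

lemma conjMap_conjMap {U : Type*} [NormedAddCommGroup U] [InnerProductSpace ℝ U]
    (u : V ≃ₗᵢ[ℝ] W) (w : W ≃ₗᵢ[ℝ] U) (x : Cl V) :
    conjMap w (conjMap u x) = map (u.trans w) x := by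
  induction x using Cl.induction with
  | hadd x y hx hy => simp [hx, hy]
  | hmk z c =>
    rw [conjMap_mk, conjMap_mk, ← map_map, map_mk, map_mk, Complex.conj_conj]

lemma conjMap_map {U : Type*} [NormedAddCommGroup U] [InnerProductSpace ℝ U]
    (u : V ≃ₗᵢ[ℝ] W) (w : W ≃ₗᵢ[ℝ] U) (x : Cl V) :
    conjMap w (map u x) = conjMap (u.trans w) x := by
  induction x using Cl.induction with
  | hadd x y hx hy => simp [hx, hy]
  | hmk z c => rw [map_mk, conjMap_mk, conjMap_mk, ← map_mk (u.trans w), ← map_map, map_mk, map_mk]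

lemma map_conjMap {U : Type*} [NormedAddCommGroup U] [InnerProductSpace ℝ U]
    (u : V ≃ₗᵢ[ℝ] W) (w : W ≃ₗᵢ[ℝ] U) (x : Cl V) :
    map w (conjMap u x) = conjMap (u.trans w) x := by
  have h : conjMap u x = conjMap (LinearIsometryEquiv.refl ℝ W) (map u x) := by
    induction x using Cl.induction with
    | hadd x y hx hy => simp [hx, hy]
    | hmk z c =>
      rw [conjMap_mk, map_mk, conjMap_mk, ← map_mk, ← map_mk, ← map_mk, map_refl]; rfl
  have h'' : ∀ y : Cl W, map w (conjMap (LinearIsometryEquiv.refl ℝ W) y) = conjMap w y := by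
    intro y
    induction y using Cl.induction with
    | hadd x y hx hy => simp [hx, hy]
    | hmk z c => rw [conjMap_mk, conjMap_mk, ← map_mk, map_refl, AlgHom.id_apply, map_mk]
  rw [h, h'', conjMap_map]

lemma conjMap_star (u : V ≃ₗᵢ[ℝ] W) (x : Cl V) : conjMap u (star x) = star (conjMap u x) := by
  have h : ∀ y : Cl V, conjMap u y = map u (conjMap (LinearIsometryEquiv.refl ℝ V) y) := by
    intro y; rw [map_conjMap]; congr 1
  have h' : ∀ y : Cl V, conjMap (LinearIsometryEquiv.refl ℝ V) (star y) =
      star (conjMap (LinearIsometryEquiv.refl ℝ V) y) := by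
    intro y
    induction y using Cl.induction with
    | hadd x y hx hy => simp [hx, hy]
    | hmk z c =>
      have h0 : ∀ (z : ℂ) (c : CliffordAlgebra (normForm V)),
          conjMap (LinearIsometryEquiv.refl ℝ V) (mk z c) = mk (starRingEnd ℂ z) c := by
        intro z c; rw [conjMap_mk, ← map_mk, map_refl]; rfl
      rw [star_mk, h0, h0, star_mk]
  rw [h, h, h', map_star]

lemma tr_conjMap (u : V ≃ₗᵢ[ℝ] W) (x : Cl V) : tr (conjMap u x) = starRingEnd ℂ (tr x) := by
  let e := stdOrthonormalBasis ℝ V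
  have hmem : ∀ s : Finset (Fin (Module.finrank ℝ V)), ∀ x ∈ gen e s,
      conjMap u x ∈ gen (fun i => u (e i)) s := by
    intro s x hx
    induction hx using Algebra.adjoin_induction with
    | mem x hx =>
      obtain ⟨i, hi, rfl⟩ := hx
      rw [conjMap_γ]; exact γ_mem_gen (e := fun i => u (e i)) (by simpa using hi)
    | algebraMap r =>
      rw [Algebra.algebraMap_eq_smul_one, conjMap_smul, map_one]
      exact Subalgebra.smul_mem _ (one_mem _) _
    | add x y _ _ hx hy => rw [map_add]; exact add_mem hx hy
    | mul x y _ _ hx hy => rw [map_mul]; exact mul_mem hx hy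
  have key : ∀ s : Finset (Fin (Module.finrank ℝ V)), ∀ x ∈ gen e s,
      tr (conjMap u x) = starRingEnd ℂ (tr x) := by
    intro s
    induction s using Finset.induction_on with
    | empty =>
      intro x hx
      obtain ⟨z, rfl⟩ := gen_empty hx
      rw [Algebra.algebraMap_eq_smul_one, conjMap_smul, map_one, ← Algebra.algebraMap_eq_smul_one,
        ← Algebra.algebraMap_eq_smul_one, tr_algebraMap, tr_algebraMap]
    | insert k s hk ih =>
      intro x hx
      obtain ⟨a, ha, b, hb, rfl⟩ := exists_of_mem_gen_insert e.orthonormal hk hx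
      have ho : ∀ i ∈ s, inner ℝ (e k) (e i) = 0 := fun i hi =>
        e.orthonormal.2 (by rintro rfl; exact hk hi)
      have ho' : ∀ i ∈ s, inner ℝ (u (e k)) (u (e i)) = 0 := fun i hi => by
        rw [u.inner_map_map]; exact ho i hi
      rw [map_add, map_mul, conjMap_γ, map_add, map_add, map_add, ih a ha,
        tr_γ_mul ho' (hmem s b hb), tr_γ_mul ho hb, map_zero]
  exact key Finset.univ x (by rw [gen_basis_univ]; trivial)

lemma norm_conjMap_le (u : V ≃ₗᵢ[ℝ] W) (x : Cl V) : ‖conjMap u x‖ ≤ ‖x‖ := by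
  have hn : ∀ y : Cl V, ‖toHilb (conjMap u y)‖ = ‖toHilb y‖ := by
    intro y
    have h2 : ‖toHilb (conjMap u y)‖ ^ 2 = (tr (star (conjMap u y) * conjMap u y)).re := by
      rw [← inner_self_eq_norm_sq (𝕜 := ℂ)]; rfl
    have h1 : ‖toHilb y‖ ^ 2 = (tr (star y * y)).re := by
      rw [← inner_self_eq_norm_sq (𝕜 := ℂ)]; rfl
    rw [← conjMap_star, ← map_mul, tr_conjMap, Complex.conj_re, ← h1] at h2
    exact (sq_eq_sq₀ (norm_nonneg _) (norm_nonneg _)).1 h2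
  rw [norm_def, norm_def]
  refine ContinuousLinearMap.opNorm_le_bound _ (norm_nonneg _) fun η => ?_
  obtain ⟨y, rfl⟩ : ∃ y : Cl V, toHilb (conjMap u y) = η :=
    ⟨conjMap u.symm (toHilb.symm η), by rw [conjMap_conjMap]; simp [map_refl]⟩
  rw [leftReg_apply, LinearEquiv.symm_apply_apply, ← map_mul, hn, hn]
  exact (leftReg x).le_opNorm (toHilb y)

lemma continuous_conjMap (u : V ≃ₗᵢ[ℝ] W) : Continuous (conjMap u : Cl V → Cl W) :=
  AddMonoidHomClass.continuous_of_bound (conjMap u) 1 (by simpa using norm_conjMap_le u)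

lemma grade_star (x : Cl V) : grade (star x) = star (grade x) := by
  induction x using Cl.induction with
  | hadd x y hx hy => simp [hx, hy]
  | hmk z c =>
    rw [star_mk, grade_mk, grade_mk, star_mk, CliffordAlgebra.reverse_involute]

lemma grade_grade (x : Cl V) : grade (grade x) = x := by
  induction x using Cl.induction with
  | hadd x y hx hy => simp [hx, hy]
  | hmk z c => rw [grade_mk, grade_mk, CliffordAlgebra.involute_involute]

lemma grade_map (u : V ≃ₗᵢ[ℝ] W) (x : Cl V) : grade (map u x) = map u (grade x) := by
  have : grade.comp (map u) = (map u).comp grade := by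
    ext v; simp only [AlgHom.comp_apply, map_γ, grade_γ, _root_.map_neg]
  exact congrArg (fun f => f x) this

lemma norm_grade (x : Cl V) : ‖grade x‖ = ‖x‖ := by
  let φ : Cl V →⋆ₐ[ℂ] Cl V := { grade with map_star' := grade_star }
  exact NonUnitalStarAlgHom.norm_map φ (Function.LeftInverse.injective grade_grade) x

end FiniteDim

end Cl
end Clifford
section Bundles

open Bundle Filter Topology

variable (𝕜 : Type*) [RCLike 𝕜] {X : Type*} [TopologicalSpace X]

section

variable (V : X → Type*) [∀ x, NormedAddCommGroup (V x)] [∀ x, InnerProductSpace 𝕜 (V x)]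
  [TopologicalSpace (TotalSpace Unit V)]

/-- A local trivialisation, isometric on the fibres, of a family of inner product spaces `V x` with
a topology on the total space (the argument `Unit` of `TotalSpace` plays no role). -/
structure IsometricTriv (n : ℕ) where
  baseSet : Set X
  isOpen_baseSet : IsOpen baseSet
  coord : ∀ x : baseSet, V x ≃ₗᵢ[𝕜] EuclideanSpace 𝕜 (Fin n)
  continuous_coord :
    Continuous fun p : {p : TotalSpace Unit V // p.proj ∈ baseSet} => coord ⟨p.1.proj, p.2⟩ p.1.snd
  continuous_coord_symm :
    Continuous fun q : baseSet × EuclideanSpace 𝕜 (Fin n) =>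
      (⟨q.1, (coord q.1).symm q.2⟩ : TotalSpace Unit V)

/-- `V` is a locally trivial vector bundle of finite (locally constant) rank with a continuous inner
product on the fibres. By the Gram-Schmidt process, such a bundle is locally isometrically
trivial. -/
class IsMetricBundle : Prop where
  continuous_proj : Continuous (TotalSpace.proj : TotalSpace Unit V → X)
  exists_triv : ∀ x : X, ∃ (n : ℕ) (e : IsometricTriv 𝕜 V n), x ∈ e.baseSet

instance IsMetricBundle.finiteDimensional [IsMetricBundle 𝕜 V] (x : X) :
    FiniteDimensional 𝕜 (V x) := by
  obtain ⟨n, e, hx⟩ := IsMetricBundle.exists_triv (𝕜 := 𝕜) (V := V) x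
  exact Module.Finite.equiv (e.coord ⟨x, hx⟩).symm.toLinearEquiv

variable {V}

/-- A section is continuous as a map into the total space. -/
def ContinuousSection (s : ∀ x, V x) : Prop := Continuous fun x => (⟨x, s x⟩ : TotalSpace Unit V)

lemma continuousSection_iff [IsMetricBundle 𝕜 V] {s : ∀ x, V x} :
    ContinuousSection s ↔
      ∀ (n : ℕ) (e : IsometricTriv 𝕜 V n), Continuous fun x : e.baseSet => e.coord x (s x) := by
  constructor
  · intro h n e
    exact e.continuous_coord.comp
      (Continuous.subtype_mk (h.comp continuous_subtype_val) fun x => x.2)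
  · intro h
    rw [ContinuousSection, continuous_iff_continuousAt]
    intro x
    obtain ⟨n, e, hx⟩ := IsMetricBundle.exists_triv (𝕜 := 𝕜) (V := V) x
    have h1 := e.continuous_coord_symm.comp (continuous_id.prodMk (h n e))
    have h2 : Continuous fun y : e.baseSet => (⟨y, s y⟩ : TotalSpace Unit V) := by
      refine h1.congr fun y => ?_
      simp
    exact (e.isOpen_baseSet.isOpenEmbedding_subtypeVal.continuousAt_iff (x := ⟨x, hx⟩)).1
      h2.continuousAt

variable (V) in
/-- The space `C₀(X, V)` of continuous sections of `V` that vanish at infinity. -/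
def C0Section [IsMetricBundle 𝕜 V] : Submodule 𝕜 (∀ x, V x) where
  carrier := {s | ContinuousSection s ∧ Tendsto (fun x => ‖s x‖) (cocompact X) (𝓝 0)}
  zero_mem' := ⟨(continuousSection_iff 𝕜).2 fun n e => by simpa using continuous_const,
    by simpa using tendsto_const_nhds⟩
  add_mem' {s t} hs ht := by
    refine ⟨(continuousSection_iff 𝕜).2 fun n e => ?_, ?_⟩
    · simp only [Pi.add_apply, map_add]
      exact ((continuousSection_iff 𝕜).1 hs.1 n e).add ((continuousSection_iff 𝕜).1 ht.1 n e)
    · exact squeeze_zero (fun x => norm_nonneg _) (fun x => norm_add_le (s x) (t x))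
        (by simpa using hs.2.add ht.2)
  smul_mem' c s hs := by
    refine ⟨(continuousSection_iff 𝕜).2 fun n e => ?_, ?_⟩
    · simp only [Pi.smul_apply, map_smul]
      exact ((continuousSection_iff 𝕜).1 hs.1 n e).const_smul c
    · simpa [norm_smul] using hs.2.const_mul ‖c‖

end

end Bundles

section Real

open Bundle Filter Topology

/-- A "real" structure on a topological space, that is, a continuous involution. -/
structure RealStructure (X : Type*) [TopologicalSpace X] where
  toFun : X → X
  continuous_toFun : Continuous toFun
  involutive : Function.Involutive toFun

instance (X : Type*) [TopologicalSpace X] : CoeFun (RealStructure X) fun _ => X → X :=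
  ⟨RealStructure.toFun⟩

variable {X : Type*} [TopologicalSpace X]

/-- The involution as a homeomorphism. -/
def RealStructure.homeo (r : RealStructure X) : X ≃ₜ X where
  toFun := r
  invFun := r
  left_inv := r.involutive
  right_inv := r.involutive
  continuous_toFun := r.continuous_toFun
  continuous_invFun := r.continuous_toFun

lemma RealStructure.tendsto (r : RealStructure X) : Tendsto r (cocompact X) (cocompact X) :=
  (r.homeo.map_cocompact).le

/-- A `ℤ/2`-equivariant (Euclidean) real vector bundle over a "real" space. -/
structure EquivariantBundle (r : RealStructure X) where
  fiber : X → Type*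
  [normed : ∀ x, NormedAddCommGroup (fiber x)]
  [innerProduct : ∀ x, InnerProductSpace ℝ (fiber x)]
  [topology : TopologicalSpace (TotalSpace Unit fiber)]
  [metricBundle : IsMetricBundle ℝ fiber]
  /-- The action of the generator of `ℤ/2`. -/
  inv : ∀ x, fiber x ≃ₗᵢ[ℝ] fiber (r x)
  inv_inv : Function.Involutive
    fun p : TotalSpace Unit fiber => (⟨r p.proj, inv p.proj p.snd⟩ : TotalSpace Unit fiber)
  continuous_inv : Continuous
    fun p : TotalSpace Unit fiber => (⟨r p.proj, inv p.proj p.snd⟩ : TotalSpace Unit fiber)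

attribute [instance] EquivariantBundle.normed EquivariantBundle.innerProduct
  EquivariantBundle.topology EquivariantBundle.metricBundle

/-- A `ℤ/2`-graded "real" (Hermitian) complex line bundle over a "real" space. -/
structure RealLineBundle (r : RealStructure X) where
  fiber : X → Type*
  [normed : ∀ x, NormedAddCommGroup (fiber x)]
  [innerProduct : ∀ x, InnerProductSpace ℂ (fiber x)]
  [topology : TopologicalSpace (TotalSpace Unit fiber)]
  [metricBundle : IsMetricBundle ℂ fiber]
  finrank_fiber : ∀ x, Module.finrank ℂ (fiber x) = 1
  /-- The grading involution, which is `1` on the even and `-1` on the odd part. -/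
  grade : ∀ x, fiber x ≃ₗᵢ[ℂ] fiber x
  grade_grade : ∀ x v, grade x (grade x v) = v
  continuous_grade : Continuous
    fun p : TotalSpace Unit fiber => (⟨p.proj, grade p.proj p.snd⟩ : TotalSpace Unit fiber)
  /-- The conjugate-linear "real" involution. -/
  conj : ∀ x, fiber x ≃ₛₗᵢ[starRingEnd ℂ] fiber (r x)
  conj_conj : Function.Involutive
    fun p : TotalSpace Unit fiber => (⟨r p.proj, conj p.proj p.snd⟩ : TotalSpace Unit fiber)
  continuous_conj : Continuous
    fun p : TotalSpace Unit fiber => (⟨r p.proj, conj p.proj p.snd⟩ : TotalSpace Unit fiber)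
  conj_grade : ∀ x v, conj x (grade x v) = grade (r x) (conj x v)

attribute [instance] RealLineBundle.normed RealLineBundle.innerProduct
  RealLineBundle.topology RealLineBundle.metricBundle

/-- A family of maps `f x : V x → V (r x)` over an involution `r` that is involutive on the total
space satisfies `f (r x) = (f x)⁻¹` (up to the identification of `V (r (r x))` with `V x`). -/
lemma totalSpace_symm_eq {V : X → Type*} (r : RealStructure X) (f : ∀ x, V x ≃ V (r x))
    (hf : Function.Involutive
      fun p : TotalSpace Unit V => (⟨r p.proj, f p.proj p.snd⟩ : TotalSpace Unit V))
    (x : X) (w : V (r x)) :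
    (⟨x, (f x).symm w⟩ : TotalSpace Unit V) = ⟨r (r x), f (r x) w⟩ := by
  have h := hf ⟨x, (f x).symm w⟩
  simpa using h.symm

namespace RealLineBundle

variable {r : RealStructure X}

/-- An isomorphism of `ℤ/2`-graded "real" line bundles. -/
structure Iso (L : RealLineBundle r) (L' : RealLineBundle r) where
  toFun : ∀ x, L.fiber x ≃ₗᵢ[ℂ] L'.fiber x
  continuous_toFun : Continuous fun p : TotalSpace Unit L.fiber =>
    (⟨p.proj, toFun p.proj p.snd⟩ : TotalSpace Unit L'.fiber)
  continuous_symm : Continuous fun p : TotalSpace Unit L'.fiber =>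
    (⟨p.proj, (toFun p.proj).symm p.snd⟩ : TotalSpace Unit L.fiber)
  map_grade : ∀ x v, toFun x (L.grade x v) = L'.grade x (toFun x v)
  map_conj : ∀ x v, toFun (r x) (L.conj x v) = L'.conj x (toFun x v)

variable (L : RealLineBundle r)

/-- The space `C₀(X, L)`. -/
abbrev Sections := C0Section ℂ L.fiber

/-- The grading on `C₀(X, L)`. -/
def gradeSection (s : L.Sections) : L.Sections :=
  ⟨fun x => L.grade x (s.1 x), L.continuous_grade.comp s.2.1, by simpa using s.2.2⟩

/-- The "real" structure on `C₀(X, L)`: the section `x ↦ 𝔯 (s (r x))`, where the "real" involution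
`L.fiber (r x) → L.fiber x` is the inverse of `L.conj x`. -/
def conjSection (s : L.Sections) : L.Sections :=
  ⟨fun x => (L.conj x).symm (s.1 (r x)), by
    have h := L.continuous_conj.comp (s.2.1.comp r.continuous_toFun)
    refine h.congr fun x => ?_
    exact (totalSpace_symm_eq r (fun x => (L.conj x).toEquiv) L.conj_conj x _).symm, by
    simp only [LinearIsometryEquiv.norm_map]
    exact s.2.2.comp r.tendsto⟩

end RealLineBundle

namespace EquivariantBundle

variable {r : RealStructure X} (E : EquivariantBundle r)

/-- The local trivialisation over `r ⁻¹ (U)` induced by one over `U`. -/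
def pullTriv {n : ℕ} (e : IsometricTriv ℝ E.fiber n) : IsometricTriv ℝ E.fiber n where
  baseSet := r ⁻¹' e.baseSet
  isOpen_baseSet := e.isOpen_baseSet.preimage r.continuous_toFun
  coord x := (E.inv x).trans (e.coord ⟨r x, x.2⟩)
  continuous_coord := e.continuous_coord.comp
    (Continuous.subtype_mk (E.continuous_inv.comp continuous_subtype_val) fun p => p.2)
  continuous_coord_symm := by
    have h0 : Continuous fun x : r ⁻¹' e.baseSet => (⟨r x, x.2⟩ : e.baseSet) :=
      (r.continuous_toFun.comp continuous_subtype_val).subtype_mk _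
    have h := E.continuous_inv.comp (e.continuous_coord_symm.comp (h0.prodMap continuous_id))
    refine h.congr fun q => ?_
    exact (totalSpace_symm_eq r (fun x => (E.inv x).toEquiv) E.inv_inv _ _).symm

/-- A section of the Clifford algebra bundle is continuous if it is so in local isometric
trivialisations of `E`, which identify the Clifford algebra bundle with a trivial bundle. -/
def ContinuousCl (f : ∀ x, Cl (E.fiber x)) : Prop :=
  ∀ (n : ℕ) (e : IsometricTriv ℝ E.fiber n),
    Continuous fun x : e.baseSet => Cl.map (e.coord x) (f x)

/-- The `ℤ/2`-graded "real" C⋆-algebra `C₀(X, Cl_E)` of continuous sections vanishing at infinity of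
the Clifford algebra bundle of `E`, with pointwise operations. -/
def ClSection : NonUnitalStarSubalgebra ℂ (∀ x, Cl (E.fiber x)) where
  carrier := {f | E.ContinuousCl f ∧ Tendsto (fun x => ‖f x‖) (cocompact X) (𝓝 0)}
  zero_mem' := ⟨fun n e => by simpa using continuous_const, by simpa using tendsto_const_nhds⟩
  add_mem' {f g} hf hg := by
    refine ⟨fun n e => by
      simp only [Pi.add_apply, map_add]; exact (hf.1 n e).add (hg.1 n e), ?_⟩
    exact squeeze_zero (fun x => norm_nonneg _) (fun x => norm_add_le (f x) (g x))
      (by simpa using hf.2.add hg.2)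
  mul_mem' {f g} hf hg := by
    refine ⟨fun n e => by
      simp only [Pi.mul_apply, map_mul]; exact (hf.1 n e).mul (hg.1 n e), ?_⟩
    exact squeeze_zero (fun x => norm_nonneg _) (fun x => norm_mul_le (f x) (g x))
      (by simpa using hf.2.mul hg.2)
  smul_mem' c f hf := by
    refine ⟨fun n e => by
      simp only [Pi.smul_apply, map_smul]; exact (hf.1 n e).const_smul c, ?_⟩
    simpa [norm_smul] using hf.2.const_mul ‖c‖
  star_mem' {f} hf := by
    refine ⟨fun n e => by
      simp only [Pi.star_apply, Cl.map_star]; exact (hf.1 n e).star, ?_⟩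
    exact hf.2.congr fun x => (norm_star (f x)).symm

/-- The grading on `C₀(X, Cl_E)`. -/
def gradeCl (f : E.ClSection) : E.ClSection :=
  ⟨fun x => Cl.grade (f.1 x), by
    intro n e
    simp only [← Cl.grade_map]
    exact (LinearMap.continuous_of_finiteDimensional (Cl.grade.toLinearMap)).comp (f.2.1 n e), by
    simpa [Cl.norm_grade] using f.2.2⟩

/-- The "real" structure on `C₀(X, Cl_E)`: the section `x ↦ 𝔯 (f (r x))`, where
`𝔯 : Cl (E.fiber (r x)) → Cl (E.fiber x)` is the conjugate-linear extension of the `ℤ/2`-action. -/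
def conjCl (f : E.ClSection) : E.ClSection :=
  ⟨fun x => Cl.conjMap (E.inv x).symm (f.1 (r x)), by
    intro n e
    have hr : ∀ x : e.baseSet, r x ∈ (E.pullTriv e).baseSet := fun x => by
      change r (r x) ∈ e.baseSet
      rw [r.involutive]; exact x.2
    have h0 : Continuous fun x : e.baseSet => (⟨r x, hr x⟩ : (E.pullTriv e).baseSet) :=
      (r.continuous_toFun.comp continuous_subtype_val).subtype_mk _
    refine ((Cl.continuous_conjMap (LinearIsometryEquiv.refl ℝ _)).comp ((f.2.1 n (E.pullTriv e)).comp h0)).congr fun x => ?_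
    have h1 : (E.inv x).symm.trans (e.coord x) = (E.pullTriv e).coord ⟨r x, hr x⟩ := by
      ext1 w
      have h2 : ∀ p q : {p : TotalSpace Unit E.fiber // p.proj ∈ e.baseSet}, p = q →
          e.coord ⟨p.1.proj, p.2⟩ p.1.snd = e.coord ⟨q.1.proj, q.2⟩ q.1.snd := by
        rintro p _ rfl; rfl
      exact h2 ⟨⟨x, (E.inv x).symm w⟩, x.2⟩ ⟨⟨r (r x), E.inv (r x) w⟩, hr x⟩
        (Subtype.ext (totalSpace_symm_eq r (fun x => (E.inv x).toEquiv) E.inv_inv _ _))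
    rw [Cl.map_conjMap, h1, Function.comp_apply, Function.comp_apply, Cl.conjMap_map]
    rfl, by
    exact squeeze_zero (fun x => norm_nonneg _) (fun x => Cl.norm_conjMap_le _ _)
      (f.2.2.comp r.tendsto)⟩

end EquivariantBundle

section Morita

open scoped ZeroAtInfty

/-- The involution `(x, y) ↦ (x, -y)` of `ℝ^{a,b} = ℝ^a × ℝ^b`. -/
def reflAB (a b : ℕ) :
    EuclideanSpace ℝ (Fin a ⊕ Fin b) ≃ₗᵢ[ℝ] EuclideanSpace ℝ (Fin a ⊕ Fin b) :=
  LinearIsometryEquiv.piLpCongrRight 2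
    (Sum.elim (fun _ => LinearIsometryEquiv.refl ℝ ℝ) (fun _ => LinearIsometryEquiv.neg ℝ))

/-- The Clifford algebra `Cl_{a,b}` with self-adjoint generators `γ_1, …, γ_{a+b}`. -/
abbrev ClAB (a b : ℕ) : Type := Cl (EuclideanSpace ℝ (Fin a ⊕ Fin b))

/-- The "real" structure on `Cl_{a,b}`, for which `γ_1, …, γ_a` and `i γ_{a+1}, …, i γ_{a+b}` are
real. -/
def conjAB (a b : ℕ) : ClAB a b →+* ClAB a b := Cl.conjMap (reflAB a b)

variable (X) in
/-- The C⋆-algebra `C₀(X) ⊗ Cl_{a,b} = C₀(X, Cl_{a,b})`. -/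
abbrev TrivCl (a b : ℕ) : Type _ := C₀(X, ClAB a b)

/-- The grading on `C₀(X, Cl_{a,b})`. -/
def gradeTriv {a b : ℕ} (g : TrivCl X a b) : TrivCl X a b where
  toFun x := Cl.grade (g x)
  continuous_toFun :=
    (LinearMap.continuous_of_finiteDimensional (Cl.grade.toLinearMap)).comp g.continuous
  zero_at_infty' := by
    have h := (zero_at_infty g).norm
    rw [tendsto_zero_iff_norm_tendsto_zero]
    simpa [Cl.norm_grade] using h

/-- The "real" structure `(𝔯 g) x = 𝔯 (g (r x))` on `C₀(X, Cl_{a,b})`. -/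
def conjTriv (r : RealStructure X) {a b : ℕ} (g : TrivCl X a b) : TrivCl X a b where
  toFun x := conjAB a b (g (r x))
  continuous_toFun := (Cl.continuous_conjMap _).comp (g.continuous.comp r.continuous_toFun)
  zero_at_infty' := by
    have h := ((Cl.continuous_conjMap (reflAB a b)).tendsto 0).comp
      ((zero_at_infty g).comp r.tendsto)
    rwa [map_zero] at h

/-- The inclusion `C₀(X) → C₀(X, Cl_{a,b})`, `f ↦ f ⊗ 1`. -/
def scalarTriv (a b : ℕ) (f : C₀(X, ℂ)) : TrivCl X a b where
  toFun x := algebraMap ℂ (ClAB a b) (f x)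
  continuous_toFun := (continuous_algebraMap ℂ _).comp f.continuous
  zero_at_infty' := by
    have h := ((continuous_algebraMap ℂ (ClAB a b)).tendsto 0).comp (zero_at_infty f)
    rwa [map_zero] at h

variable {r : RealStructure X}

/-- The inclusion `C₀(X) → C₀(X, Cl_E)`, `f ↦ f ⊗ 1`. -/
def EquivariantBundle.scalarCl (E : EquivariantBundle r) (f : C₀(X, ℂ)) : E.ClSection :=
  ⟨fun x => algebraMap ℂ (Cl (E.fiber x)) (f x), by
    intro n e
    simp only [AlgHom.commutes]
    exact (continuous_algebraMap ℂ _).comp (f.continuous.comp continuous_subtype_val), by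
    have h := (zero_at_infty f).norm
    simpa [norm_algebraMap'] using h⟩

/-- A `KR`-orientation of `E`, with underlying Banach space `M`: a `ℤ/2`-graded, "real",
`C₀(X)`-linear Morita equivalence between `C₀(X, Cl_E)` and `C₀(X) ⊗ Cl_{a,b}`. -/
structure KROrientation (E : EquivariantBundle r) (a b : ℕ) (M : Type*) [NormedAddCommGroup M]
    [NormedSpace ℂ M] [CompleteSpace M] where
  /-- The left action: `lact f m = f · m`. -/
  lact : E.ClSection →ₗ[ℂ] M →ₗ[ℂ] M
  lact_mul : ∀ f g m, lact (f * g) m = lact f (lact g m)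
  /-- The right action: `ract g m = m · g`. -/
  ract : TrivCl X a b →ₗ[ℂ] M →ₗ[ℂ] M
  ract_mul : ∀ g h m, ract (g * h) m = ract h (ract g m)
  lact_ract : ∀ f g m, lact f (ract g m) = ract g (lact f m)
  /-- The left inner product with values in `C₀(X, Cl_E)`. -/
  linner : M →ₗ[ℂ] M →ₗ⋆[ℂ] E.ClSection
  linner_lact : ∀ f m m', linner (lact f m) m' = f * linner m m'
  star_linner : ∀ m m', star (linner m m') = linner m' m
  linner_nonneg : ∀ m, ∃ f, linner m m = star f * f
  linner_ract : ∀ g m m', linner (ract g m) m' = linner m (ract (star g) m')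
  /-- The right inner product with values in `C₀(X, Cl_{a,b})`. -/
  rinner : M →ₗ⋆[ℂ] M →ₗ[ℂ] TrivCl X a b
  rinner_ract : ∀ g m m', rinner m (ract g m') = rinner m m' * g
  star_rinner : ∀ m m', star (rinner m m') = rinner m' m
  rinner_nonneg : ∀ m, ∃ g, rinner m m = star g * g
  rinner_lact : ∀ f m m', rinner (lact f m) m' = rinner m (lact (star f) m')
  /-- `M` carries the Hilbert module norm. -/
  norm_sq : ∀ m, ‖m‖ ^ 2 = ‖rinner m m‖
  /-- The two inner products are compatible. -/
  linner_rinner : ∀ m m' m'', lact (linner m m') m'' = ract (rinner m' m'') m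
  /-- `M` is full as a left Hilbert module (the norm on `C₀(X, Cl_E)` is the supremum norm). -/
  linner_full : ∀ f : E.ClSection, ∀ ε : ℝ, 0 < ε →
    ∃ g ∈ Submodule.span ℂ (Set.range fun p : M × M => linner p.1 p.2),
      ∀ x, ‖f.1 x - g.1 x‖ < ε
  /-- `M` is full as a right Hilbert module. -/
  rinner_full : Dense
    (Submodule.span ℂ (Set.range fun p : M × M => rinner p.1 p.2) : Set (TrivCl X a b))
  /-- The left and right multiplication actions of `C₀(X)` agree. -/
  scalar : ∀ (f : C₀(X, ℂ)) m, lact (E.scalarCl f) m = ract (scalarTriv a b f) m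
  /-- The grading involution, which is `1` on the even and `-1` on the odd part. -/
  grade : M →ₗ[ℂ] M
  grade_grade : ∀ m, grade (grade m) = m
  grade_lact : ∀ f m, grade (lact f m) = lact (E.gradeCl f) (grade m)
  grade_ract : ∀ g m, grade (ract g m) = ract (gradeTriv g) (grade m)
  linner_grade : ∀ m m', linner (grade m) (grade m') = E.gradeCl (linner m m')
  rinner_grade : ∀ m m', rinner (grade m) (grade m') = gradeTriv (rinner m m')
  /-- The conjugate-linear "real" involution. -/
  conj : M →ₗ⋆[ℂ] M
  conj_conj : ∀ m, conj (conj m) = m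
  conj_grade : ∀ m, conj (grade m) = grade (conj m)
  conj_lact : ∀ f m, conj (lact f m) = lact (E.conjCl f) (conj m)
  conj_ract : ∀ g m, conj (ract g m) = ract (conjTriv r g) (conj m)
  linner_conj : ∀ m m', linner (conj m) (conj m') = E.conjCl (linner m m')
  rinner_conj : ∀ m m', rinner (conj m) (conj m') = conjTriv r (rinner m m')

/-- An isomorphism `L ⊗̂ M₁ ≅ M₂` of `ℤ/2`-graded "real" Hilbert bimodules, where `L ⊗̂ M₁` is the
graded tensor product over `X` with the line bundle `L`, that is, the completion of the algebraic
tensor product of `C₀(X, L)` and `M₁` for the inner product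
`⟪l ⊗ m, l' ⊗ m'⟫ = ⟪l, l'⟫ • ⟪m, m'⟫` with values in `C₀(X, Cl_{a,b})`, with the right action on
the factor `M₁`, with the left action `f (l ⊗ m) = (-1) ^ (|f| |l|) l ⊗ f m`, and with
the diagonal grading and "real" structure. A unitary from this completion onto `M₂` is the same as a
bilinear map that preserves the inner products and has dense linear span of its range. It preserves
the left inner products automatically because these are determined by
`⟪ξ, η⟫ ζ = ξ ⟪η, ζ⟫`. -/
structure TensorIso {E : EquivariantBundle r} {a b : ℕ}
    {M₁ : Type*} [NormedAddCommGroup M₁] [NormedSpace ℂ M₁] [CompleteSpace M₁]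
    {M₂ : Type*} [NormedAddCommGroup M₂] [NormedSpace ℂ M₂] [CompleteSpace M₂]
    (L : RealLineBundle r) (K₁ : KROrientation E a b M₁) (K₂ : KROrientation E a b M₂) where
  /-- The image of `l ⊗ m`. -/
  tmul : L.Sections →ₗ[ℂ] M₁ →ₗ[ℂ] M₂
  rinner_tmul : ∀ l l' m m' x,
    K₂.rinner (tmul l m) (tmul l' m') x = inner ℂ (l.1 x) (l'.1 x) • K₁.rinner m m' x
  dense : Dense
    (Submodule.span ℂ (Set.range fun p : L.Sections × M₁ => tmul p.1 p.2) : Set M₂)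
  ract_tmul : ∀ g l m, K₂.ract g (tmul l m) = tmul l (K₁.ract g m)
  lact_tmul_of_even : ∀ f, E.gradeCl f = f →
    ∀ l m, K₂.lact f (tmul l m) = tmul l (K₁.lact f m)
  lact_tmul_of_odd : ∀ f, E.gradeCl f = -f →
    ∀ l m, K₂.lact f (tmul l m) = tmul (L.gradeSection l) (K₁.lact f m)
  grade_tmul : ∀ l m, K₂.grade (tmul l m) = tmul (L.gradeSection l) (K₁.grade m)
  conj_tmul : ∀ l m, K₂.conj (tmul l m) = tmul (L.conjSection l) (K₁.conj m)

end Morita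

end Real

end KR

end

/-! The bundle `L` has as fibre over `x` the line of intertwiners from the fibre of `M₁` to that of
`M₂`, that is, of right module maps that supercommute with the left action. Three facts make this
work.

First, the space of intertwiners at `x` is at most one-dimensional and carries a metric. For
homogeneous `S` and `T`, the form `⟪S m, T n⟫` at `x` is invariant under both algebras up to parity
twists. Compatibility of the two inner products and fullness force it to be `⟪m, n⟫ * d` with a
fixed `d` in `Cl_{a,b}`. This `d` lies in the supercentre, which is `ℂ`
(`Cl.scalar_of_supercentral`), so it is a scalar, and it is zero if the parities differ
(`KROrientation.form_eq_smul`). The scalar `coef S T x` is the inner product on the line, and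
`Intertwiner.smul_sub_smul_mem_null` says that two intertwiners are proportional wherever one of
them is nonzero.

Secondly, some intertwiner is nonzero at any given point (`exists_intertwiner`). A homogeneous part
of a rank-one operator is right linear. It is made to supercommute with the members of a local
orthonormal frame of `E` one at a time, without becoming zero at the point
(`Adapted.exists_insert`), and is finally cut off to a global map.

Thirdly, evaluation `l ⊗ m ↦ l(m)` preserves inner products by the definition of the metric, and its
range spans a dense subspace because `M₁` is full (`dense_lineTensor`). Conversely, if `L' ⊗ M₁ ≅
M₂`, then a homogeneous section `l` of `L'` defines the intertwiner `m ↦ l ⊗ m`. This identifies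
`L'` isometrically with the line bundle of intertwiners (`TensorIso.lineBundleIso`), which gives
uniqueness.

The fibres of `M₁` and `M₂` are never formed as quotients. A statement over `x` is a congruence
modulo the submodule `Null x`, and elements congruent at all points are equal
(`KROrientation.eq_of_null`). -/

noncomputable section

set_option linter.unusedSectionVars false

namespace KR

open Bundle Filter Topology
open scoped ZeroAtInfty

section

/-! ### Supercentre, trace and norm of complex Clifford algebras. -/

namespace Cl

section Clifford

variable {V : Type*} [NormedAddCommGroup V] [InnerProductSpace ℝ V]

lemma γ_add (v w : V) : γ (v + w) = γ v + γ w := by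
  rw [γ, map_add, mk, TensorProduct.tmul_add]; rfl

lemma γ_smul (c : ℝ) (w : V) : γ (c • w) = (c : ℂ) • γ w := by
  rw [Algebra.smul_def, algebraMap_def, γ, γ, mk_mul_mk, map_smul, mk, mk,
    TensorProduct.tmul_smul, TensorProduct.smul_tmul']
  simp
  rfl

lemma γ_orthonormal_sq {ι : Type*} {e : ι → V} (he : Orthonormal ℝ e) (k : ι) :
    γ (e k) * γ (e k) = 1 := by
  rw [γ_mul_self, he.1 k]; simp

/-- The supercentre of the subalgebra generated by finitely many orthonormal vectors is `ℂ`. -/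
lemma scalar_of_mem_gen [FiniteDimensional ℝ V] {ι : Type*} [DecidableEq ι] {e : ι → V}
    (he : Orthonormal ℝ e)
    (s : Finset ι) : ∀ d ∈ gen e s, (∀ i ∈ s, γ (e i) * d = grade d * γ (e i)) →
      ∃ z : ℂ, d = algebraMap ℂ (Cl V) z := by
  induction s using Finset.induction_on with
  | empty => exact fun d hd _ => gen_empty hd
  | insert k s hk ih =>
    intro d hd hcomm
    obtain ⟨a, ha, b, hb, rfl⟩ := exists_of_mem_gen_insert he hk hd
    have ho : ∀ i ∈ s, inner ℝ (e k) (e i) = 0 := fun i hi =>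
      he.2 (by rintro rfl; exact hk hi)
    have hsq := γ_orthonormal_sq he k
    have hk' := hcomm k (Finset.mem_insert_self k s)
    have ha' : grade a * γ (e k) = γ (e k) * a := by
      rw [gen_mul_γ ho (grade_mem_gen ha), grade_grade]
    have hb' : grade b * γ (e k) = γ (e k) * b := by
      rw [gen_mul_γ ho (grade_mem_gen hb), grade_grade]
    -- With `d = a + γ_k b`, one has `γ_k d = γ_k a + b`, whereas `grade d * γ_k = γ_k a - b`. Hence
    -- supercommutation with `γ_k` removes the part of `d` that contains `γ_k`.
    have hb2 : b = -b := by
      rw [mul_add, ← mul_assoc, hsq, one_mul, map_add, map_mul, grade_γ, add_mul, ha', neg_mul,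
        neg_mul, mul_assoc, hb', ← mul_assoc, hsq, one_mul] at hk'
      exact add_left_cancel hk'
    have hb0 : b = 0 := by
      have h2 : (2 : ℂ) • b = 0 := by rw [two_smul]; nth_rewrite 2 [hb2]; exact add_neg_cancel b
      simpa using h2
    rw [hb0, mul_zero, add_zero] at hcomm ⊢
    exact ih a ha fun i hi => hcomm i (Finset.mem_insert_of_mem hi)

end Clifford

section FiniteDim

variable {V : Type*} [NormedAddCommGroup V] [InnerProductSpace ℝ V] [FiniteDimensional ℝ V]

/-- The supercentre of a complex Clifford algebra is `ℂ`. -/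
lemma scalar_of_supercentral (d : Cl V) (hd : ∀ v : V, γ v * d = grade d * γ v) :
    ∃ z : ℂ, d = algebraMap ℂ (Cl V) z :=
  scalar_of_mem_gen (stdOrthonormalBasis ℝ V).orthonormal Finset.univ d
    (by rw [gen_basis_univ]; trivial) fun i _ => hd _

open scoped ComplexOrder in
lemma tr_star_mul_self_nonneg (x : Cl V) : 0 ≤ tr (star x * x) := by
  by_cases hx : x = 0
  · simp [hx]
  · exact (tr_star_mul_self_pos hx).le

open scoped ComplexOrder in
lemma tr_star_mul_self_eq_zero {x : Cl V} (h : tr (star x * x) = 0) : x = 0 := by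
  by_contra hx
  exact (tr_star_mul_self_pos hx).ne' h

lemma norm_tr_le (x : Cl V) : ‖tr x‖ ≤ ‖x‖ := by
  have h1 : ‖toHilb (1 : Cl V)‖ = 1 := by
    have h2 : ‖toHilb (1 : Cl V)‖ ^ 2 = (tr (star (1 : Cl V) * 1)).re := by
      rw [← inner_self_eq_norm_sq (𝕜 := ℂ)]; rfl
    rw [star_one, one_mul, ← map_one (algebraMap ℂ (Cl V)), tr_algebraMap] at h2
    rw [Complex.one_re] at h2
    exact (pow_eq_one_iff_of_nonneg (norm_nonneg _) two_ne_zero).1 h2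
  -- The trace is the vector state of the unit vector `1` in the left regular representation.
  have h : tr x = inner ℂ (toHilb 1) (leftReg x (toHilb 1)) := by
    simp [leftReg_apply, inner_hilb]
  rw [h, norm_def]
  refine (norm_inner_le_norm _ _).trans ?_
  rw [h1, one_mul]
  simpa [h1] using (leftReg x).le_opNorm (toHilb 1)

lemma norm_γ (v : V) : ‖γ v‖ = ‖v‖ := by
  have h := CStarRing.norm_star_mul_self (x := γ v)
  rw [star_γ, γ_mul_self, norm_algebraMap', Complex.norm_real, Real.norm_eq_abs,
    abs_of_nonneg (by positivity), sq] at h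
  exact (mul_self_inj (norm_nonneg _) (norm_nonneg _)).1 h.symm

lemma continuous_γ : Continuous (γ : V → Cl V) :=
  AddMonoidHomClass.continuous_of_bound
    (⟨⟨γ, by simpa using γ_smul (0 : ℝ) (0 : V)⟩, γ_add⟩ : V →+ Cl V) 1
    (fun v => by simpa using (norm_γ v).le)

end FiniteDim

end Cl

end

section

/-! ### Cutoff functions and functions vanishing at infinity. -/

section Cutoff

variable {X : Type*} [TopologicalSpace X]

/-- A continuous function with compact support as a function vanishing at infinity. -/
def compactlySupported {F : Type*} [TopologicalSpace F] [Zero F] (h : X → F) (hc : Continuous h)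
    (hs : HasCompactSupport h) : C₀(X, F) where
  toFun := h
  continuous_toFun := hc
  zero_at_infty' := hs.is_zero_at_infty

lemma compactlySupported_apply {F : Type*} [TopologicalSpace F] [Zero F] (h : X → F)
    (hc : Continuous h) (hs : HasCompactSupport h) (x : X) : compactlySupported h hc hs x = h x :=
  rfl

lemma exists_cutoff [T2Space X] [LocallyCompactSpace X] {K U : Set X} (hK : IsCompact K)
    (hU : IsOpen U) (hKU : K ⊆ U) :
    ∃ χ : X → ℝ, Continuous χ ∧ HasCompactSupport χ ∧ tsupport χ ⊆ U ∧ (∀ x ∈ K, χ x = 1) ∧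
      (∀ x, 0 ≤ χ x) ∧ ∀ x, χ x ≤ 1 := by
  -- A Urysohn function for `K` and the complement of `interior k` has its closed support in `k`,
  -- hence in `U`.
  obtain ⟨k, k_comp, k_closed, sk, kt⟩ := exists_compact_closed_between hK hU hKU
  obtain ⟨χ, h1, h0, hs, hI⟩ := exists_continuous_one_zero_of_isCompact hK
    isOpen_interior.isClosed_compl (Set.disjoint_compl_right_iff_subset.mpr sk)
  refine ⟨χ, χ.continuous, hs, ?_, fun x hx => h1 hx, fun x => (hI x).1, fun x => (hI x).2⟩
  refine (closure_minimal (fun x hx => ?_) k_closed).trans kt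
  by_contra hxk
  exact hx (h0 fun hxi => hxk (interior_subset hxi))

lemma exists_c0_apply_eq_one [T2Space X] [LocallyCompactSpace X] (x : X) :
    ∃ h : C₀(X, ℂ), h x = 1 := by
  obtain ⟨χ, hc, hs, -, h1, -, -⟩ :=
    exists_cutoff (isCompact_singleton (x := x)) isOpen_univ (Set.subset_univ _)
  refine ⟨compactlySupported (fun y => (χ y : ℂ)) (Complex.continuous_ofReal.comp hc)
    (hs.comp_left (g := fun t : ℝ => (t : ℂ)) (by simp)), ?_⟩
  rw [compactlySupported_apply, h1 x rfl, Complex.ofReal_one]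

lemma c0_norm_apply_le {F : Type*} [NormedAddCommGroup F] (g : C₀(X, F)) (x : X) :
    ‖g x‖ ≤ ‖g‖ := by
  rw [← ZeroAtInftyContinuousMap.norm_toBCF_eq_norm]
  exact g.toBCF.norm_coe_le_norm x

lemma c0_norm_le {F : Type*} [NormedAddCommGroup F] (g : C₀(X, F)) {C : ℝ} (hC : 0 ≤ C)
    (h : ∀ x, ‖g x‖ ≤ C) : ‖g‖ ≤ C := by
  rw [← ZeroAtInftyContinuousMap.norm_toBCF_eq_norm]
  exact (BoundedContinuousFunction.norm_le hC).2 h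

end Cutoff

/-! ### Splitting a scalar function off a section of the Clifford bundle. -/

variable {X : Type*} [TopologicalSpace X] {r : RealStructure X} {E : EquivariantBundle r}

lemma EquivariantBundle.ContinuousCl.norm {f : ∀ x, Cl (E.fiber x)} (hf : E.ContinuousCl f) :
    Continuous fun x => ‖f x‖ := by
  rw [continuous_iff_continuousAt]
  intro x
  obtain ⟨n, e, hx⟩ := IsMetricBundle.exists_triv (𝕜 := ℝ) (V := E.fiber) x
  have h : Continuous fun y : e.baseSet => ‖f y‖ := by
    refine (hf n e).norm.congr fun y => ?_
    rw [Cl.norm_map]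
  exact (e.isOpen_baseSet.isOpenEmbedding_subtypeVal.continuousAt_iff (x := ⟨x, hx⟩)).1
    h.continuousAt

/-- The case `v = 0` is included because `0⁻¹ = 0`. The formula shows that `v ↦ v / √‖v‖` is
continuous at `0`. -/
lemma norm_sqrt_inv_smul {F : Type*} [NormedAddCommGroup F] [NormedSpace ℂ F] (v : F) :
    ‖(((√‖v‖)⁻¹ : ℝ) : ℂ) • v‖ = √‖v‖ := by
  rw [norm_smul, Complex.norm_real, Real.norm_eq_abs, abs_of_nonneg (by positivity)]
  by_cases h : √‖v‖ = 0
  · simp [h]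
  · field_simp
    exact (Real.sq_sqrt (norm_nonneg v)).symm

lemma continuous_sqrt_inv_smul {F : Type*} [NormedAddCommGroup F] [NormedSpace ℂ F] :
    Continuous fun v : F => (((√‖v‖)⁻¹ : ℝ) : ℂ) • v := by
  rw [continuous_iff_continuousAt]
  intro v
  by_cases h : v = 0
  · subst h
    rw [ContinuousAt, smul_zero, tendsto_zero_iff_norm_tendsto_zero]
    simp only [norm_sqrt_inv_smul]
    simpa [Function.comp_def] using (Real.continuous_sqrt.comp continuous_norm).tendsto (0 : F)
  · have h0 : √‖v‖ ≠ 0 := by simpa [Real.sqrt_eq_zero'] using h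
    exact (Complex.continuous_ofReal.continuousAt.comp
      ((Real.continuous_sqrt.comp continuous_norm).continuousAt.inv₀ h0)).smul continuousAt_id

/-- Take `h = √‖f‖` and `f' = f / √‖f‖`. The purpose is to transfer vanishing of `f` at a point to a
scalar function, which acts in the same way from the left and from the right. -/
lemma EquivariantBundle.exists_factor (f : E.ClSection) :
    ∃ (h : C₀(X, ℂ)) (f' : E.ClSection), f = E.scalarCl h * f' ∧ ∀ x, f.1 x = 0 → h x = 0 := by
  have hc : Continuous fun x => √‖f.1 x‖ := Real.continuous_sqrt.comp f.2.1.norm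
  have ht : Tendsto (fun x => √‖f.1 x‖) (cocompact X) (𝓝 0) := by
    simpa [Function.comp_def] using (Real.continuous_sqrt.tendsto 0).comp f.2.2
  refine ⟨⟨⟨fun x => ((√‖f.1 x‖ : ℝ) : ℂ), Complex.continuous_ofReal.comp hc⟩, by
    simpa [Function.comp_def] using (Complex.continuous_ofReal.tendsto 0).comp ht⟩,
    ⟨fun x => (((√‖f.1 x‖)⁻¹ : ℝ) : ℂ) • f.1 x, ?_, ?_⟩, ?_, ?_⟩
  · intro n e
    refine (continuous_sqrt_inv_smul.comp (f.2.1 n e)).congr fun x => ?_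
    simp only [Function.comp_apply, map_smul, Cl.norm_map]
  · simpa only [norm_sqrt_inv_smul] using ht
  · refine Subtype.ext (funext fun x => ?_)
    change f.1 x = algebraMap ℂ _ ((√‖f.1 x‖ : ℝ) : ℂ) * ((((√‖f.1 x‖)⁻¹ : ℝ) : ℂ) • f.1 x)
    rw [← Algebra.smul_def, smul_smul, ← Complex.ofReal_mul]
    by_cases h : √‖f.1 x‖ = 0
    · have h0 : f.1 x = 0 := by simpa [Real.sqrt_eq_zero'] using h
      rw [h0, smul_zero]
    · rw [mul_inv_cancel₀ h, Complex.ofReal_one, one_smul]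
  · intro x hx
    change ((√‖f.1 x‖ : ℝ) : ℂ) = 0
    simp [hx]

end

/-! ### Fibres of a Hilbert bimodule over a point. -/

section

/-- The seminorm of a positive semidefinite inner product. -/
def coreSeminorm {F : Type*} [AddCommGroup F] [Module ℂ F] (c : PreInnerProductSpace.Core ℂ F) :
    Seminorm ℂ F :=
  letI : SeminormedAddCommGroup F := InnerProductSpace.Core.toSeminormedAddCommGroup (𝕜 := ℂ)
  Seminorm.of (fun m => ‖m‖) norm_add_le fun z m => by
    let _ : NormedSpace ℂ F := InnerProductSpace.Core.toNormedSpace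
    exact norm_smul z m

namespace KROrientation

variable {X : Type*} [TopologicalSpace X] {r : RealStructure X} {E : EquivariantBundle r} {a b : ℕ}
  {M : Type*} [NormedAddCommGroup M] [NormedSpace ℂ M] [CompleteSpace M]
  (K : KROrientation E a b M)

lemma rinner_sub_right (m n p : M) (x : X) :
    K.rinner m (n - p) x = K.rinner m n x - K.rinner m p x := by
  rw [map_sub]; rfl

lemma rinner_sub_left (m n p : M) (x : X) :
    K.rinner (m - n) p x = K.rinner m p x - K.rinner n p x := by
  rw [map_sub]; rfl

lemma rinner_smul_right (z : ℂ) (m n : M) (x : X) :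
    K.rinner m (z • n) x = z • K.rinner m n x := by
  rw [map_smul]; rfl

lemma rinner_smul_left (z : ℂ) (m n : M) (x : X) :
    K.rinner (z • m) n x = star z • K.rinner m n x := by
  rw [LinearMap.map_smulₛₗ]; rfl

/-- The vectors in `M` that vanish in the fibre over `x`. -/
def Null (x : X) : Submodule ℂ M where
  carrier := {m | ∀ n, K.rinner n m x = 0}
  zero_mem' n := by simp
  add_mem' {m m'} hm hm' n := by
    rw [map_add, ZeroAtInftyContinuousMap.add_apply, hm n, hm' n, add_zero]
  smul_mem' c m hm n := by
    rw [map_smul, ZeroAtInftyContinuousMap.smul_apply, hm n, smul_zero]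

lemma rinner_symm (m n : M) (x : X) : K.rinner m n x = star (K.rinner n m x) := by
  rw [← K.star_rinner n m]; rfl

lemma rinner_null_left {x : X} {m : M} (hm : m ∈ K.Null x) (n : M) : K.rinner m n x = 0 := by
  rw [rinner_symm, hm n, star_zero]

lemma rinner_ract_left (g : TrivCl X a b) (m n : M) :
    K.rinner (K.ract g m) n = star g * K.rinner m n := by
  ext x
  rw [K.rinner_symm, K.rinner_ract, ZeroAtInftyContinuousMap.mul_apply,
    ZeroAtInftyContinuousMap.mul_apply, star_mul, ← K.rinner_symm]
  rfl

lemma rinner_lact_right (f : E.ClSection) (m n : M) :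
    K.rinner m (K.lact f n) = K.rinner (K.lact (star f) m) n := by
  rw [K.rinner_lact, star_star]

lemma lact_mem_null {x : X} {m : M} (hm : m ∈ K.Null x) (f : E.ClSection) :
    K.lact f m ∈ K.Null x := fun n => by
  rw [K.rinner_lact_right]; exact hm _

lemma ract_mem_null {x : X} {m : M} (hm : m ∈ K.Null x) (g : TrivCl X a b) :
    K.ract g m ∈ K.Null x := fun n => by
  rw [K.rinner_ract, ZeroAtInftyContinuousMap.mul_apply, hm, zero_mul]

lemma grade_mem_null {x : X} {m : M} (hm : m ∈ K.Null x) : K.grade m ∈ K.Null x := fun n => by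
  have h := congrArg (fun g => g x) (K.rinner_grade (K.grade n) m)
  simp only [K.grade_grade] at h
  rw [h]
  change Cl.grade (K.rinner (K.grade n) m x) = 0
  rw [hm, map_zero]

lemma conj_mem_null {x : X} {m : M} (hm : m ∈ K.Null (r x)) : K.conj m ∈ K.Null x := fun n => by
  have h := congrArg (fun g => g x) (K.rinner_conj (K.conj n) m)
  simp only [K.conj_conj] at h
  rw [h]
  change conjAB a b (K.rinner (K.conj n) m (r x)) = 0
  rw [hm, map_zero]

lemma ract_sub_smul_mem_null {x : X} {g : TrivCl X a b} {z : ℂ} (hg : g x = algebraMap ℂ _ z)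
    (m : M) : K.ract g m - z • m ∈ K.Null x := fun n => by
  rw [map_sub, K.rinner_ract, map_smul, ZeroAtInftyContinuousMap.sub_apply,
    ZeroAtInftyContinuousMap.mul_apply, ZeroAtInftyContinuousMap.smul_apply, hg,
    ← Algebra.commutes, Algebra.smul_def, sub_self]

lemma scalar_sub_smul_mem_null (x : X) (h : C₀(X, ℂ)) (m : M) :
    K.ract (scalarTriv a b h) m - h x • m ∈ K.Null x :=
  K.ract_sub_smul_mem_null rfl m

/-- The left action is `C₀(X)`-linear, so it is local: in `f = h * f'` with `h x = 0`, the factor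
`h` may act from the right, where the inner product shows its value at `x`. -/
lemma lact_mem_null_of_apply_eq_zero {x : X} {f : E.ClSection} (hf : f.1 x = 0) (m : M) :
    K.lact f m ∈ K.Null x := by
  obtain ⟨h, f', rfl, h0⟩ := E.exists_factor f
  rw [K.lact_mul, K.scalar]
  simpa [h0 x hf] using K.scalar_sub_smul_mem_null x h (K.lact f' m)

lemma lact_sub_mem_null {x : X} {f f' : E.ClSection} (hf : f.1 x = f'.1 x) (m : M) :
    K.lact f m - K.lact f' m ∈ K.Null x := by
  rw [← LinearMap.sub_apply, ← map_sub]
  refine K.lact_mem_null_of_apply_eq_zero ?_ m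
  change f.1 x - f'.1 x = 0
  rw [hf, sub_self]

/-! ### The seminorm in a fibre -/

open scoped ComplexOrder in
lemma rinner_self_nonneg (m : M) (x : X) : 0 ≤ Cl.tr (K.rinner m m x) := by
  obtain ⟨g, hg⟩ := K.rinner_nonneg m
  rw [hg]
  exact Cl.tr_star_mul_self_nonneg (g x)

/-- The trace of the inner product in the fibre over `x`. -/
@[reducible] def fiberCore (x : X) : PreInnerProductSpace.Core ℂ M where
  inner m n := Cl.tr (K.rinner m n x)
  conj_inner_symm m n := by
    rw [K.rinner_symm m n, Cl.tr_star]
  re_inner_nonneg m := (Complex.nonneg_iff.1 (K.rinner_self_nonneg m x)).1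
  add_left m n p := by
    rw [map_add, LinearMap.add_apply, ZeroAtInftyContinuousMap.add_apply, map_add]
  smul_left m n c := by
    rw [LinearMap.map_smulₛₗ, LinearMap.smul_apply, ZeroAtInftyContinuousMap.smul_apply, map_smul,
      smul_eq_mul]

/-- The norm in the fibre over `x`. -/
def fiberNorm (x : X) : Seminorm ℂ M := coreSeminorm (K.fiberCore x)

lemma fiberNorm_apply (x : X) (m : M) :
    K.fiberNorm x m = √(Cl.tr (K.rinner m m x)).re := rfl

/-- Composition with the trace turns the Clifford-valued inner product into a scalar one, so the
usual Cauchy–Schwarz inequality suffices. -/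
lemma norm_tr_rinner_le (m n : M) (x : X) :
    ‖Cl.tr (K.rinner m n x)‖ ≤ K.fiberNorm x m * K.fiberNorm x n :=
  letI : PreInnerProductSpace.Core ℂ M := K.fiberCore x
  InnerProductSpace.Core.norm_inner_le_norm (𝕜 := ℂ) m n

lemma norm_rinner_self (m : M) : ‖K.rinner m m‖ = ‖m‖ ^ 2 := (K.norm_sq m).symm

lemma fiberNorm_le (x : X) (m : M) : K.fiberNorm x m ≤ ‖m‖ := by
  rw [fiberNorm_apply]
  refine Real.sqrt_le_iff.2 ⟨norm_nonneg _, ?_⟩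
  rw [← K.norm_rinner_self]
  exact (Complex.re_le_norm _).trans ((Cl.norm_tr_le _).trans (c0_norm_apply_le _ x))

lemma norm_le_of_rinner {m : M} {C : ℝ} (hC : 0 ≤ C) (h : ∀ x, ‖K.rinner m m x‖ ≤ C ^ 2) :
    ‖m‖ ≤ C := by
  refine (sq_le_sq₀ (norm_nonneg _) hC).1 ?_
  rw [← K.norm_rinner_self]
  exact c0_norm_le _ (by positivity) h

lemma eq_zero_of_null {m : M} (h : ∀ x, m ∈ K.Null x) : m = 0 := by
  have : ‖m‖ ≤ 0 := K.norm_le_of_rinner le_rfl fun x => by rw [h x m]; simp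
  simpa using this

lemma eq_of_null {m n : M} (h : ∀ x, m - n ∈ K.Null x) : m = n :=
  sub_eq_zero.1 (K.eq_zero_of_null h)

lemma fiberNorm_of_null {x : X} {m : M} (h : m ∈ K.Null x) : K.fiberNorm x m = 0 := by
  rw [fiberNorm_apply, h m, map_zero, Complex.zero_re, Real.sqrt_zero]

variable [T2Space X] [LocallyCompactSpace X]

variable (X) in
/-- The constant function `c`, cut off away from `x`. -/
lemma exists_triv_apply_eq (x : X) (c : ClAB a b) : ∃ g : TrivCl X a b, g x = c := by
  obtain ⟨h, hx⟩ := exists_c0_apply_eq_one x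
  refine ⟨⟨⟨fun y => h y • c, h.continuous.smul continuous_const⟩, ?_⟩, ?_⟩
  · simpa using (zero_at_infty h).smul_const c
  · change h x • c = c
    rw [hx, one_smul]

/-- The trace alone detects null vectors: test against `n * g` with `g x = ⟪n, m⟫ x =: c`, which
gives `tr (star c * c) = 0`, and use faithfulness of the trace. -/
lemma mem_null_of_tr {x : X} {m : M} (h : ∀ n, Cl.tr (K.rinner n m x) = 0) : m ∈ K.Null x := by
  intro n
  obtain ⟨g, hg⟩ := exists_triv_apply_eq X x (K.rinner n m x)
  have h1 := h (K.ract g n)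
  rw [K.rinner_ract_left, ZeroAtInftyContinuousMap.mul_apply, ZeroAtInftyContinuousMap.star_apply,
    hg] at h1
  exact Cl.tr_star_mul_self_eq_zero h1

lemma mem_null_of_fiberNorm {x : X} {m : M} (h : K.fiberNorm x m = 0) : m ∈ K.Null x :=
  K.mem_null_of_tr fun n => by
    have h1 := K.norm_tr_rinner_le n m x
    rw [h, mul_zero] at h1
    simpa using h1

lemma mem_null_of_self {x : X} {m : M} (h : K.rinner m m x = 0) : m ∈ K.Null x :=
  K.mem_null_of_fiberNorm (by rw [fiberNorm_apply, h, map_zero, Complex.zero_re, Real.sqrt_zero])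

/-- The inner products span the fibre of `C₀(X, Cl_{a,b})`. -/
lemma span_rinner (x : X) :
    Submodule.span ℂ (Set.range fun p : M × M => K.rinner p.1 p.2 x) = ⊤ := by
  let ev : TrivCl X a b →ₗ[ℂ] ClAB a b :=
    { toFun := fun g => g x
      map_add' := fun _ _ => rfl
      map_smul' := fun _ _ => rfl }
  have hev : Continuous ev := AddMonoidHomClass.continuous_of_bound ev 1 fun g => by
    rw [one_mul]; exact c0_norm_apply_le g x
  have hmap : Submodule.span ℂ (Set.range fun p : M × M => K.rinner p.1 p.2 x) =
      (Submodule.span ℂ (Set.range fun p : M × M => K.rinner p.1 p.2)).map ev := by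
    rw [Submodule.map_span, ← Set.range_comp]; rfl
  rw [hmap, eq_top_iff]
  rintro c -
  obtain ⟨g, rfl⟩ := exists_triv_apply_eq X x c
  -- Fullness gives density only. In the finite-dimensional fibre, the span is closed and hence
  -- everything.
  have hfin : ∀ S : Submodule ℂ (ClAB a b), IsClosed (S : Set (ClAB a b)) := fun S =>
    haveI : FiniteDimensional ℂ S := FiniteDimensional.finiteDimensional_submodule S
    Submodule.closed_of_finiteDimensional S
  have hcl := hfin ((Submodule.span ℂ (Set.range fun p : M × M => K.rinner p.1 p.2)).map ev)
  exact (hcl.preimage hev).closure_subset_iff.2 (fun y hy => ⟨y, hy, rfl⟩) (K.rinner_full g)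

/-- A linear functional condition that holds on all inner products holds for `1`. -/
lemma rinner_span_induction (x : X) {p : ClAB a b → Prop} (h : ∀ m n, p (K.rinner m n x))
    (hadd : ∀ c d, p c → p d → p (c + d)) (hsmul : ∀ (z : ℂ) c, p c → p (z • c)) (c : ClAB a b) :
    p c := by
  have hc : c ∈ Submodule.span ℂ (Set.range fun p : M × M => K.rinner p.1 p.2 x) := by
    rw [K.span_rinner x]; trivial
  induction hc using Submodule.span_induction with
  | mem c hc => obtain ⟨p, rfl⟩ := hc; exact h _ _
  | zero => simpa using hsmul 0 _ (h 0 0)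
  | add c d _ _ hc hd => exact hadd c d hc hd
  | smul z c _ hc => exact hsmul z c hc

/-- Inner products span `Cl_{a,b}` and `tr 1 = 1`, so no fibre is zero. This is what allows scalars
to be compared after multiplication by `⟪m, n⟫`. -/
lemma exists_tr_rinner_ne_zero (x : X) : ∃ m n, Cl.tr (K.rinner m n x) ≠ 0 := by
  by_contra! h
  have := K.rinner_span_induction x (p := fun c => Cl.tr c = 0) h
    (fun c d hc hd => by rw [map_add, hc, hd, add_zero])
    (fun z c hc => by rw [map_smul, hc, smul_zero]) 1
  rw [← map_one (algebraMap ℂ (ClAB a b)), Cl.tr_algebraMap] at this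
  exact one_ne_zero this

end KROrientation

end

/-! ### Parity twists and involutions of the coefficient algebras. -/

section

section Twist

variable {X : Type*} [TopologicalSpace X] {r : RealStructure X} {E : EquivariantBundle r}

lemma gradeCl_gradeCl (f : E.ClSection) : E.gradeCl (E.gradeCl f) = f :=
  Subtype.ext (funext fun _ => Cl.grade_grade _)

lemma gradeCl_star (f : E.ClSection) : E.gradeCl (star f) = star (E.gradeCl f) :=
  Subtype.ext (funext fun _ => Cl.grade_star _)

lemma gradeCl_mul (f g : E.ClSection) : E.gradeCl (f * g) = E.gradeCl f * E.gradeCl g :=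
  Subtype.ext (funext fun _ => map_mul _ _ _)

lemma gradeCl_add (f g : E.ClSection) : E.gradeCl (f + g) = E.gradeCl f + E.gradeCl g :=
  Subtype.ext (funext fun _ => map_add _ _ _)

lemma gradeCl_scalarCl (h : C₀(X, ℂ)) : E.gradeCl (E.scalarCl h) = E.scalarCl h :=
  Subtype.ext (funext fun _ => AlgHom.commutes _ _)

/-- The map that a commutation past an operator of parity `ε` induces: the identity for even
operators (`ε = 1`), the grading for odd ones. -/
def twist (ε : ℤˣ) (f : E.ClSection) : E.ClSection := if ε = 1 then f else E.gradeCl f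

@[simp] lemma twist_one (f : E.ClSection) : twist 1 f = f := by simp [twist]

@[simp] lemma twist_neg_one (f : E.ClSection) : twist (-1) f = E.gradeCl f := by
  rw [twist, if_neg (by decide)]

lemma twist_twist (ε : ℤˣ) (f : E.ClSection) : twist ε (twist ε f) = f := by
  rcases Int.units_eq_one_or ε with rfl | rfl <;> simp [gradeCl_gradeCl]

lemma twist_star (ε : ℤˣ) (f : E.ClSection) : twist ε (star f) = star (twist ε f) := by
  rcases Int.units_eq_one_or ε with rfl | rfl <;> simp [gradeCl_star]

lemma twist_mul (ε : ℤˣ) (f g : E.ClSection) : twist ε (f * g) = twist ε f * twist ε g := by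
  rcases Int.units_eq_one_or ε with rfl | rfl <;> simp [gradeCl_mul]

lemma twist_add (ε : ℤˣ) (f g : E.ClSection) : twist ε (f + g) = twist ε f + twist ε g := by
  rcases Int.units_eq_one_or ε with rfl | rfl <;> simp [gradeCl_add]

lemma twist_scalarCl (ε : ℤˣ) (h : C₀(X, ℂ)) : twist ε (E.scalarCl h) = E.scalarCl h := by
  rcases Int.units_eq_one_or ε with rfl | rfl <;> simp [gradeCl_scalarCl]

lemma gradeTriv_gradeTriv {a b : ℕ} (g : TrivCl X a b) : gradeTriv (gradeTriv g) = g :=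
  ZeroAtInftyContinuousMap.ext fun _ => Cl.grade_grade _

lemma unit_mul_self_complex (ε : ℤˣ) : ((ε : ℤ) : ℂ) * ((ε : ℤ) : ℂ) = 1 := by
  rcases Int.units_eq_one_or ε with rfl | rfl <;> simp

lemma Cl.grade_conjMap {V W : Type*} [NormedAddCommGroup V] [InnerProductSpace ℝ V]
    [NormedAddCommGroup W] [InnerProductSpace ℝ W] [FiniteDimensional ℝ V] [FiniteDimensional ℝ W]
    (u : V ≃ₗᵢ[ℝ] W) (x : Cl V) : Cl.grade (Cl.conjMap u x) = Cl.conjMap u (Cl.grade x) := by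
  induction x using Cl.induction with
  | hadd x y hx hy => rw [map_add, map_add, hx, hy, map_add, map_add]
  | hmk z c => rw [Cl.conjMap_mk, ← Cl.map_mk, Cl.grade_map, Cl.grade_mk, Cl.grade_mk, Cl.map_mk,
      Cl.conjMap_mk]

lemma gradeCl_conjCl (f : E.ClSection) : E.gradeCl (E.conjCl f) = E.conjCl (E.gradeCl f) :=
  Subtype.ext (funext fun _ => Cl.grade_conjMap _ _)

/-- For `y = r (r x)`, the values `f y` and `f x` lie in fibres over points that are only
propositionally equal. The hypothesis `hu` says that `u` is the canonical identification of these
fibres. -/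
lemma map_section_of_eq (f : ∀ x, Cl (E.fiber x)) {x y : X} (h : y = x)
    (u : E.fiber y ≃ₗᵢ[ℝ] E.fiber x)
    (hu : ∀ v, (⟨x, u v⟩ : TotalSpace Unit E.fiber) = ⟨y, v⟩) : Cl.map u (f y) = f x := by
  subst h
  have : u = LinearIsometryEquiv.refl ℝ _ := by
    ext v
    have := hu v
    simpa using this
  rw [this, Cl.map_refl]; rfl

lemma conjCl_conjCl (f : E.ClSection) : E.conjCl (E.conjCl f) = f := by
  refine Subtype.ext (funext fun x => ?_)
  change Cl.conjMap (E.inv x).symm (Cl.conjMap (E.inv (r x)).symm (f.1 (r (r x)))) = f.1 x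
  rw [Cl.conjMap_conjMap]
  refine map_section_of_eq f.1 (r.involutive x) _ fun v => ?_
  have h := totalSpace_symm_eq r (fun x => (E.inv x).toEquiv) E.inv_inv x ((E.inv (r x)).symm v)
  refine h.trans ?_
  change (⟨r (r x), E.inv (r x) ((E.inv (r x)).symm v)⟩ : TotalSpace Unit E.fiber) = _
  rw [LinearIsometryEquiv.apply_symm_apply]

lemma conjCl_twist (ε : ℤˣ) (f : E.ClSection) : E.conjCl (twist ε f) = twist ε (E.conjCl f) := by
  rcases Int.units_eq_one_or ε with rfl | rfl <;> simp [gradeCl_conjCl]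

lemma conjAB_conjAB {a b : ℕ} (c : ClAB a b) : conjAB a b (conjAB a b c) = c := by
  have h : (reflAB a b).trans (reflAB a b) = LinearIsometryEquiv.refl ℝ _ := by
    ext v i
    rcases i with i | i <;> simp [reflAB]
  rw [conjAB, Cl.conjMap_conjMap, h, Cl.map_refl]; rfl

lemma conjTriv_conjTriv {a b : ℕ} (g : TrivCl X a b) : conjTriv r (conjTriv r g) = g :=
  ZeroAtInftyContinuousMap.ext fun x => by
    change conjAB a b (conjAB a b (g (r (r x)))) = g x
    rw [conjAB_conjAB, r.involutive]

end Twist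

/-! ### Invariant sesquilinear forms on a fibre. -/

section Forms

variable {X : Type*} [TopologicalSpace X] {r : RealStructure X} {E : EquivariantBundle r} {a b : ℕ}
  {M : Type*} [NormedAddCommGroup M] [NormedSpace ℂ M] [CompleteSpace M]
  [T2Space X] [LocallyCompactSpace X]

/-- A sesquilinear form with values in the fibre of `C₀(X, Cl_{a,b})` that is invariant under both
algebras and the grading is a multiple of the inner product. -/
lemma KROrientation.form_eq_smul (K : KROrientation E a b M) (x : X) (τ : ClAB a b → ClAB a b)
    (hτ_add : ∀ c d, τ (c + d) = τ c + τ d) (hτ_smul : ∀ (z : ℂ) c, τ (z • c) = z • τ c)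
    (hτ_one : τ 1 = 1) (s : ℤˣ)
    (hτ : ∀ v, τ (Cl.γ v) = ((s : ℤ) : ℂ) • Cl.γ v)
    (Q : M → M → ClAB a b)
    (hQ_ract_right : ∀ m n g, Q m (K.ract g n) = Q m n * τ (g x))
    (hQ_ract_left : ∀ m n g, Q (K.ract g m) n = star (g x) * Q m n)
    (hQ_lact : ∀ f m n, Q (K.lact f m) n = Q m (K.lact (star f) n))
    (hQ_grade : ∀ m n, Cl.grade (Q m n) = ((s : ℤ) : ℂ) • Q (K.grade m) (K.grade n)) :
    ∃ z : ℂ, (∀ m n, Q m n = z • K.rinner m n x) ∧ (s = -1 → z = 0) := by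
  -- Rewrite `n ⟪m', n'⟫` as `f n'`, where `f` is the left inner product of `n` and `m'`. Invariance
  -- moves `star f` to the first variable, where `star f m = m' ⟪n, m⟫`, and `⟪n, m⟫` leaves the
  -- form as its adjoint `⟪m, n⟫`.
  have key : ∀ m n m' n', Q m n * τ (K.rinner m' n' x) = K.rinner m n x * Q m' n' := by
    intro m n m' n'
    rw [← hQ_ract_right, ← K.linner_rinner, ← K.star_linner, ← hQ_lact, K.linner_rinner,
      hQ_ract_left, ← K.rinner_symm]
  -- By fullness, `1` is a combination of inner products `⟪m', n'⟫`. The corresponding combination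
  -- of the `Q m' n'` is the required `d`.
  have hd : ∀ c : ClAB a b, ∃ d, ∀ m n, Q m n * τ c = K.rinner m n x * d := by
    refine K.rinner_span_induction x (fun m n => ⟨_, fun m' n' => key m' n' m n⟩) ?_ ?_
    · rintro c c' ⟨d, hd⟩ ⟨d', hd'⟩
      exact ⟨d + d', fun m n => by rw [hτ_add, mul_add, mul_add, hd, hd']⟩
    · rintro z c ⟨d, hd⟩
      exact ⟨z • d, fun m n => by rw [hτ_smul, mul_smul_comm, mul_smul_comm, hd]⟩
  obtain ⟨d, hd⟩ := hd 1
  simp only [hτ_one, mul_one] at hd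
  -- Insert `Q m n = ⟪m, n⟫ * d` into `key` and use fullness in both pairs of variables.
  have hcomm : ∀ c, d * τ c = c * d := by
    intro c
    have h : ∀ c', ∀ c'', c' * (d * τ c'') = c' * (c'' * d) := by
      refine K.rinner_span_induction x (fun m n => ?_) ?_ ?_
      · refine K.rinner_span_induction x (fun m' n' => ?_) ?_ ?_
        · rw [← mul_assoc, ← hd, key, hd]
        · intro c c' h h'
          rw [hτ_add, mul_add, mul_add, add_mul, mul_add, h, h']
        · intro z c h
          rw [hτ_smul, mul_smul_comm, smul_mul_assoc, mul_smul_comm, mul_smul_comm, h]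
      · intro c c' h h' c''
        rw [add_mul, add_mul, h, h']
      · intro z c h c''
        rw [smul_mul_assoc, smul_mul_assoc, h]
    simpa using h 1 c
  have hgrade : Cl.grade d = ((s : ℤ) : ℂ) • d := by
    have h : ∀ c, Cl.grade (c : ClAB a b) * Cl.grade d = Cl.grade c * (((s : ℤ) : ℂ) • d) := by
      refine K.rinner_span_induction x (fun m n => ?_) ?_ ?_
      · have h1 := congrArg (fun g => g x) (K.rinner_grade m n)
        change K.rinner (K.grade m) (K.grade n) x = Cl.grade (K.rinner m n x) at h1
        rw [← map_mul, ← hd, hQ_grade, hd, ← h1, mul_smul_comm]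
      · intro c c' h h'
        rw [map_add, add_mul, add_mul, h, h']
      · intro z c h
        rw [map_smul, smul_mul_assoc, smul_mul_assoc, h]
    simpa using h 1
  -- The sign in `τ (γ v) = s γ v` equals the parity of `d`, so that commutation twisted by `τ` is
  -- exactly supercommutation.
  obtain ⟨z, rfl⟩ := Cl.scalar_of_supercentral d fun v => by
    rw [hgrade, ← hcomm, hτ, mul_smul_comm, smul_mul_assoc]
  refine ⟨z, fun m n => by rw [hd, ← Algebra.commutes, Algebra.smul_def], ?_⟩
  rintro rfl
  rw [AlgHom.commutes] at hgrade
  -- A scalar is even. If `d` is odd as well, then it is zero.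
  have h2 : algebraMap ℂ (ClAB a b) z = algebraMap ℂ (ClAB a b) (-z) := by
    rw [hgrade]; simp
  have h3 : z = -z := FaithfulSMul.algebraMap_injective ℂ (ClAB a b) h2
  exact self_eq_neg.1 h3

end Forms

end

/-! ### Intertwiners and their scalar inner products. -/

section

variable {X : Type*} [TopologicalSpace X] {r : RealStructure X} {E : EquivariantBundle r} {a b : ℕ}
  {M₁ : Type*} [NormedAddCommGroup M₁] [NormedSpace ℂ M₁] [CompleteSpace M₁]
  {M₂ : Type*} [NormedAddCommGroup M₂] [NormedSpace ℂ M₂] [CompleteSpace M₂]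

/-- A homogeneous linear map of right modules that supercommutes with the left action. -/
structure Intertwiner (K₁ : KROrientation E a b M₁) (K₂ : KROrientation E a b M₂) where
  /-- The underlying linear map. -/
  toFun : M₁ →ₗ[ℂ] M₂
  /-- The parity. -/
  sign : ℤˣ
  map_ract : ∀ g m, toFun (K₁.ract g m) = K₂.ract g (toFun m)
  map_lact : ∀ f m, toFun (K₁.lact f m) = K₂.lact (twist sign f) (toFun m)
  map_grade : ∀ m, toFun (K₁.grade m) = ((sign : ℤ) : ℂ) • K₂.grade (toFun m)

namespace Intertwiner

variable {K₁ : KROrientation E a b M₁} {K₂ : KROrientation E a b M₂}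

instance : CoeFun (Intertwiner K₁ K₂) fun _ => M₁ → M₂ := ⟨fun T => T.toFun⟩

lemma lact_apply (T : Intertwiner K₁ K₂) (f : E.ClSection) (m : M₁) :
    K₂.lact f (T m) = T (K₁.lact (twist T.sign f) m) := by
  rw [T.map_lact, twist_twist]

lemma grade_apply (T : Intertwiner K₁ K₂) (m : M₁) :
    K₂.grade (T m) = ((T.sign : ℤ) : ℂ) • T (K₁.grade m) := by
  rw [T.map_grade, smul_smul, unit_mul_self_complex, one_smul]

variable [T2Space X] [LocallyCompactSpace X]

/-- The form `⟪S m, T n⟫` has parity `S.sign * T.sign` and is invariant up to this parity, so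
`form_eq_smul` applies. Intertwiners of different parity are orthogonal. -/
lemma exists_coef (S T : Intertwiner K₁ K₂) (x : X) :
    ∃ z : ℂ, (∀ m n, K₂.rinner (S m) (T n) x = z • K₁.rinner m n x) ∧
      (S.sign ≠ T.sign → z = 0) := by
  have hr : ∀ m n g, K₂.rinner (S m) (T (K₁.ract g n)) x = K₂.rinner (S m) (T n) x * g x := by
    intro m n g
    rw [T.map_ract, K₂.rinner_ract]; rfl
  have hl : ∀ m n g, K₂.rinner (S (K₁.ract g m)) (T n) x =
      star (g x) * K₂.rinner (S m) (T n) x := by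
    intro m n g
    rw [S.map_ract, K₂.rinner_ract_left]; rfl
  have hlact : ∀ f m n, K₂.rinner (S (K₁.lact f m)) (T n) x =
      K₂.rinner (S m) (T (K₁.lact (twist (S.sign * T.sign) (star f)) n)) x := by
    intro f m n
    rw [S.map_lact, K₂.rinner_lact, T.lact_apply, ← twist_star]
    congr 4
    rcases Int.units_eq_one_or S.sign with h | h <;>
      rcases Int.units_eq_one_or T.sign with h' | h' <;> simp [h, h', gradeCl_gradeCl]
  have hg : ∀ m n, Cl.grade (K₂.rinner (S m) (T n) x) = (((S.sign * T.sign : ℤˣ) : ℤ) : ℂ) •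
      K₂.rinner (S (K₁.grade m)) (T (K₁.grade n)) x := by
    intro m n
    have h1 := congrArg (fun g => g x) (K₂.rinner_grade (S m) (T n))
    change K₂.rinner (K₂.grade (S m)) (K₂.grade (T n)) x = Cl.grade (K₂.rinner (S m) (T n) x) at h1
    rw [← h1, S.grade_apply, T.grade_apply, K₂.rinner_smul_left, K₂.rinner_smul_right, smul_smul]
    simp
  by_cases hs : S.sign = T.sign
  · have h1 : S.sign * T.sign = 1 := by rw [hs]; exact Int.units_mul_self _
    obtain ⟨z, hz, -⟩ := K₁.form_eq_smul x id (fun _ _ => rfl) (fun _ _ => rfl) rfl 1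
      (fun v => by simp) (fun m n => K₂.rinner (S m) (T n) x) hr hl
      (fun f m n => by simpa [h1] using hlact f m n)
      (fun m n => by simpa [h1] using hg m n)
    exact ⟨z, hz, fun h => absurd hs h⟩
  · have h1 : S.sign * T.sign = -1 := by
      rcases Int.units_eq_one_or S.sign with h | h <;>
        rcases Int.units_eq_one_or T.sign with h' | h' <;> simp_all
    -- For different parities, the left action is twisted by the grading. Inserting `K₁.grade` in
    -- the second variable cancels this twist and twists the right action instead, whence `τ =
    -- Cl.grade` and `s = -1`.
    obtain ⟨z, hz, h0⟩ := K₁.form_eq_smul x Cl.grade (map_add _) (map_smul _) (map_one _) (-1)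
      (fun v => by simp [Cl.grade_γ]) (fun m n => K₂.rinner (S m) (T (K₁.grade n)) x)
      (fun m n g => by rw [K₁.grade_ract, hr]; rfl) (fun m n g => hl _ _ _)
      (fun f m n => by rw [hlact, h1, twist_neg_one, K₁.grade_lact])
      (fun m n => by rw [hg, h1])
    refine ⟨0, fun m n => ?_, fun _ => rfl⟩
    have := hz m (K₁.grade n)
    rwa [h0 rfl, K₁.grade_grade, zero_smul, ← zero_smul ℂ (K₁.rinner m n x)] at this

/-- The `ℂ`-valued inner product of intertwiners in the fibre over `x`. -/
def coef (S T : Intertwiner K₁ K₂) (x : X) : ℂ := (exists_coef S T x).choose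

lemma rinner_apply (S T : Intertwiner K₁ K₂) (m n : M₁) (x : X) :
    K₂.rinner (S m) (T n) x = coef S T x • K₁.rinner m n x :=
  (exists_coef S T x).choose_spec.1 m n

lemma coef_of_sign_ne (S T : Intertwiner K₁ K₂) (x : X) (h : S.sign ≠ T.sign) : coef S T x = 0 :=
  (exists_coef S T x).choose_spec.2 h

lemma coef_eq {S T : Intertwiner K₁ K₂} {x : X} {z : ℂ}
    (h : ∀ m n, K₂.rinner (S m) (T n) x = z • K₁.rinner m n x) : coef S T x = z := by
  obtain ⟨m, n, hmn⟩ := K₁.exists_tr_rinner_ne_zero x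
  have h1 := congrArg Cl.tr (h m n)
  rw [rinner_apply, map_smul, map_smul, smul_eq_mul, smul_eq_mul] at h1
  exact mul_right_cancel₀ hmn h1

/-- Near `x` the coefficient is the quotient of the traces of `⟪S m, T n⟫` and `⟪m, n⟫`, for `m`,
`n` chosen so that the denominator is nonzero at `x`. -/
lemma continuous_coef (S T : Intertwiner K₁ K₂) : Continuous (coef S T) := by
  rw [continuous_iff_continuousAt]
  intro x
  obtain ⟨m, n, hmn⟩ := K₁.exists_tr_rinner_ne_zero x
  have htr : Continuous (Cl.tr : ClAB a b → ℂ) :=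
    LinearMap.continuous_of_finiteDimensional _
  have h1 : Continuous fun y => Cl.tr (K₁.rinner m n y) := htr.comp (K₁.rinner m n).continuous
  have h2 : Continuous fun y => Cl.tr (K₂.rinner (S m) (T n) y) :=
    htr.comp (K₂.rinner (S m) (T n)).continuous
  refine (h2.continuousAt.div h1.continuousAt hmn).congr ?_
  filter_upwards [h1.continuousAt.eventually_ne hmn] with y hy
  rw [Pi.div_apply, rinner_apply, map_smul, smul_eq_mul, mul_div_assoc, div_self hy, mul_one]

lemma coef_symm (S T : Intertwiner K₁ K₂) (x : X) : coef S T x = star (coef T S x) :=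
  coef_eq fun m n => by
    rw [K₂.rinner_symm, rinner_apply, star_smul, ← K₁.rinner_symm]

open scoped ComplexOrder in
lemma coef_self_nonneg (S : Intertwiner K₁ K₂) (x : X) : 0 ≤ coef S S x := by
  -- If all squares had trace zero at `x`, then all vectors would be null there and the fibre would
  -- vanish.
  obtain ⟨m, hm⟩ : ∃ m, Cl.tr (K₁.rinner m m x) ≠ 0 := by
    by_contra! h
    obtain ⟨m, n, hmn⟩ := K₁.exists_tr_rinner_ne_zero x
    have hm : m ∈ K₁.Null x := K₁.mem_null_of_fiberNorm (by
      rw [K₁.fiberNorm_apply, h, Complex.zero_re, Real.sqrt_zero])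
    rw [K₁.rinner_null_left hm, map_zero] at hmn
    exact hmn rfl
  have h1 := K₂.rinner_self_nonneg (S m) x
  rw [rinner_apply, map_smul, smul_eq_mul] at h1
  have h2 := lt_of_le_of_ne (K₁.rinner_self_nonneg m x) hm.symm
  exact le_of_mul_le_mul_right (by rwa [zero_mul]) h2

lemma mem_null_of_coef_eq_zero {S : Intertwiner K₁ K₂} {x : X} (h : coef S S x = 0) (m : M₁) :
    S m ∈ K₂.Null x :=
  K₂.mem_null_of_self (by rw [rinner_apply, h, zero_smul])

/-- An intertwiner that does not vanish at `x` is surjective in the fibre over `x`. -/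
lemma exists_sub_mem_null {S : Intertwiner K₁ K₂} {x : X} (h : coef S S x ≠ 0) (n : M₂) :
    ∃ m, n - S m ∈ K₂.Null x := by
  have key : ∀ c : ClAB a b, ∃ m, ∀ p, K₂.rinner p n x * c - K₂.rinner p (S m) x = 0 := by
    refine K₁.rinner_span_induction x (fun m m' => ?_) ?_ ?_
    · refine ⟨(coef S S x)⁻¹ • K₁.lact (twist S.sign (K₂.linner n (S m))) m', fun p => ?_⟩
      rw [map_smul, ← S.lact_apply, K₂.linner_rinner, map_smul, K₂.rinner_ract,
        ZeroAtInftyContinuousMap.smul_apply, ZeroAtInftyContinuousMap.mul_apply, rinner_apply,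
        mul_smul_comm, smul_smul, inv_mul_cancel₀ h, one_smul, sub_self]
    · rintro c d ⟨m, hm⟩ ⟨m', hm'⟩
      refine ⟨m + m', fun p => ?_⟩
      rw [map_add, map_add, ZeroAtInftyContinuousMap.add_apply, mul_add, add_sub_add_comm, hm, hm',
        add_zero]
    · rintro z c ⟨m, hm⟩
      refine ⟨z • m, fun p => ?_⟩
      rw [map_smul, map_smul, ZeroAtInftyContinuousMap.smul_apply, mul_smul_comm, ← smul_sub, hm,
        smul_zero]
  obtain ⟨m, hm⟩ := key 1
  refine ⟨m, fun p => ?_⟩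
  rw [map_sub, ZeroAtInftyContinuousMap.sub_apply]
  simpa using hm p

/-- Intertwiners are proportional in each fibre. -/
lemma smul_sub_smul_mem_null (S T : Intertwiner K₁ K₂) {x : X} (h : coef S S x ≠ 0) (m : M₁) :
    coef S S x • T m - coef S T x • S m ∈ K₂.Null x := by
  intro n
  obtain ⟨m', hm'⟩ := exists_sub_mem_null h n
  -- Since `S` is surjective over `x`, it suffices to test against vectors `S m'`. There both terms
  -- give `coef S S x * coef S T x` times `⟪m', m⟫`.
  have h1 : K₂.rinner n (coef S S x • T m - coef S T x • S m) x =
      K₂.rinner (S m') (coef S S x • T m - coef S T x • S m) x := by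
    have h2 := K₂.rinner_null_left hm' (coef S S x • T m - coef S T x • S m)
    rwa [K₂.rinner_sub_left, sub_eq_zero] at h2
  rw [h1, K₂.rinner_sub_right, K₂.rinner_smul_right, K₂.rinner_smul_right, rinner_apply,
    rinner_apply, smul_smul, smul_smul, mul_comm, sub_self]

/-- The Gram matrix of vectors in a line has rank one. -/
lemma coef_mul_coef (S T U : Intertwiner K₁ K₂) {x : X} (h : coef S S x ≠ 0) :
    coef T S x * coef S U x = coef S S x * coef T U x := by
  obtain ⟨m, n, hmn⟩ := K₁.exists_tr_rinner_ne_zero x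
  have h1 := smul_sub_smul_mem_null S U h n (T m)
  rw [K₂.rinner_sub_right, K₂.rinner_smul_right, K₂.rinner_smul_right, rinner_apply,
    rinner_apply, smul_smul, smul_smul, ← sub_smul] at h1
  have h2 := congrArg Cl.tr h1
  rw [map_smul, map_zero, smul_eq_mul] at h2
  have h3 := (mul_eq_zero.1 h2).resolve_right hmn
  rw [mul_comm]
  exact (sub_eq_zero.1 h3).symm

/-- The multiple of an intertwiner by a scalar. -/
def smul (z : ℂ) (S : Intertwiner K₁ K₂) : Intertwiner K₁ K₂ where
  toFun := z • S.toFun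
  sign := S.sign
  map_ract g m := by
    rw [LinearMap.smul_apply, S.map_ract, LinearMap.smul_apply, map_smul]
  map_lact f m := by
    rw [LinearMap.smul_apply, S.map_lact, LinearMap.smul_apply, map_smul]
  map_grade m := by
    rw [LinearMap.smul_apply, S.map_grade, LinearMap.smul_apply, map_smul, smul_comm]

lemma coef_smul_smul (z : ℂ) (S : Intertwiner K₁ K₂) (x : X) :
    coef (smul z S) (smul z S) x = star z * z * coef S S x :=
  coef_eq fun m n => by
    have h : K₂.rinner (z • S m) (z • S n) x = (star z * z * coef S S x) • K₁.rinner m n x := by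
      rw [K₂.rinner_smul_left, K₂.rinner_smul_right, rinner_apply, smul_smul, smul_smul, mul_assoc]
    exact h

/-- The "real" structure on intertwiners. -/
def conj (S : Intertwiner K₁ K₂) : Intertwiner K₁ K₂ where
  toFun :=
    { toFun := fun m => K₂.conj (S (K₁.conj m))
      map_add' := fun m n => by simp
      map_smul' := fun z m => by simp [LinearMap.map_smulₛₗ] }
  sign := S.sign
  map_ract g m := by
    change K₂.conj (S (K₁.conj (K₁.ract g m))) = K₂.ract g (K₂.conj (S (K₁.conj m)))
    rw [K₁.conj_ract, S.map_ract, K₂.conj_ract, conjTriv_conjTriv]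
  map_lact f m := by
    change K₂.conj (S (K₁.conj (K₁.lact f m))) = K₂.lact (twist S.sign f) (K₂.conj (S (K₁.conj m)))
    rw [K₁.conj_lact, S.map_lact, K₂.conj_lact, conjCl_twist, conjCl_conjCl]
  map_grade m := by
    change K₂.conj (S (K₁.conj (K₁.grade m))) =
      ((S.sign : ℤ) : ℂ) • K₂.grade (K₂.conj (S (K₁.conj m)))
    rw [K₁.conj_grade, S.map_grade, LinearMap.map_smulₛₗ, K₂.conj_grade]
    simp

lemma conj_apply (S : Intertwiner K₁ K₂) (m : M₁) : S.conj m = K₂.conj (S (K₁.conj m)) := rfl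

lemma conjAB_smul (z : ℂ) (c : ClAB a b) : conjAB a b (z • c) = star z • conjAB a b c :=
  Cl.conjMap_smul _ z c

lemma coef_conj_conj (S T : Intertwiner K₁ K₂) (x : X) :
    coef S.conj T.conj x = star (coef S T (r x)) :=
  coef_eq fun m n => by
    rw [conj_apply, conj_apply, K₂.rinner_conj]
    change conjAB a b (K₂.rinner (S (K₁.conj m)) (T (K₁.conj n)) (r x)) = _
    rw [rinner_apply, conjAB_smul, K₁.rinner_conj]
    change _ • conjAB a b (conjAB a b (K₁.rinner m n (r (r x)))) = _
    rw [conjAB_conjAB, r.involutive]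

lemma conj_conj (S : Intertwiner K₁ K₂) (m : M₁) : S.conj.conj m = S m := by
  rw [conj_apply, conj_apply, K₁.conj_conj, K₂.conj_conj]

lemma coef_conj_left (S T : Intertwiner K₁ K₂) (x : X) :
    coef S.conj T x = star (coef S T.conj (r x)) := by
  rw [← coef_conj_conj]
  -- The coefficient depends only on the underlying maps, and those of `T.conj.conj` and `T` agree.
  exact (coef_eq fun m n => by rw [← conj_conj T, rinner_apply])

end Intertwiner

end

/-! ### Local sections of metric bundles and of the Clifford bundle. -/

section

section BumpSection

variable {𝕜 : Type*} [RCLike 𝕜] {X : Type*} [TopologicalSpace X]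
  {V : X → Type*} [∀ x, NormedAddCommGroup (V x)] [∀ x, InnerProductSpace 𝕜 (V x)]
  [TopologicalSpace (TotalSpace Unit V)]

open Classical in
/-- A constant vector in a local trivialisation, multiplied by a cutoff function. -/
def bumpFun {n : ℕ} (e : IsometricTriv 𝕜 V n) (χ : X → ℝ) (w : EuclideanSpace 𝕜 (Fin n)) (x : X) :
    V x :=
  if h : x ∈ e.baseSet then (χ x : 𝕜) • (e.coord ⟨x, h⟩).symm w else 0

lemma bumpFun_of_mem {n : ℕ} (e : IsometricTriv 𝕜 V n) (χ : X → ℝ)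
    (w : EuclideanSpace 𝕜 (Fin n)) {x : X} (h : x ∈ e.baseSet) :
    bumpFun e χ w x = (χ x : 𝕜) • (e.coord ⟨x, h⟩).symm w := dif_pos h

lemma bumpFun_of_eq_zero {n : ℕ} (e : IsometricTriv 𝕜 V n) {χ : X → ℝ}
    (w : EuclideanSpace 𝕜 (Fin n)) {x : X} (h : χ x = 0) : bumpFun e χ w x = 0 := by
  rw [bumpFun]
  split_ifs
  · rw [h, RCLike.ofReal_zero, zero_smul]
  · rfl

lemma continuousSection_bumpFun [IsMetricBundle 𝕜 V] {n : ℕ} (e : IsometricTriv 𝕜 V n) {χ : X → ℝ}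
    (hc : Continuous χ) (ht : tsupport χ ⊆ e.baseSet) (w : EuclideanSpace 𝕜 (Fin n)) :
    ContinuousSection (bumpFun e χ w) := by
  rw [ContinuousSection, continuous_iff_continuousAt]
  intro x
  by_cases hx : x ∈ e.baseSet
  · have h0 : Continuous fun y : e.baseSet => (χ y : 𝕜) • w :=
      Continuous.fun_smul (RCLike.continuous_ofReal.comp (hc.comp continuous_subtype_val))
        (continuous_const (y := w))
    have h1 := e.continuous_coord_symm.comp (continuous_id.prodMk h0)
    have h2 : Continuous fun y : e.baseSet => (⟨y, bumpFun e χ w y⟩ : TotalSpace Unit V) := by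
      refine h1.congr fun y => ?_
      change (⟨y, (e.coord y).symm ((χ y : 𝕜) • w)⟩ : TotalSpace Unit V) = ⟨y, bumpFun e χ w y⟩
      rw [bumpFun_of_mem e χ w y.2, map_smul]
    exact (e.isOpen_baseSet.isOpenEmbedding_subtypeVal.continuousAt_iff (x := ⟨x, hx⟩)).1
      h2.continuousAt
  -- Outside the domain of the trivialisation, the closed support is avoided on a neighbourhood,
  -- where the section agrees with the zero section.
  · have h0 : Continuous fun y => (⟨y, (0 : ∀ x, V x) y⟩ : TotalSpace Unit V) :=
      (C0Section 𝕜 V).zero_mem.1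
    refine h0.continuousAt.congr ?_
    have hn : ∀ᶠ y in 𝓝 x, y ∉ tsupport χ :=
      (isClosed_tsupport χ).isOpen_compl.mem_nhds fun h => hx (ht h)
    filter_upwards [hn] with y hy
    rw [bumpFun_of_eq_zero e w (image_eq_zero_of_notMem_tsupport hy)]
    rfl

lemma norm_bumpFun_le {n : ℕ} (e : IsometricTriv 𝕜 V n) (χ : X → ℝ)
    (w : EuclideanSpace 𝕜 (Fin n)) (x : X) : ‖bumpFun e χ w x‖ ≤ |χ x| * ‖w‖ := by
  rw [bumpFun]
  split_ifs
  · rw [norm_smul, LinearIsometryEquiv.norm_map, RCLike.norm_ofReal]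
  · rw [norm_zero]; positivity

lemma bumpFun_mem [IsMetricBundle 𝕜 V] {n : ℕ} (e : IsometricTriv 𝕜 V n) {χ : X → ℝ}
    (hc : Continuous χ) (hs : HasCompactSupport χ) (ht : tsupport χ ⊆ e.baseSet)
    (w : EuclideanSpace 𝕜 (Fin n)) : bumpFun e χ w ∈ C0Section 𝕜 V := by
  refine ⟨continuousSection_bumpFun e hc ht w, ?_⟩
  refine squeeze_zero (fun x => norm_nonneg _) (norm_bumpFun_le e χ w) ?_
  simpa using hs.is_zero_at_infty.abs.mul_const ‖w‖

/-- There is a section through every vector of the bundle. -/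
lemma exists_section_apply_eq [T2Space X] [LocallyCompactSpace X] [IsMetricBundle 𝕜 V] (x : X)
    (v : V x) : ∃ s : C0Section 𝕜 V, s.1 x = v := by
  obtain ⟨n, e, hx⟩ := IsMetricBundle.exists_triv (𝕜 := 𝕜) (V := V) x
  obtain ⟨χ, hc, hs, ht, h1, -, -⟩ := exists_cutoff (isCompact_singleton (x := x))
    e.isOpen_baseSet (Set.singleton_subset_iff.2 hx)
  refine ⟨⟨_, bumpFun_mem e hc hs ht (e.coord ⟨x, hx⟩ v)⟩, ?_⟩
  refine (bumpFun_of_mem e _ _ hx).trans ?_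
  rw [h1 x rfl]
  simp

end BumpSection

section Frame

variable {X : Type*} [TopologicalSpace X] {r : RealStructure X} {E : EquivariantBundle r}

/-- A section of `E` as a section of the Clifford algebra bundle. -/
def clSection (s : C0Section ℝ E.fiber) : E.ClSection :=
  ⟨fun x => Cl.γ (s.1 x), by
    intro n e
    simp only [Cl.map_γ]
    exact Cl.continuous_γ.comp ((continuousSection_iff ℝ).1 s.2.1 n e), by
    simpa only [Cl.norm_γ] using s.2.2⟩

lemma gradeCl_clSection (s : C0Section ℝ E.fiber) : E.gradeCl (clSection s) = -clSection s :=
  Subtype.ext (funext fun _ => Cl.grade_γ _)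

lemma clSection_anticomm {s t : C0Section ℝ E.fiber} (h : ∀ x, inner ℝ (s.1 x) (t.1 x) = 0) :
    clSection s * clSection t = -(clSection t * clSection s) :=
  Subtype.ext (funext fun x => Cl.γ_anticomm (h x))

end Frame

/-! ### Intertwiners that do not vanish at a given point. -/

section Existence

variable {X : Type*} [TopologicalSpace X] {r : RealStructure X} {E : EquivariantBundle r} {a b : ℕ}
  {M₁ : Type*} [NormedAddCommGroup M₁] [NormedSpace ℂ M₁] [CompleteSpace M₁]
  {M₂ : Type*} [NormedAddCommGroup M₂] [NormedSpace ℂ M₂] [CompleteSpace M₂]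

lemma grade_lact_odd (K : KROrientation E a b M₁) {f : E.ClSection} (hf : E.gradeCl f = -f)
    (m : M₁) : K.lact f (K.grade m) = -K.grade (K.lact f m) := by
  rw [K.grade_lact, hf, map_neg, LinearMap.neg_apply, neg_neg]

variable [T2Space X] [LocallyCompactSpace X]

/-- A homogeneous map of right modules that supercommutes with given odd elements of
`C₀(X, Cl_E)`. -/
structure Adapted (K₁ : KROrientation E a b M₁) (K₂ : KROrientation E a b M₂)
    (P : E.ClSection → Prop) (S : M₁ →ₗ[ℂ] M₂) (ε : ℤˣ) : Prop where
  map_ract : ∀ g m, S (K₁.ract g m) = K₂.ract g (S m)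
  map_grade : ∀ m, S (K₁.grade m) = ((ε : ℤ) : ℂ) • K₂.grade (S m)
  map_lact : ∀ f, P f → ∀ m, S (K₁.lact f m) = ((ε : ℤ) : ℂ) • K₂.lact f (S m)

variable {K₁ : KROrientation E a b M₁} {K₂ : KROrientation E a b M₂}

-- The rank-one operator `m ↦ p ⟪m', m⟫` is right linear, and it is nonzero at `x` for suitable `m'`
-- because `p` is not null there and `M₁` is full. One of its homogeneous parts is then nonzero at
-- `x`.
variable (K₁ K₂) in
lemma exists_adapted_bot (x : X) : ∃ (S : M₁ →ₗ[ℂ] M₂) (ε : ℤˣ),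
    Adapted K₁ K₂ (fun _ => False) S ε ∧ ∃ m, S m ∉ K₂.Null x := by
  obtain ⟨n, p, hp⟩ := K₂.exists_tr_rinner_ne_zero x
  obtain ⟨m', m, hm⟩ : ∃ m' m, K₂.ract (K₁.rinner m' m) p ∉ K₂.Null x := by
    by_contra! h
    have h1 : ∀ c, K₂.rinner n p x * c = 0 := by
      refine K₁.rinner_span_induction x (fun m' m => ?_) ?_ ?_
      · have := h m' m n
        rwa [K₂.rinner_ract] at this
      · intro c d hc hd
        rw [mul_add, hc, hd, add_zero]
      · intro z c hc
        rw [mul_smul_comm, hc, smul_zero]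
    have h2 := h1 1
    rw [mul_one] at h2
    rw [h2, map_zero] at hp
    exact hp rfl
  let θ : M₁ →ₗ[ℂ] M₂ := (K₂.ract.flip p) ∘ₗ (K₁.rinner m')
  have hθ : ∀ g m, θ (K₁.ract g m) = K₂.ract g (θ m) := fun g m => by
    change K₂.ract (K₁.rinner m' (K₁.ract g m)) p = K₂.ract g (K₂.ract (K₁.rinner m' m) p)
    rw [K₁.rinner_ract, K₂.ract_mul]
  -- Twice the component of `θ` of parity `ε`. The two components add up to `2 θ`.
  let T : ℤˣ → M₁ →ₗ[ℂ] M₂ := fun ε => θ + ((ε : ℤ) : ℂ) • (K₂.grade ∘ₗ θ ∘ₗ K₁.grade)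
  have hTa : ∀ ε m, T ε m = θ m + ((ε : ℤ) : ℂ) • K₂.grade (θ (K₁.grade m)) := fun _ _ => rfl
  have hT : ∀ ε, Adapted K₁ K₂ (fun _ => False) (T ε) ε := fun ε =>
    { map_ract := fun g m => by
        rw [hTa, hTa, K₁.grade_ract, hθ, hθ, K₂.grade_ract, gradeTriv_gradeTriv, map_add, map_smul]
      map_grade := fun m => by
        rw [hTa, hTa, map_add, map_smul, smul_add, smul_smul, unit_mul_self_complex, one_smul,
          K₁.grade_grade, K₂.grade_grade, add_comm]
      map_lact := fun f hf => hf.elim }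
  by_cases h1 : T 1 m ∈ K₂.Null x
  · refine ⟨T (-1), -1, hT _, m, fun h2 => hm ?_⟩
    have h3 := (K₂.Null x).smul_mem (1 / 2 : ℂ) (add_mem h1 h2)
    have h4 : (1 / 2 : ℂ) • (T 1 m + T (-1) m) = θ m := by
      rw [hTa, hTa, Units.val_neg, Units.val_one]
      push_cast
      module
    rw [h4] at h3
    exact h3
  · exact ⟨T 1, 1, hT _, m, h1⟩

/-- This is a Clifford averaging. Combining `S` with its conjugate by `g` in two ways gives maps of
opposite parities that supercommute with `g`, and they still supercommute with the elements in `P`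
because these anticommute with `g`. The two maps cannot both vanish at `x`. The parity of the result
is therefore not under control. -/
lemma Adapted.exists_insert {P : E.ClSection → Prop} {S : M₁ →ₗ[ℂ] M₂} {ε : ℤˣ}
    (hS : Adapted K₁ K₂ P S ε) {x : X} (hx : ∃ m, S m ∉ K₂.Null x) {g : E.ClSection}
    (hg : E.gradeCl g = -g) (q : C₀(X, ℂ)) (hq : g * g = E.scalarCl q) (hqx : q x = 1)
    (hPg : ∀ f, P f → g * f = -(f * g)) :
    ∃ (S' : M₁ →ₗ[ℂ] M₂) (ε' : ℤˣ), Adapted K₁ K₂ (fun f => P f ∨ f = g) S' ε' ∧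
      ∃ m, S' m ∉ K₂.Null x := by
  have hgg : ∀ m, S (K₁.lact g (K₁.lact g m)) = K₂.lact g (K₂.lact g (S m)) := fun m => by
    rw [← K₁.lact_mul, ← K₂.lact_mul, hq, K₁.scalar, K₂.scalar, hS.map_ract]
  have hgf₁ : ∀ f, P f → ∀ m, K₁.lact g (K₁.lact f m) = -K₁.lact f (K₁.lact g m) := fun f hf m => by
    rw [← K₁.lact_mul, hPg f hf, map_neg, LinearMap.neg_apply, K₁.lact_mul]
  have hgf₂ : ∀ f, P f → ∀ m, K₂.lact g (K₂.lact f m) = -K₂.lact f (K₂.lact g m) := fun f hf m => by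
    rw [← K₂.lact_mul, hPg f hf, map_neg, LinearMap.neg_apply, K₂.lact_mul]
  have hεε := unit_mul_self_complex ε
  have hgr := hS.map_grade
  have hla := hS.map_lact
  set δ : ℂ := ((ε : ℤ) : ℂ) with hδ
  -- The inner bracket `g S + δ S g` has grading parity `-ε` but commutes with `g` with the sign
  -- `δ`. The additional factor `g` restores the parity `ε`. That `g * g` is scalar is used as `S g²
  -- = g² S`.
  let S₁ : M₁ →ₗ[ℂ] M₂ := K₂.lact g ∘ₗ (K₂.lact g ∘ₗ S + δ • (S ∘ₗ K₁.lact g))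
  let S₂ : M₁ →ₗ[ℂ] M₂ := S ∘ₗ K₁.lact g - δ • (K₂.lact g ∘ₗ S)
  have hS₁ : ∀ m, S₁ m = K₂.lact g (K₂.lact g (S m) + δ • S (K₁.lact g m)) := fun _ => rfl
  have hS₂ : ∀ m, S₂ m = S (K₁.lact g m) - δ • K₂.lact g (S m) := fun _ => rfl
  have hA₁ : Adapted K₁ K₂ (fun f => P f ∨ f = g) S₁ ε :=
    { map_ract := fun h m => by
        rw [hS₁, hS₁, K₁.lact_ract, hS.map_ract, hS.map_ract, K₂.lact_ract, ← map_smul, ← map_add,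
          K₂.lact_ract]
      map_grade := fun m => by
        rw [hS₁, hS₁, grade_lact_odd K₁ hg, hgr, map_neg, hgr, map_smul, grade_lact_odd K₂ hg,
          K₂.grade_lact, hg]
        simp only [map_add, map_smul, LinearMap.neg_apply, map_neg, smul_add, smul_neg, smul_smul,
          K₂.grade_lact, hg, neg_neg, ← hδ]
      map_lact := by
        rintro f (hf | rfl) m
        · rw [hS₁, hS₁, hla f hf, hgf₁ f hf, map_neg, hla f hf]
          simp only [map_add, map_smul, map_neg, smul_add, smul_neg, hgf₂ f hf, neg_neg, ← hδ]
        · rw [hS₁, hS₁, hgg]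
          simp only [map_add, map_smul, smul_add, smul_smul, hεε, one_smul, ← hδ]
          rw [add_comm] }
  have hA₂ : Adapted K₁ K₂ (fun f => P f ∨ f = g) S₂ (-ε) :=
    { map_ract := fun h m => by
        rw [hS₂, hS₂, K₁.lact_ract, hS.map_ract, hS.map_ract, K₂.lact_ract, ← map_smul, ← map_sub]
      map_grade := fun m => by
        rw [hS₂, hS₂, grade_lact_odd K₁ hg, hgr, map_neg, hgr, map_smul, grade_lact_odd K₂ hg]
        rw [Units.val_neg, Int.cast_neg, ← hδ]
        simp only [map_sub, map_smul, smul_sub, smul_neg, neg_smul, smul_smul, neg_mul, hεε,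
          one_smul]
      map_lact := by
        rw [Units.val_neg, Int.cast_neg, ← hδ]
        rintro f (hf | rfl) m
        · rw [hS₂, hS₂, hla f hf, hgf₁ f hf, map_neg, hla f hf]
          simp only [map_sub, map_smul, smul_sub, smul_neg, neg_smul, hgf₂ f hf, smul_smul,
            neg_mul, hεε, one_smul]
        · rw [hS₂, hS₂, hgg]
          simp only [map_sub, map_smul, smul_sub, neg_smul, smul_smul, neg_mul, hεε,
          one_smul]
          abel }
  obtain ⟨m, hm⟩ := hx
  by_cases h1 : S₁ m ∈ K₂.Null x
  · refine ⟨S₂, -ε, hA₂, K₁.lact g m, fun h2 => hm ?_⟩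
    have h3 := (K₂.Null x).smul_mem (1 / 2 : ℂ) (add_mem h1 h2)
    -- In `S₁ + S₂ g = g² S + S g²` the mixed terms `g S g` cancel, so that `2 g² S` remains. At
    -- `x`, `g²` is `1`.
    have h4 : (1 / 2 : ℂ) • (S₁ m + S₂ (K₁.lact g m)) = K₂.lact g (K₂.lact g (S m)) := by
      rw [hS₁, hS₂, hgg, map_add, map_smul]
      module
    rw [h4, ← K₂.lact_mul, hq, K₂.scalar] at h3
    have h5 := sub_mem h3 (K₂.scalar_sub_smul_mem_null x q (S m))
    rwa [sub_sub_cancel, hqx, one_smul] at h5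
  · exact ⟨S₁, ε, hA₁, m, h1⟩

/-- The square of a cutoff function. -/
def cutoffSq {χ : X → ℝ} (hc : Continuous χ) (hs : HasCompactSupport χ) : C₀(X, ℂ) :=
  compactlySupported (fun y => ((χ y : ℝ) : ℂ) ^ 2)
    ((Complex.continuous_ofReal.comp hc).pow 2)
    (hs.comp_left (g := fun t : ℝ => (t : ℂ) ^ 2) (by simp))

section LocalFrame

variable {n : ℕ} (e : IsometricTriv ℝ E.fiber n) {χ : X → ℝ} (hc : Continuous χ)
  (hs : HasCompactSupport χ) (ht : tsupport χ ⊆ e.baseSet)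

/-- The members of a local orthonormal frame of `E`, multiplied by a cutoff function, as sections
of the Clifford algebra bundle. -/
def frameSection (i : Fin n) : E.ClSection :=
  clSection ⟨_, bumpFun_mem e hc hs ht (EuclideanSpace.basisFun (Fin n) ℝ i)⟩

lemma frameSection_apply (i : Fin n) {y : X} (hy : y ∈ e.baseSet) :
    (frameSection e hc hs ht i).1 y = ((χ y : ℝ) : ℂ) •
      Cl.γ ((e.coord ⟨y, hy⟩).symm (EuclideanSpace.basisFun (Fin n) ℝ i)) := by
  rw [← Cl.γ_smul]
  exact congrArg Cl.γ (bumpFun_of_mem e χ _ hy)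

lemma gradeCl_frameSection (i : Fin n) :
    E.gradeCl (frameSection e hc hs ht i) = -frameSection e hc hs ht i :=
  gradeCl_clSection _

lemma frameSection_sq (i : Fin n) :
    frameSection e hc hs ht i * frameSection e hc hs ht i = E.scalarCl (cutoffSq hc hs) := by
  refine Subtype.ext (funext fun y => ?_)
  change Cl.γ (bumpFun e χ _ y) * Cl.γ (bumpFun e χ _ y) =
    algebraMap ℂ _ (((χ y : ℝ) : ℂ) ^ 2)
  rw [Cl.γ_mul_self]
  congr 1
  by_cases hy : y ∈ e.baseSet
  · rw [bumpFun_of_mem e χ _ hy, norm_smul, LinearIsometryEquiv.norm_map,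
      (EuclideanSpace.basisFun (Fin n) ℝ).orthonormal.1 i]
    simp
  · have h0 : χ y = 0 := image_eq_zero_of_notMem_tsupport fun h => hy (ht h)
    rw [bumpFun_of_eq_zero e _ h0, h0]
    simp

lemma frameSection_anticomm {i j : Fin n} (hij : i ≠ j) :
    frameSection e hc hs ht i * frameSection e hc hs ht j =
      -(frameSection e hc hs ht j * frameSection e hc hs ht i) := by
  refine clSection_anticomm fun y => ?_
  change inner ℝ (bumpFun e χ _ y) (bumpFun e χ _ y) = 0
  by_cases hy : y ∈ e.baseSet
  · rw [bumpFun_of_mem e χ _ hy, bumpFun_of_mem e χ _ hy, inner_smul_left, inner_smul_right,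
      LinearIsometryEquiv.inner_map_map, (EuclideanSpace.basisFun (Fin n) ℝ).orthonormal.2 hij,
      mul_zero, mul_zero]
  · have h0 : χ y = 0 := image_eq_zero_of_notMem_tsupport fun h => hy (ht h)
    rw [bumpFun_of_eq_zero e _ h0, inner_zero_left]

-- Induction over the frame. Its members are odd, anticommute and all have the square `χ²`, which is
-- `1` at `x`, so `Adapted.exists_insert` applies in each step.
variable (K₁ K₂) in
lemma exists_adapted_frame {x : X} (hx : χ x = 1) (s : Finset (Fin n)) :
    ∃ (S : M₁ →ₗ[ℂ] M₂) (ε : ℤˣ),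
      Adapted K₁ K₂ (fun f => ∃ i ∈ s, f = frameSection e hc hs ht i) S ε ∧
        ∃ m, S m ∉ K₂.Null x := by
  induction s using Finset.induction_on with
  | empty =>
    obtain ⟨S, ε, hS, hm⟩ := exists_adapted_bot K₁ K₂ x
    exact ⟨S, ε, ⟨hS.map_ract, hS.map_grade, by simp⟩, hm⟩
  | insert k s hk ih =>
    obtain ⟨S, ε, hS, hm⟩ := ih
    obtain ⟨S', ε', hS', hm'⟩ := hS.exists_insert hm (gradeCl_frameSection e hc hs ht k) _
      (frameSection_sq e hc hs ht k)
      (by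
        change ((χ x : ℝ) : ℂ) ^ 2 = 1
        rw [hx]; simp)
      (by
        rintro f ⟨i, hi, rfl⟩
        exact frameSection_anticomm e hc hs ht (by rintro rfl; exact hk hi))
    refine ⟨S', ε', ⟨hS'.map_ract, hS'.map_grade, ?_⟩, hm'⟩
    rintro f ⟨i, hi, rfl⟩
    refine hS'.map_lact _ ?_
    rcases Finset.mem_insert.1 hi with rfl | hi
    · exact Or.inr rfl
    · exact Or.inl ⟨i, hi, rfl⟩

end LocalFrame

/-- Although `S` need not supercommute with all of `C₀(X, Cl_E)`, it is right linear and hence local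
over `X`. Splitting a scalar factor off `f` is enough. -/
lemma Adapted.lact_mem_null {P : E.ClSection → Prop} {S : M₁ →ₗ[ℂ] M₂} {ε : ℤˣ}
    (hS : Adapted K₁ K₂ P S ε) {y : X} {f : E.ClSection} (hf : f.1 y = 0) (m : M₁) :
    S (K₁.lact f m) ∈ K₂.Null y := by
  obtain ⟨h, f', rfl, h0⟩ := E.exists_factor f
  rw [K₁.lact_mul, K₁.scalar, hS.map_ract]
  simpa [h0 y hf] using K₂.scalar_sub_smul_mem_null y h (S (K₁.lact f' m))

lemma twist_apply_eq (ε : ℤˣ) {f f' : E.ClSection} {y : X} (h : f.1 y = f'.1 y) :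
    (twist ε f).1 y = (twist ε f').1 y := by
  rcases Int.units_eq_one_or ε with rfl | rfl
  · simpa using h
  · rw [twist_neg_one, twist_neg_one]
    exact congrArg Cl.grade h

/-- A map that supercommutes with a local frame supercommutes with `C₀(X, Cl_E)` where the frame is
defined. -/
lemma Adapted.lact_sub_mem_null {n : ℕ} {e : IsometricTriv ℝ E.fiber n} {χ : X → ℝ}
    {hc : Continuous χ} {hs : HasCompactSupport χ} {ht : tsupport χ ⊆ e.baseSet}
    {S : M₁ →ₗ[ℂ] M₂} {ε : ℤˣ}
    (hS : Adapted K₁ K₂ (fun f => ∃ i ∈ Finset.univ, f = frameSection e hc hs ht i) S ε) {y : X}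
    (hy : χ y ≠ 0) (f : E.ClSection) (m : M₁) :
    S (K₁.lact f m) - K₂.lact (twist ε f) (S m) ∈ K₂.Null y := by
  have hyb : y ∈ e.baseSet := ht (subset_tsupport χ hy)
  -- The elements that supercommute with `S` over `y` are closed under sums and products and contain
  -- all scalars and the frame. So their values at `y` exhaust the Clifford algebra of the fibre.
  let D : E.ClSection → Prop := fun f =>
    ∀ m, S (K₁.lact f m) - K₂.lact (twist ε f) (S m) ∈ K₂.Null y
  have hadd : ∀ f g, D f → D g → D (f + g) := fun f g hf hg m => by
    rw [twist_add, map_add, map_add, LinearMap.add_apply, LinearMap.add_apply, map_add,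
      add_sub_add_comm]
    exact add_mem (hf m) (hg m)
  have hmul : ∀ f g, D f → D g → D (f * g) := fun f g hf hg m => by
    rw [twist_mul, K₁.lact_mul, K₂.lact_mul]
    have h1 := add_mem (hf (K₁.lact g m)) (K₂.lact_mem_null (hg m) (twist ε f))
    rw [map_sub, sub_add_sub_cancel] at h1
    exact h1
  have hscal : ∀ h : C₀(X, ℂ), D (E.scalarCl h) := fun h m => by
    rw [twist_scalarCl, K₁.scalar, K₂.scalar, hS.map_ract, sub_self]
    exact zero_mem _
  have hframe : ∀ i, D (frameSection e hc hs ht i) := fun i m => by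
    rw [hS.map_lact _ ⟨i, Finset.mem_univ i, rfl⟩]
    have h1 : ((ε : ℤ) : ℂ) • K₂.lact (frameSection e hc hs ht i) (S m) =
        K₂.lact (twist ε (frameSection e hc hs ht i)) (S m) := by
      rcases Int.units_eq_one_or ε with rfl | rfl
      · simp
      · simp [gradeCl_frameSection]
    rw [h1, sub_self]
    exact zero_mem _
  have hconst : ∀ z : ℂ, ∃ h : C₀(X, ℂ), h y = z := fun z => by
    obtain ⟨h, hh⟩ := exists_c0_apply_eq_one y
    exact ⟨z • h, by rw [ZeroAtInftyContinuousMap.smul_apply, hh, smul_eq_mul, mul_one]⟩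
  have hvec : ∀ w : EuclideanSpace ℝ (Fin n),
      ∃ f, D f ∧ f.1 y = Cl.γ ((e.coord ⟨y, hyb⟩).symm w) := by
    intro w
    have hw : w ∈ Submodule.span ℝ (Set.range (EuclideanSpace.basisFun (Fin n) ℝ)) := by
      rw [← OrthonormalBasis.coe_toBasis, Module.Basis.span_eq]; trivial
    have hsm : ∀ (t : ℝ) (f : E.ClSection) (v : EuclideanSpace ℝ (Fin n)), D f →
        f.1 y = Cl.γ ((e.coord ⟨y, hyb⟩).symm v) →
        ∃ f', D f' ∧ f'.1 y = Cl.γ ((e.coord ⟨y, hyb⟩).symm (t • v)) := by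
      intro t f v hD hf
      obtain ⟨h, hh⟩ := hconst (t : ℂ)
      refine ⟨E.scalarCl h * f, hmul _ _ (hscal h) hD, ?_⟩
      change algebraMap ℂ _ (h y) * f.1 y = _
      rw [hh, hf, map_smul, Cl.γ_smul, Algebra.smul_def]
    induction hw using Submodule.span_induction with
    | mem w hw =>
      obtain ⟨i, rfl⟩ := hw
      -- Divide by the cutoff factor of the frame section. This is where `χ y ≠ 0` is needed.
      obtain ⟨h, hh⟩ := hconst ((χ y : ℂ)⁻¹)
      refine ⟨E.scalarCl h * frameSection e hc hs ht i, hmul _ _ (hscal h) (hframe i), ?_⟩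
      change algebraMap ℂ _ (h y) * (frameSection e hc hs ht i).1 y = _
      rw [hh, frameSection_apply e hc hs ht i hyb, ← Algebra.smul_def, smul_smul,
        inv_mul_cancel₀ (by exact_mod_cast hy), one_smul]
    | zero =>
      refine ⟨E.scalarCl 0, hscal 0, ?_⟩
      change algebraMap ℂ _ 0 = _
      rw [map_zero, map_zero, ← zero_smul ℝ (0 : E.fiber y), Cl.γ_smul]
      simp
    | add v w _ _ hv hw =>
      obtain ⟨f, hf, hf'⟩ := hv
      obtain ⟨g, hg, hg'⟩ := hw
      refine ⟨f + g, hadd f g hf hg, ?_⟩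
      change f.1 y + g.1 y = _
      rw [hf', hg', map_add, Cl.γ_add]
    | smul t w _ hw =>
      obtain ⟨f, hf, hf'⟩ := hw
      exact hsm t f w hf hf'
  have hall : ∀ c : Cl (E.fiber y), ∃ f, D f ∧ f.1 y = c := by
    intro c
    have hc' : c ∈ Algebra.adjoin ℂ (Set.range (Cl.γ : E.fiber y → Cl (E.fiber y))) := by
      rw [Cl.adjoin_γ]; trivial
    induction hc' using Algebra.adjoin_induction with
    | mem c hc =>
      obtain ⟨v, rfl⟩ := hc
      simpa using hvec (e.coord ⟨y, hyb⟩ v)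
    | algebraMap z =>
      obtain ⟨h, hh⟩ := hconst z
      exact ⟨E.scalarCl h, hscal h, by rw [← hh]; rfl⟩
    | add c d _ _ hc hd =>
      obtain ⟨f, hf, rfl⟩ := hc
      obtain ⟨g, hg, rfl⟩ := hd
      exact ⟨f + g, hadd f g hf hg, rfl⟩
    | mul c d _ _ hc hd =>
      obtain ⟨f, hf, rfl⟩ := hc
      obtain ⟨g, hg, rfl⟩ := hd
      exact ⟨f * g, hmul f g hf hg, rfl⟩
  -- Both sides depend only on the value of `f` at `y`, so `f` may be replaced by an element of `D`
  -- with the same value.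
  obtain ⟨f', hD, hf'⟩ := hall (f.1 y)
  have h1 : S (K₁.lact (f - f') m) ∈ K₂.Null y := hS.lact_mem_null (by
    change f.1 y - f'.1 y = 0
    rw [hf', sub_self]) m
  rw [map_sub, LinearMap.sub_apply, map_sub] at h1
  have h2 := add_mem (add_mem h1 (hD m)) (K₂.lact_sub_mem_null (twist_apply_eq ε hf') (S m))
  rwa [sub_add_sub_cancel, sub_add_sub_cancel] at h2

variable (K₁ K₂) in
/-- There is an intertwiner that does not vanish at a given point. -/
lemma exists_intertwiner (x : X) : ∃ T : Intertwiner K₁ K₂, Intertwiner.coef T T x = 1 := by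
  obtain ⟨n, e, hx⟩ := IsMetricBundle.exists_triv (𝕜 := ℝ) (V := E.fiber) x
  obtain ⟨χ, hc, hs, ht, h1, -, -⟩ := exists_cutoff (isCompact_singleton (x := x))
    e.isOpen_baseSet (Set.singleton_subset_iff.2 hx)
  obtain ⟨S, ε, hS, m, hm⟩ := exists_adapted_frame K₁ K₂ e hc hs ht (h1 x rfl) Finset.univ
  let q := scalarTriv a b (cutoffSq hc hs)
  have hq : ∀ (g : TrivCl X a b), q * g = g * q := fun g =>
    ZeroAtInftyContinuousMap.ext fun y => Algebra.commutes (cutoffSq hc hs y) (g y)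
  have hgq : gradeTriv q = q := ZeroAtInftyContinuousMap.ext fun y =>
    AlgHom.commutes (Cl.grade : ClAB a b →ₐ[ℂ] ClAB a b) (cutoffSq hc hs y)
  have hqa : ∀ y, (cutoffSq hc hs) y = ((χ y : ℝ) : ℂ) ^ 2 := fun _ => rfl
  -- The map `S` supercommutes with `C₀(X, Cl_E)` only where `χ` is nonzero. Multiplication by the
  -- central even function `χ²` makes the defect vanish elsewhere.
  let T : Intertwiner K₁ K₂ :=
    { toFun := K₂.ract q ∘ₗ S
      sign := ε
      map_ract := fun g m => by
        change K₂.ract q (S (K₁.ract g m)) = K₂.ract g (K₂.ract q (S m))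
        rw [hS.map_ract, ← K₂.ract_mul, ← K₂.ract_mul, hq]
      map_lact := fun f m => by
        change K₂.ract q (S (K₁.lact f m)) = K₂.lact (twist ε f) (K₂.ract q (S m))
        rw [K₂.lact_ract]
        refine K₂.eq_of_null fun y => ?_
        rw [← map_sub]
        by_cases hy : χ y = 0
        · have h2 := K₂.scalar_sub_smul_mem_null y (cutoffSq hc hs)
            (S (K₁.lact f m) - K₂.lact (twist ε f) (S m))
          rwa [hqa, hy, Complex.ofReal_zero, zero_pow two_ne_zero, zero_smul, sub_zero] at h2
        · exact K₂.ract_mem_null (hS.lact_sub_mem_null hy f m) q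
      map_grade := fun m => by
        change K₂.ract q (S (K₁.grade m)) = ((ε : ℤ) : ℂ) • K₂.grade (K₂.ract q (S m))
        rw [hS.map_grade, K₂.grade_ract, map_smul, hgq] }
  have hT0 : Intertwiner.coef T T x ≠ 0 := fun h0 => hm (by
    have h2 := Intertwiner.mem_null_of_coef_eq_zero h0 m
    have h3 := sub_mem h2 (K₂.scalar_sub_smul_mem_null x (cutoffSq hc hs) (S m))
    change K₂.ract q (S m) - (K₂.ract q (S m) - _) ∈ _ at h3
    rwa [sub_sub_cancel, hqa, h1 x rfl, Complex.ofReal_one, one_pow, one_smul] at h3)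
  obtain ⟨hre, him⟩ := Complex.nonneg_iff.1 (Intertwiner.coef_self_nonneg T x)
  have hre0 : (Intertwiner.coef T T x).re ≠ 0 := fun h => hT0 (Complex.ext h him.symm)
  have hval : Intertwiner.coef T T x = (((Intertwiner.coef T T x).re : ℝ) : ℂ) :=
    Complex.ext rfl (by simpa using him.symm)
  -- Rescale by a positive constant to get norm `1` at `x`. Away from `x` the norm is not
  -- prescribed.
  refine ⟨Intertwiner.smul (((√(Intertwiner.coef T T x).re)⁻¹ : ℝ) : ℂ) T, ?_⟩
  rw [Intertwiner.coef_smul_smul, hval]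
  have : star ((((√(Intertwiner.coef T T x).re)⁻¹ : ℝ) : ℂ)) =
    (((√(Intertwiner.coef T T x).re)⁻¹ : ℝ) : ℂ) := Complex.conj_ofReal _
  rw [Complex.ofReal_re, this, ← Complex.ofReal_mul, ← Complex.ofReal_mul, ← mul_inv,
    Real.mul_self_sqrt hre, inv_mul_cancel₀ hre0, Complex.ofReal_one]

end Existence

end

/-! ### The line bundle of intertwiners. -/

section

/-- Multiplication by a complex number of norm `1`. -/
def mulUnit (u : ℂ) (hu : ‖u‖ = 1) : ℂ ≃ₗᵢ[ℂ] ℂ where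
  toFun z := u * z
  invFun z := star u * z
  left_inv z := by
    have : star u * u = 1 := by
      rw [← starRingEnd_apply, ← Complex.normSq_eq_conj_mul_self, Complex.normSq_eq_norm_sq, hu]
      simp
    change star u * (u * z) = z
    rw [← mul_assoc, this, one_mul]
  right_inv z := by
    have : u * star u = 1 := by
      rw [← starRingEnd_apply, Complex.mul_conj, Complex.normSq_eq_norm_sq, hu]
      simp
    change u * (star u * z) = z
    rw [← mul_assoc, this, one_mul]
  map_add' z w := mul_add u z w
  map_smul' z w := by simp only [smul_eq_mul, RingHom.id_apply]; ring
  norm_map' z := by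
    change ‖u * z‖ = ‖z‖
    rw [norm_mul, hu, one_mul]

lemma norm_eq_one_of_star_mul_self {u : ℂ} (h : star u * u = 1) : ‖u‖ = 1 := by
  have h1 := congrArg norm h
  rw [norm_mul, norm_star, norm_one, ← sq] at h1
  exact (pow_eq_one_iff_of_nonneg (norm_nonneg _) two_ne_zero).1 h1

section LineBundle

variable {X : Type*} [TopologicalSpace X] {r : RealStructure X} {E : EquivariantBundle r} {a b : ℕ}
  {M₁ : Type*} [NormedAddCommGroup M₁] [NormedSpace ℂ M₁] [CompleteSpace M₁]
  {M₂ : Type*} [NormedAddCommGroup M₂] [NormedSpace ℂ M₂] [CompleteSpace M₂]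
  [T2Space X] [LocallyCompactSpace X]
  (K₁ : KROrientation E a b M₁) (K₂ : KROrientation E a b M₂)

open Intertwiner

/-- An intertwiner that spans the line of intertwiners in the fibre over `x`. -/
def frame (x : X) : Intertwiner K₁ K₂ := (exists_intertwiner K₁ K₂ x).choose

lemma coef_frame (x : X) : coef (frame K₁ K₂ x) (frame K₁ K₂ x) x = 1 :=
  (exists_intertwiner K₁ K₂ x).choose_spec

lemma coef_frame_ne_zero (x : X) : coef (frame K₁ K₂ x) (frame K₁ K₂ x) x ≠ 0 := by
  rw [coef_frame]; exact one_ne_zero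

-- Parseval's identity for the unit vector `frame K₁ K₂ x` in the line over `x`.
variable {K₁ K₂} in
lemma coef_mul_coef_frame (S T : Intertwiner K₁ K₂) (x : X) :
    coef S (frame K₁ K₂ x) x * coef (frame K₁ K₂ x) T x = coef S T x := by
  rw [coef_mul_coef _ _ _ (coef_frame_ne_zero K₁ K₂ x), coef_frame, one_mul]

/-- The line of intertwiners in the fibre over a point, with its unit vector `frame K₁ K₂ x`. -/
def LineFiber (_ : KROrientation E a b M₁) (_ : KROrientation E a b M₂) (_ : X) : Type := ℂ

instance (x : X) : NormedAddCommGroup (LineFiber K₁ K₂ x) := inferInstanceAs (NormedAddCommGroup ℂ)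

instance (x : X) : InnerProductSpace ℂ (LineFiber K₁ K₂ x) :=
  inferInstanceAs (InnerProductSpace ℂ ℂ)

/-- A vector in the line over `x` as a complex number. -/
def lineCoord (x : X) : LineFiber K₁ K₂ x ≃ₗᵢ[ℂ] ℂ := LinearIsometryEquiv.refl ℂ ℂ

variable {K₁ K₂} in
/-- The inner product of an intertwiner with a vector in the line bundle. -/
def pairing (S : Intertwiner K₁ K₂) (p : TotalSpace Unit (LineFiber K₁ K₂)) : ℂ :=
  coef S (frame K₁ K₂ p.proj) p.proj * lineCoord K₁ K₂ p.proj p.snd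

variable {K₁ K₂} in
lemma pairing_mk (S : Intertwiner K₁ K₂) (x : X) (v : LineFiber K₁ K₂ x) :
    pairing S ⟨x, v⟩ = coef S (frame K₁ K₂ x) x * lineCoord K₁ K₂ x v := rfl

/-- The unit vectors are chosen independently at the points of `X`, so the product topology of `X ×
ℂ` would be wrong. The topology is the coarsest one for which the projection and the inner products
with all intertwiners are continuous. -/
instance : TopologicalSpace (TotalSpace Unit (LineFiber K₁ K₂)) :=
  .induced TotalSpace.proj inferInstance ⊓
    ⨅ S : Intertwiner K₁ K₂, .induced (pairing S) inferInstance

lemma continuous_lineBundle_iff {Y : Type*} [TopologicalSpace Y]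
    {f : Y → TotalSpace Unit (LineFiber K₁ K₂)} :
    Continuous f ↔ Continuous (fun y => (f y).proj) ∧
      ∀ S : Intertwiner K₁ K₂, Continuous fun y => pairing S (f y) :=
  continuous_inf_rng.trans (and_congr continuous_induced_rng
    (continuous_iInf_rng.trans (forall_congr' fun _ => continuous_induced_rng)))

lemma continuous_lineBundle_proj :
    Continuous (TotalSpace.proj : TotalSpace Unit (LineFiber K₁ K₂) → X) :=
  ((continuous_lineBundle_iff K₁ K₂).1 continuous_id).1

variable {K₁ K₂} in
lemma continuous_pairing (S : Intertwiner K₁ K₂) : Continuous (pairing S) :=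
  ((continuous_lineBundle_iff K₁ K₂).1 continuous_id).2 S

variable {K₁ K₂} in
lemma coef_self_eq_ofReal (S : Intertwiner K₁ K₂) (x : X) :
    coef S S x = (((coef S S x).re : ℝ) : ℂ) :=
  Complex.ext rfl (by simpa using (Complex.nonneg_iff.1 (coef_self_nonneg S x)).2.symm)

variable {K₁ K₂} in
lemma coef_self_re_nonneg (S : Intertwiner K₁ K₂) (x : X) : 0 ≤ (coef S S x).re :=
  (Complex.nonneg_iff.1 (coef_self_nonneg S x)).1

variable {K₁ K₂} in
/-- The norm of an intertwiner in the fibre over `x`. -/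
def size (S : Intertwiner K₁ K₂) (x : X) : ℝ := √(coef S S x).re

variable {K₁ K₂} in
lemma size_mul_self (S : Intertwiner K₁ K₂) (x : X) :
    ((size S x : ℝ) : ℂ) * ((size S x : ℝ) : ℂ) = coef S S x := by
  rw [← Complex.ofReal_mul, size, Real.mul_self_sqrt (coef_self_re_nonneg S x),
    ← coef_self_eq_ofReal]

variable {K₁ K₂} in
lemma size_ne_zero {S : Intertwiner K₁ K₂} {x : X} (h : coef S S x ≠ 0) :
    ((size S x : ℝ) : ℂ) ≠ 0 := fun h0 => h (by rw [← size_mul_self, h0, zero_mul])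

variable {K₁ K₂} in
lemma continuous_size (S : Intertwiner K₁ K₂) : Continuous fun x => ((size S x : ℝ) : ℂ) :=
  Complex.continuous_ofReal.comp (Real.continuous_sqrt.comp
    (Complex.continuous_re.comp (continuous_coef S S)))

variable {K₁ K₂} in
lemma star_coef_mul_coef (S : Intertwiner K₁ K₂) (x : X) :
    star (coef S (frame K₁ K₂ x) x) * coef S (frame K₁ K₂ x) x = coef S S x := by
  rw [← coef_symm, mul_comm, coef_mul_coef_frame]

variable {K₁ K₂} in
lemma star_size (S : Intertwiner K₁ K₂) (x : X) :
    star ((size S x : ℝ) : ℂ) = ((size S x : ℝ) : ℂ) := Complex.conj_ofReal _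

variable {K₁ K₂} in
lemma norm_coef_div_size {S : Intertwiner K₁ K₂} {x : X} (h : coef S S x ≠ 0) :
    ‖coef S (frame K₁ K₂ x) x / ((size S x : ℝ) : ℂ)‖ = 1 := by
  apply norm_eq_one_of_star_mul_self
  rw [star_div₀, star_size, div_mul_div_comm, star_coef_mul_coef, size_mul_self, div_self h]

variable {K₁ K₂} in
/-- The trivialisation of the line bundle given by an intertwiner, where it does not vanish. -/
def lineTriv (S : Intertwiner K₁ K₂) : IsometricTriv ℂ (LineFiber K₁ K₂) 1 where
  baseSet := {x | coef S S x ≠ 0}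
  isOpen_baseSet := isOpen_ne_fun (continuous_coef S S) continuous_const
  -- The coordinate of a vector is its inner product with the normalised intertwiner `S / size S`.
  coord x := ((lineCoord K₁ K₂ x).trans (mulUnit _ (norm_coef_div_size x.2))).trans
    (OrthonormalBasis.singleton (Fin 1) ℂ).repr
  continuous_coord := by
    refine (OrthonormalBasis.singleton (Fin 1) ℂ).repr.continuous.comp ?_
    have h1 : Continuous fun p : {p : TotalSpace Unit (LineFiber K₁ K₂) //
        p.proj ∈ {x | coef S S x ≠ 0}} => pairing S p.1 / ((size S p.1.proj : ℝ) : ℂ) :=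
      ((continuous_pairing S).comp continuous_subtype_val).div
        ((continuous_size S).comp ((continuous_lineBundle_proj K₁ K₂).comp continuous_subtype_val))
        fun p => size_ne_zero p.2
    refine h1.congr fun p => ?_
    exact (div_mul_eq_mul_div _ _ _).symm
  continuous_coord_symm := by
    rw [continuous_lineBundle_iff]
    refine ⟨continuous_subtype_val.comp continuous_fst, fun T => ?_⟩
    have h1 : Continuous fun q : {x | coef S S x ≠ 0} × EuclideanSpace ℂ (Fin 1) =>
        coef T S q.1 / ((size S q.1 : ℝ) : ℂ) *
          (OrthonormalBasis.singleton (Fin 1) ℂ).repr.symm q.2 := by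
      refine Continuous.mul (Continuous.div ?_ ?_ fun q => size_ne_zero q.1.2)
        ((OrthonormalBasis.singleton (Fin 1) ℂ).repr.symm.continuous.comp continuous_snd)
      · exact (continuous_coef T S).comp (continuous_subtype_val.comp continuous_fst)
      · exact (continuous_size S).comp (continuous_subtype_val.comp continuous_fst)
    refine h1.congr fun q => ?_
    -- The inverse coordinate multiplies by the conjugate of the same unimodular factor. By
    -- Parseval, pairing with `T` gives `coef T S / size S`, in which the discontinuous frame no
    -- longer occurs.
    rw [← coef_mul_coef_frame T S q.1, coef_symm (frame K₁ K₂ q.1) S, mul_div_assoc, mul_assoc]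
    refine congrArg (coef T (frame K₁ K₂ q.1) q.1 * ·) ?_
    have h2 : star (coef S (frame K₁ K₂ q.1) q.1) / ((size S q.1 : ℝ) : ℂ) =
        star (coef S (frame K₁ K₂ q.1) q.1 / ((size S q.1 : ℝ) : ℂ)) := by
      rw [star_div₀, star_size]
    exact congrArg (· * (OrthonormalBasis.singleton (Fin 1) ℂ).repr.symm q.2) h2

instance : IsMetricBundle ℂ (LineFiber K₁ K₂) where
  continuous_proj := continuous_lineBundle_proj K₁ K₂
  exists_triv x := ⟨1, lineTriv (frame K₁ K₂ x), coef_frame_ne_zero K₁ K₂ x⟩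

/-- The coordinate of the "real" conjugate of the unit vector over `x`. -/
def conjCoef (x : X) : ℂ := coef (frame K₁ K₂ (r x)) (frame K₁ K₂ x).conj (r x)

lemma norm_conjCoef (x : X) : ‖conjCoef K₁ K₂ x‖ = 1 := by
  apply norm_eq_one_of_star_mul_self
  rw [conjCoef, ← coef_symm, coef_mul_coef_frame, coef_conj_conj, r.involutive, coef_frame,
    star_one]

/-- The matrix of an antiunitary involution is symmetric. Together with `norm_conjCoef`, this makes
the conjugation of the line bundle involutive. -/
lemma conjCoef_apply_apply (x : X) : conjCoef K₁ K₂ (r x) = conjCoef K₁ K₂ x := by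
  have h := coef_conj_left (frame K₁ K₂ x) (frame K₁ K₂ (r x)) (r x)
  rw [coef_symm, star_inj] at h
  rw [conjCoef, conjCoef, h, r.involutive x]

lemma conjCoef_mul (x : X) : conjCoef K₁ K₂ (r x) * star (conjCoef K₁ K₂ x) = 1 := by
  rw [conjCoef_apply_apply, ← starRingEnd_apply, Complex.mul_conj, Complex.normSq_eq_norm_sq,
    norm_conjCoef]
  simp

lemma norm_sign (ε : ℤˣ) : ‖((ε : ℤ) : ℂ)‖ = 1 := by
  rcases Int.units_eq_one_or ε with rfl | rfl <;> simp

/-- The line bundle of intertwiners. -/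
def lineBundle : RealLineBundle r where
  fiber := LineFiber K₁ K₂
  finrank_fiber x := Module.finrank_self ℂ
  grade x := (lineCoord K₁ K₂ x).trans ((mulUnit _ (norm_sign (frame K₁ K₂ x).sign)).trans
    (lineCoord K₁ K₂ x).symm)
  grade_grade x v := by
    change (((frame K₁ K₂ x).sign : ℤ) : ℂ) *
      ((((frame K₁ K₂ x).sign : ℤ) : ℂ) * lineCoord K₁ K₂ x v) = lineCoord K₁ K₂ x v
    rw [← mul_assoc, unit_mul_self_complex, one_mul]
  continuous_grade := by
    rw [continuous_lineBundle_iff]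
    refine ⟨continuous_lineBundle_proj K₁ K₂, fun S => ?_⟩
    refine ((continuous_pairing S).const_smul ((S.sign : ℤ) : ℂ)).congr fun p => ?_
    change ((S.sign : ℤ) : ℂ) *
        (coef S (frame K₁ K₂ p.proj) p.proj * lineCoord K₁ K₂ p.proj p.snd) =
      coef S (frame K₁ K₂ p.proj) p.proj *
        ((((frame K₁ K₂ p.proj).sign : ℤ) : ℂ) * lineCoord K₁ K₂ p.proj p.snd)
    by_cases h : S.sign = (frame K₁ K₂ p.proj).sign
    · rw [h]; ring
    · rw [coef_of_sign_ne _ _ _ h]; ring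
  conj x := ((lineCoord K₁ K₂ x).trans (starₗᵢ ℂ : ℂ ≃ₗᵢ⋆[ℂ] ℂ)).trans
    ((mulUnit _ (norm_conjCoef K₁ K₂ x)).trans (lineCoord K₁ K₂ (r x)).symm)
  conj_conj p := by
    obtain ⟨x, v⟩ := p
    -- All fibres are `ℂ` by definition, so the heterogeneous equality is an equality of complex
    -- numbers.
    refine TotalSpace.ext (r.involutive x) (heq_of_eq ?_)
    change conjCoef K₁ K₂ (r x) * star (conjCoef K₁ K₂ x * star (lineCoord K₁ K₂ x v)) =
      lineCoord K₁ K₂ x v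
    rw [star_mul', star_star, ← mul_assoc, conjCoef_mul, one_mul]
  continuous_conj := by
    rw [continuous_lineBundle_iff]
    refine ⟨r.continuous_toFun.comp (continuous_lineBundle_proj K₁ K₂), fun S => ?_⟩
    -- Antiunitarity: pairing `S` with a conjugated vector is the complex conjugate of pairing
    -- `S.conj` with the vector.
    refine ((continuous_pairing S.conj).star).congr fun p => ?_
    change star (coef S.conj (frame K₁ K₂ p.proj) p.proj * lineCoord K₁ K₂ p.proj p.snd) =
      coef S (frame K₁ K₂ (r p.proj)) (r p.proj) * (conjCoef K₁ K₂ p.proj *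
        star (lineCoord K₁ K₂ p.proj p.snd))
    rw [coef_conj_left, star_mul', star_star, conjCoef, ← mul_assoc, coef_mul_coef_frame]
  conj_grade x v := by
    change conjCoef K₁ K₂ x * star ((((frame K₁ K₂ x).sign : ℤ) : ℂ) * lineCoord K₁ K₂ x v) =
      (((frame K₁ K₂ (r x)).sign : ℤ) : ℂ) * (conjCoef K₁ K₂ x * star (lineCoord K₁ K₂ x v))
    -- Conjugation preserves parity. If the two frame vectors had different parities, then they
    -- would be orthogonal and `conjCoef` would vanish.
    have h : (frame K₁ K₂ (r x)).sign = (frame K₁ K₂ x).sign := by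
      by_contra h
      have h0 : conjCoef K₁ K₂ x = 0 := coef_of_sign_ne _ _ _ h
      have h1 := norm_conjCoef K₁ K₂ x
      rw [h0, norm_zero] at h1
      exact zero_ne_one h1
    rw [h, star_mul']
    have h2 : star ((((frame K₁ K₂ x).sign : ℤ) : ℂ)) = (((frame K₁ K₂ x).sign : ℤ) : ℂ) := by simp
    rw [h2]; ring

end LineBundle

end

/-! ### The product of sections with module elements. -/

section

namespace KROrientation

variable {X : Type*} [TopologicalSpace X] {r : RealStructure X} {E : EquivariantBundle r} {a b : ℕ}
  {M : Type*} [NormedAddCommGroup M] [NormedSpace ℂ M] [CompleteSpace M]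
  (K : KROrientation E a b M)

lemma rinner_congr {x : X} {m m' n n' : M} (hm : m - m' ∈ K.Null x) (hn : n - n' ∈ K.Null x) :
    K.rinner m n x = K.rinner m' n' x := by
  have h1 := K.rinner_null_left hm n
  rw [K.rinner_sub_left, sub_eq_zero] at h1
  have h2 := hn m'
  rw [K.rinner_sub_right, sub_eq_zero] at h2
  rw [h1, h2]

lemma norm_ract_le (g : TrivCl X a b) (m : M) : ‖K.ract g m‖ ≤ ‖g‖ * ‖m‖ := by
  refine K.norm_le_of_rinner (by positivity) fun x => ?_
  rw [K.rinner_ract, K.rinner_ract_left, ZeroAtInftyContinuousMap.mul_apply,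
    ZeroAtInftyContinuousMap.mul_apply]
  have h1 : ‖(star g : TrivCl X a b) x‖ ≤ ‖g‖ := by
    rw [ZeroAtInftyContinuousMap.star_apply, norm_star]
    exact c0_norm_apply_le g x
  have h2 : ‖K.rinner m m x‖ ≤ ‖m‖ ^ 2 := by
    rw [← K.norm_rinner_self]; exact c0_norm_apply_le _ x
  calc _ ≤ ‖(star g : TrivCl X a b) x * K.rinner m m x‖ * ‖g x‖ := norm_mul_le _ _
    _ ≤ (‖(star g : TrivCl X a b) x‖ * ‖K.rinner m m x‖) * ‖g x‖ := by
        gcongr; exact norm_mul_le _ _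
    _ ≤ (‖g‖ * ‖m‖ ^ 2) * ‖g‖ := by
        gcongr; exact c0_norm_apply_le g x
    _ = (‖g‖ * ‖m‖) ^ 2 := by ring

variable [T2Space X] [LocallyCompactSpace X]

/-- The fibre seminorm is dominated by the norm, so it is continuous along the sequence. -/
lemma mem_null_of_tendsto {x : X} {n : M} {u : ℕ → M} (hu : Tendsto u atTop (𝓝 n))
    (h : Tendsto (fun k => K.fiberNorm x (u k)) atTop (𝓝 0)) : n ∈ K.Null x := by
  refine K.mem_null_of_fiberNorm (le_antisymm ?_ (apply_nonneg _ _))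
  have h1 : Tendsto (fun k => ‖n - u k‖ + K.fiberNorm x (u k)) atTop (𝓝 0) := by
    have h2 := (tendsto_const_nhds (x := n)).sub hu
    rw [sub_self] at h2
    simpa using h2.norm.add h
  refine ge_of_tendsto' h1 fun k => ?_
  calc K.fiberNorm x n = K.fiberNorm x ((n - u k) + u k) := by rw [sub_add_cancel]
    _ ≤ K.fiberNorm x (n - u k) + K.fiberNorm x (u k) := map_add_le_add _ _ _
    _ ≤ _ := by gcongr; exact K.fiberNorm_le x _

/-- Cutting off an element of `M` changes it little. -/
lemma exists_cutoff_norm_sub_le (n : M) {ε : ℝ} (hε : 0 < ε) :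
    ∃ h : C₀(X, ℂ), ∃ χ : X → ℝ, Continuous χ ∧ HasCompactSupport χ ∧ (∀ x, h x = χ x) ∧
      ‖n - K.ract (scalarTriv a b h) (K.ract (scalarTriv a b h) n)‖ ≤ ε := by
  have ht := (zero_at_infty (K.rinner n n)).norm
  rw [norm_zero] at ht
  have hev := ht.eventually (gt_mem_nhds (show (0 : ℝ) < ε ^ 2 by positivity))
  obtain ⟨C, hC, hCs⟩ := mem_cocompact.1 hev
  obtain ⟨χ, hc, hs, -, h1, h0, hle⟩ := exists_cutoff hC isOpen_univ (Set.subset_univ _)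
  refine ⟨compactlySupported (fun y => (χ y : ℂ)) (Complex.continuous_ofReal.comp hc)
    (hs.comp_left (g := fun t : ℝ => (t : ℂ)) (by simp)), χ, hc, hs, fun _ => rfl, ?_⟩
  set h := compactlySupported (fun y => (χ y : ℂ)) (Complex.continuous_ofReal.comp hc)
    (hs.comp_left (g := fun t : ℝ => (t : ℂ)) (by simp))
  refine K.norm_le_of_rinner hε.le fun x => ?_
  have hx : h x = (χ x : ℂ) := rfl
  -- In the fibre over `x` the difference is `(1 - χ²) n`. It vanishes on `C`, and outside `C` the
  -- inner product `⟪n, n⟫` is already below `ε²`.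
  have hn : (n - K.ract (scalarTriv a b h) (K.ract (scalarTriv a b h) n)) -
      ((1 - χ x ^ 2 : ℝ) : ℂ) • n ∈ K.Null x := by
    have h2 := K.scalar_sub_smul_mem_null x h (K.ract (scalarTriv a b h) n)
    have h3 := (K.Null x).smul_mem (h x) (K.scalar_sub_smul_mem_null x h n)
    have h4 := neg_mem (add_mem h2 h3)
    convert h4 using 1
    rw [hx]
    push_cast
    module
  rw [K.rinner_congr hn hn, K.rinner_smul_left, K.rinner_smul_right, norm_smul, norm_smul,
    norm_star, Complex.norm_real, Real.norm_eq_abs]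
  have hb : 0 ≤ χ x ^ 2 ∧ χ x ^ 2 ≤ 1 := ⟨by positivity, pow_le_one₀ (h0 x) (hle x)⟩
  by_cases hxC : x ∈ C
  · rw [h1 x hxC]
    simp only [one_pow, sub_self, abs_zero, zero_mul]
    positivity
  · have h5 : ‖K.rinner n n x‖ < ε ^ 2 := hCs hxC
    have h6 : |1 - χ x ^ 2| ≤ 1 := by rw [abs_le]; constructor <;> linarith
    calc _ ≤ 1 * (1 * ‖K.rinner n n x‖) := by gcongr
      _ ≤ ε ^ 2 := by linarith

end KROrientation

section Tensor

variable {X : Type*} [TopologicalSpace X] {r : RealStructure X} {E : EquivariantBundle r} {a b : ℕ}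
  {M₁ : Type*} [NormedAddCommGroup M₁] [NormedSpace ℂ M₁] [CompleteSpace M₁]
  {M₂ : Type*} [NormedAddCommGroup M₂] [NormedSpace ℂ M₂] [CompleteSpace M₂]
  [T2Space X] [LocallyCompactSpace X]
  {K₁ : KROrientation E a b M₁} {K₂ : KROrientation E a b M₂}

open Intertwiner

lemma sub_smul_frame_mem_null (S : Intertwiner K₁ K₂) (x : X) (m : M₁) :
    S m - coef (frame K₁ K₂ x) S x • frame K₁ K₂ x m ∈ K₂.Null x := by
  have h := smul_sub_smul_mem_null (frame K₁ K₂ x) S (coef_frame_ne_zero K₁ K₂ x) m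
  rwa [coef_frame, one_smul] at h

variable (K₁ K₂) in
/-- A function with compact support is a combination of squared norms of intertwiners. -/
lemma exists_sum_coef {h : X → ℝ} (hc : Continuous h) (hs : HasCompactSupport h) :
    ∃ (t : Finset X) (g : X → ℝ), Continuous g ∧ HasCompactSupport g ∧
      ∀ x, ∑ i ∈ t, (g x : ℂ) * coef (frame K₁ K₂ i) (frame K₁ K₂ i) x = h x := by
  have hcoef : ∀ i, Continuous fun x => (coef (frame K₁ K₂ i) (frame K₁ K₂ i) x).re := fun i =>
    Complex.continuous_re.comp (continuous_coef _ _)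
  obtain ⟨t, -, ht⟩ := hs.isCompact.elim_nhds_subcover
    (fun i => {x | 1 / 2 < (coef (frame K₁ K₂ i) (frame K₁ K₂ i) x).re}) fun i _ =>
      (isOpen_lt continuous_const (hcoef i)).mem_nhds (by
        rw [Set.mem_ofPred_eq, coef_frame, Complex.one_re]; norm_num)
  let f : X → ℝ := fun x => ∑ i ∈ t, (coef (frame K₁ K₂ i) (frame K₁ K₂ i) x).re
  have hf : Continuous f := continuous_finsetSum _ fun i _ => hcoef i
  have hpos : ∀ x, max (f x) (1 / 2) ≠ 0 := fun x => by
    have := le_max_right (f x) (1 / 2); positivity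
  -- The sum `f` of squared norms is at least `1 / 2` on the support of `h`. The maximum with `1 /
  -- 2` makes the quotient continuous everywhere and changes nothing where `h ≠ 0`.
  refine ⟨t, fun x => h x / max (f x) (1 / 2), hc.div (hf.max continuous_const) hpos,
    hs.mono fun x hx hx0 => hx (by simp [hx0]), fun x => ?_⟩
  have hsum : ∑ i ∈ t, ((h x / max (f x) (1 / 2) : ℝ) : ℂ) *
      coef (frame K₁ K₂ i) (frame K₁ K₂ i) x = ((h x / max (f x) (1 / 2) * f x : ℝ) : ℂ) := by
    rw [← Finset.mul_sum, Complex.ofReal_mul]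
    congr 1
    rw [Complex.ofReal_sum]
    exact Finset.sum_congr rfl fun i _ => coef_self_eq_ofReal _ _
  rw [hsum]
  by_cases hx : x ∈ tsupport h
  · obtain ⟨i, hi, hxi⟩ := Set.mem_iUnion₂.1 (ht hx)
    have h1 : 1 / 2 ≤ f x := le_trans (le_of_lt hxi)
      (Finset.single_le_sum (f := fun i => (coef (frame K₁ K₂ i) (frame K₁ K₂ i) x).re)
        (fun j _ => coef_self_re_nonneg _ _) hi)
    rw [max_eq_left h1, div_mul_cancel₀ _ (by linarith)]
  · rw [image_eq_zero_of_notMem_tsupport hx, zero_div, zero_mul]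

/-- `n` is the product of the section `l` with `m`. -/
def IsTensor (l : ∀ x, LineFiber K₁ K₂ x) (m : M₁) (n : M₂) : Prop :=
  ∀ x, n - lineCoord K₁ K₂ x (l x) • frame K₁ K₂ x m ∈ K₂.Null x

lemma IsTensor.unique {l : ∀ x, LineFiber K₁ K₂ x} {m : M₁} {n n' : M₂} (h : IsTensor l m n)
    (h' : IsTensor l m n') : n = n' :=
  K₂.eq_of_null fun x => by simpa using sub_mem (h x) (h' x)

lemma IsTensor.sub {l l' : ∀ x, LineFiber K₁ K₂ x} {m : M₁} {n n' : M₂} (h : IsTensor l m n)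
    (h' : IsTensor l' m n') : IsTensor (l - l') m (n - n') := fun x => by
  have := sub_mem (h x) (h' x)
  rw [Pi.sub_apply, map_sub, sub_smul]
  rwa [sub_sub_sub_comm] at this

lemma IsTensor.rinner {l l' : ∀ x, LineFiber K₁ K₂ x} {m m' : M₁} {n n' : M₂}
    (h : IsTensor l m n) (h' : IsTensor l' m' n') (x : X) :
    K₂.rinner n n' x =
      (star (lineCoord K₁ K₂ x (l x)) * lineCoord K₁ K₂ x (l' x)) • K₁.rinner m m' x := by
  rw [K₂.rinner_congr (h x) (h' x), K₂.rinner_smul_left, K₂.rinner_smul_right, rinner_apply,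
    coef_frame, one_smul, smul_smul]

lemma IsTensor.norm_le {l : ∀ x, LineFiber K₁ K₂ x} {m : M₁} {n : M₂} (h : IsTensor l m n) {C : ℝ}
    (hC : 0 ≤ C) (hl : ∀ x, ‖l x‖ ≤ C) : ‖n‖ ≤ C * ‖m‖ := by
  refine K₂.norm_le_of_rinner (by positivity) fun x => ?_
  have h2 : ‖K₁.rinner m m x‖ ≤ ‖m‖ ^ 2 := by
    rw [← K₁.norm_rinner_self]; exact c0_norm_apply_le _ x
  rw [h.rinner h, norm_smul, norm_mul, norm_star, LinearIsometryEquiv.norm_map, mul_pow]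
  have h1 : ‖l x‖ * ‖l x‖ ≤ C ^ 2 := by
    rw [sq]; exact mul_le_mul (hl x) (hl x) (norm_nonneg _) hC
  gcongr

/-- Locally `l` is a combination of intertwiners. With `h = ∑ g ⟪Tᵢ, Tᵢ⟫`, the section `h l` equals
`∑ g ⟪Tᵢ, l⟫ Tᵢ`, and the coefficients `g ⟪Tᵢ, l⟫` lie in `C₀(X)` and may act on `Tᵢ m` from the
right. -/
lemma exists_isTensor_of_cutoff (l : C0Section ℂ (LineFiber K₁ K₂)) {h : X → ℝ} (hc : Continuous h)
    (hs : HasCompactSupport h) (m : M₁) : ∃ n, IsTensor (fun x => (h x : ℂ) • l.1 x) m n := by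
  obtain ⟨t, g, hgc, hgs, hg⟩ := exists_sum_coef K₁ K₂ hc hs
  have hp : ∀ i, Continuous fun x => pairing (frame K₁ K₂ i) ⟨x, l.1 x⟩ := fun i =>
    (continuous_pairing _).comp l.2.1
  let G : X → C₀(X, ℂ) := fun i => compactlySupported
    (fun x => (g x : ℂ) * pairing (frame K₁ K₂ i) ⟨x, l.1 x⟩)
    ((Complex.continuous_ofReal.comp hgc).mul (hp i))
    (HasCompactSupport.mul_right (hgs.comp_left (g := fun t : ℝ => (t : ℂ)) (by simp)))
  refine ⟨∑ i ∈ t, K₂.ract (scalarTriv a b (G i)) (frame K₁ K₂ i m), fun x => ?_⟩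
  have h1 : ∀ i ∈ t, K₂.ract (scalarTriv a b (G i)) (frame K₁ K₂ i m) -
      (((g x : ℂ) * coef (frame K₁ K₂ i) (frame K₁ K₂ i) x) * lineCoord K₁ K₂ x (l.1 x)) •
        frame K₁ K₂ x m ∈ K₂.Null x := by
    intro i _
    have h2 := K₂.scalar_sub_smul_mem_null x (G i) (frame K₁ K₂ i m)
    have h3 := (K₂.Null x).smul_mem (G i x) (sub_smul_frame_mem_null (frame K₁ K₂ i) x m)
    have h4 := add_mem h2 h3
    rw [smul_sub, sub_add_sub_cancel, smul_smul] at h4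
    -- Parseval over `x` moves the frame coefficients: `⟪Tᵢ, l⟫ Tᵢ = ⟪Tᵢ, Tᵢ⟫ l` in a line.
    have h5 : G i x * coef (frame K₁ K₂ x) (frame K₁ K₂ i) x =
        ((g x : ℂ) * coef (frame K₁ K₂ i) (frame K₁ K₂ i) x) * lineCoord K₁ K₂ x (l.1 x) := by
      rw [← coef_mul_coef_frame (frame K₁ K₂ i) (frame K₁ K₂ i) x]
      change (g x : ℂ) * (coef (frame K₁ K₂ i) (frame K₁ K₂ x) x * lineCoord K₁ K₂ x (l.1 x)) *
        _ = _
      ring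
    rwa [h5] at h4
  have h6 := sum_mem h1
  rw [Finset.sum_sub_distrib, ← Finset.sum_smul, ← Finset.sum_mul, hg] at h6
  rw [map_smul, smul_eq_mul]
  exact h6

/-- Cutoffs of `l` converge to `l` uniformly, and `IsTensor.norm_le` turns this into a Cauchy
sequence in `M₂`. Its limit has the right value in each fibre. -/
lemma exists_isTensor (l : C0Section ℂ (LineFiber K₁ K₂)) (m : M₁) :
    ∃ n, IsTensor l.1 m n := by
  have hcut : ∀ k : ℕ, ∃ χ : X → ℝ, Continuous χ ∧ HasCompactSupport χ ∧
      ∀ x, ‖l.1 x - (χ x : ℂ) • l.1 x‖ ≤ 1 / ((k : ℝ) + 1) := by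
    intro k
    have hev := l.2.2.eventually (gt_mem_nhds (show (0 : ℝ) < 1 / ((k : ℝ) + 1) by positivity))
    obtain ⟨C, hC, hCs⟩ := mem_cocompact.1 hev
    obtain ⟨χ, hc, hs, -, h1, h0, hle⟩ := exists_cutoff hC isOpen_univ (Set.subset_univ _)
    refine ⟨χ, hc, hs, fun x => ?_⟩
    have h2 : l.1 x - (χ x : ℂ) • l.1 x = ((1 - χ x : ℝ) : ℂ) • l.1 x := by
      push_cast; rw [sub_smul, one_smul]
    rw [h2, norm_smul, Complex.norm_real, Real.norm_eq_abs, abs_of_nonneg (by linarith [hle x])]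
    by_cases hx : x ∈ C
    · rw [h1 x hx, sub_self, zero_mul]; positivity
    · have h5 : ‖l.1 x‖ < 1 / ((k : ℝ) + 1) := hCs hx
      calc _ ≤ 1 * ‖l.1 x‖ := by gcongr; linarith [h0 x]
        _ ≤ _ := by linarith
  choose χ hc hs hχ using hcut
  choose u hu using fun k => exists_isTensor_of_cutoff l (hc k) (hs k) m
  have hdist : ∀ j k, ‖u j - u k‖ ≤ (1 / ((j : ℝ) + 1) + 1 / ((k : ℝ) + 1)) * ‖m‖ := fun j k =>
    ((hu j).sub (hu k)).norm_le (by positivity) fun x => by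
      have h1 := norm_sub_le (l.1 x - (χ k x : ℂ) • l.1 x) (l.1 x - (χ j x : ℂ) • l.1 x)
      rw [sub_sub_sub_cancel_left] at h1
      refine h1.trans ?_
      rw [add_comm]
      exact add_le_add (hχ j x) (hχ k x)
  have hlim : Tendsto (fun k : ℕ => 1 / ((k : ℝ) + 1)) atTop (𝓝 0) :=
    tendsto_one_div_add_atTop_nhds_zero_nat
  have hcau : CauchySeq u := by
    refine Metric.cauchySeq_iff'.2 fun ε hε => ?_
    have h2 : Tendsto (fun k : ℕ => (1 / ((k : ℝ) + 1) + 1 / ((k : ℝ) + 1)) * ‖m‖) atTop (𝓝 0) := by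
      simpa using (hlim.add hlim).mul_const ‖m‖
    obtain ⟨N, hN⟩ := (h2.eventually (gt_mem_nhds hε)).exists
    refine ⟨N, fun k hk => ?_⟩
    rw [dist_eq_norm]
    refine (hdist k N).trans_lt (lt_of_le_of_lt ?_ hN)
    gcongr
  obtain ⟨n, hn⟩ := cauchySeq_tendsto_of_complete hcau
  refine ⟨n, fun x => ?_⟩
  refine K₂.mem_null_of_tendsto (hn.sub_const (lineCoord K₁ K₂ x (l.1 x) • frame K₁ K₂ x m)) ?_
  have hb : Tendsto (fun k : ℕ => 1 / ((k : ℝ) + 1) * K₂.fiberNorm x (frame K₁ K₂ x m)) atTop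
      (𝓝 0) := by simpa using hlim.mul_const (K₂.fiberNorm x (frame K₁ K₂ x m))
  refine squeeze_zero (fun k => apply_nonneg _ _) (fun k => ?_) hb
  -- The first summand is null over `x` by the choice of `u k`. The second is the error of the
  -- cutoff, applied to a fixed vector.
  have h1 : u k - lineCoord K₁ K₂ x (l.1 x) • frame K₁ K₂ x m =
      (u k - lineCoord K₁ K₂ x ((χ k x : ℂ) • l.1 x) • frame K₁ K₂ x m) +
        (-lineCoord K₁ K₂ x (l.1 x - (χ k x : ℂ) • l.1 x)) • frame K₁ K₂ x m := by
    rw [map_sub]; module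
  rw [h1]
  refine (map_add_le_add _ _ _).trans ?_
  rw [K₂.fiberNorm_of_null (hu k x), zero_add, map_smul_eq_mul, norm_neg,
    LinearIsometryEquiv.norm_map]
  gcongr
  exact hχ k x

/-- The product of a section of the line bundle of intertwiners with `m`. -/
def lineMul (l : C0Section ℂ (LineFiber K₁ K₂)) (m : M₁) : M₂ := (exists_isTensor l m).choose

lemma isTensor_lineMul (l : C0Section ℂ (LineFiber K₁ K₂)) (m : M₁) :
    IsTensor l.1 m (lineMul l m) := (exists_isTensor l m).choose_spec

lemma lineMul_eq {l : C0Section ℂ (LineFiber K₁ K₂)} {m : M₁} {n : M₂} (h : IsTensor l.1 m n) :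
    lineMul l m = n := (isTensor_lineMul l m).unique h

variable (K₁ K₂) in
/-- The product of sections of the line bundle of intertwiners with elements of `M₁`. -/
def lineTensor : C0Section ℂ (LineFiber K₁ K₂) →ₗ[ℂ] M₁ →ₗ[ℂ] M₂ :=
  LinearMap.mk₂ ℂ lineMul
    (fun l l' m => lineMul_eq fun x => by
      have h := add_mem (isTensor_lineMul l m x) (isTensor_lineMul l' m x)
      change _ - lineCoord K₁ K₂ x (l.1 x + l'.1 x) • _ ∈ _
      rw [map_add, add_smul, add_sub_add_comm]
      exact h)
    (fun c l m => lineMul_eq fun x => by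
      have h := (K₂.Null x).smul_mem c (isTensor_lineMul l m x)
      change _ - lineCoord K₁ K₂ x (c • l.1 x) • _ ∈ _
      rw [map_smul, smul_eq_mul, mul_smul, ← smul_sub]
      exact h)
    (fun l m m' => lineMul_eq fun x => by
      have h := add_mem (isTensor_lineMul l m x) (isTensor_lineMul l m' x)
      rw [map_add, smul_add, add_sub_add_comm]
      exact h)
    (fun c l m => lineMul_eq fun x => by
      have h := (K₂.Null x).smul_mem c (isTensor_lineMul l m x)
      rw [map_smul, smul_comm, ← smul_sub]
      exact h)

lemma lineTensor_apply (l : C0Section ℂ (LineFiber K₁ K₂)) (m : M₁) :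
    lineTensor K₁ K₂ l m = lineMul l m := rfl

/-- An intertwiner, multiplied by a function with compact support, as a section. -/
def sectionOf (S : Intertwiner K₁ K₂) {g : X → ℝ} (hc : Continuous g) (hs : HasCompactSupport g) :
    C0Section ℂ (LineFiber K₁ K₂) :=
  ⟨fun x => (lineCoord K₁ K₂ x).symm ((g x : ℂ) * coef (frame K₁ K₂ x) S x), by
    refine (continuous_lineBundle_iff K₁ K₂).2 ⟨continuous_id, fun T => ?_⟩
    refine ((Complex.continuous_ofReal.comp hc).mul (continuous_coef T S)).congr fun x => ?_
    rw [pairing_mk, LinearIsometryEquiv.apply_symm_apply]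
    change (g x : ℂ) * coef T S x = _
    rw [← coef_mul_coef_frame T S x]
    ring, by
    refine tendsto_const_nhds.congr' ?_
    filter_upwards [hs.isCompact.compl_mem_cocompact] with x hx
    rw [LinearIsometryEquiv.norm_map, image_eq_zero_of_notMem_tsupport hx, Complex.ofReal_zero,
      zero_mul, norm_zero]⟩

lemma lineMul_sectionOf (S : Intertwiner K₁ K₂) {g : X → ℝ} (hc : Continuous g)
    (hs : HasCompactSupport g) (G : C₀(X, ℂ)) (hG : ∀ x, G x = g x) (m : M₁) :
    lineMul (sectionOf S hc hs) m = K₂.ract (scalarTriv a b G) (S m) := lineMul_eq fun x => by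
  have h2 := K₂.scalar_sub_smul_mem_null x G (S m)
  have h3 := (K₂.Null x).smul_mem (G x) (sub_smul_frame_mem_null S x m)
  have h4 := add_mem h2 h3
  rw [smul_sub, sub_add_sub_cancel, smul_smul, hG] at h4
  exact h4

-- By compatibility of the inner products, `n ⟪T m, T m'⟫` is the image under `T` of an element of
-- `M₁`. Summing over intertwiners whose squared norms add up to a cutoff puts `n ⟪m, m'⟫`, cut off,
-- into the span, and fullness of `M₁` allows `⟪m, m'⟫` to be replaced by any element of `C₀(X,
-- Cl_{a,b})`.
variable (K₁ K₂) in
lemma dense_lineTensor : Dense (Submodule.span ℂ (Set.range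
    fun p : C0Section ℂ (LineFiber K₁ K₂) × M₁ => lineTensor K₁ K₂ p.1 p.2) : Set M₂) := by
  set D := Submodule.span ℂ (Set.range
    fun p : C0Section ℂ (LineFiber K₁ K₂) × M₁ => lineTensor K₁ K₂ p.1 p.2) with hD
  have hA : ∀ (h : X → ℝ) (_ : Continuous h) (_ : HasCompactSupport h) (H : C₀(X, ℂ))
      (_ : ∀ x, H x = h x) (n : M₂) (m m' : M₁),
      K₂.ract (scalarTriv a b H) (K₂.ract (K₁.rinner m m') n) ∈ D := by
    intro h hc hs H hH n m m'
    obtain ⟨t, g, hgc, hgs, hg⟩ := exists_sum_coef K₁ K₂ hc hs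
    let G : C₀(X, ℂ) := compactlySupported (fun x => (g x : ℂ)) (Complex.continuous_ofReal.comp hgc)
      (hgs.comp_left (g := fun t : ℝ => (t : ℂ)) (by simp))
    -- The twist compensates the sign rule: applying `frame K₁ K₂ i` to `y i` gives the left inner
    -- product of `n` and `frame K₁ K₂ i m`, applied to `frame K₁ K₂ i m'`.
    let y : X → M₁ := fun i =>
      K₁.lact (twist (frame K₁ K₂ i).sign (K₂.linner n (frame K₁ K₂ i m))) m'
    have hsum : K₂.ract (scalarTriv a b H) (K₂.ract (K₁.rinner m m') n) =
        ∑ i ∈ t, lineTensor K₁ K₂ (sectionOf (frame K₁ K₂ i) hgc hgs) (y i) := by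
      have hterm : ∀ i ∈ t, lineTensor K₁ K₂ (sectionOf (frame K₁ K₂ i) hgc hgs) (y i) =
          K₂.ract (K₂.rinner (frame K₁ K₂ i m) (frame K₁ K₂ i m') * scalarTriv a b G) n := by
        intro i _
        rw [lineTensor_apply, lineMul_sectionOf _ hgc hgs G (fun _ => rfl), K₂.ract_mul,
          ← K₂.linner_rinner, ← lact_apply]
      rw [Finset.sum_congr rfl hterm, ← LinearMap.sum_apply, ← map_sum, ← K₂.ract_mul]
      congr 2
      ext x
      have hs : (∑ i ∈ t, K₂.rinner (frame K₁ K₂ i m) (frame K₁ K₂ i m') * scalarTriv a b G :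
          TrivCl X a b) x = ∑ i ∈ t, (K₂.rinner (frame K₁ K₂ i m) (frame K₁ K₂ i m') *
            scalarTriv a b G) x :=
        map_sum (⟨⟨fun g : TrivCl X a b => g x, rfl⟩, fun _ _ => rfl⟩ :
          TrivCl X a b →+ ClAB a b) _ _
      rw [hs]
      have hs2 : ∀ i ∈ t, (K₂.rinner (frame K₁ K₂ i m) (frame K₁ K₂ i m') *
          scalarTriv a b G) x =
          ((g x : ℂ) * coef (frame K₁ K₂ i) (frame K₁ K₂ i) x) • K₁.rinner m m' x := by
        intro i _
        rw [ZeroAtInftyContinuousMap.mul_apply, rinner_apply]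
        change _ * algebraMap ℂ (ClAB a b) (g x : ℂ) = _
        rw [← Algebra.commutes, ← Algebra.smul_def, smul_smul]
      rw [Finset.sum_congr rfl hs2, ← Finset.sum_smul, hg, ZeroAtInftyContinuousMap.mul_apply]
      change _ * algebraMap ℂ (ClAB a b) (H x) = _
      rw [hH, ← Algebra.commutes, ← Algebra.smul_def]
    rw [hsum]
    exact sum_mem fun i _ => Submodule.subset_span ⟨(_, _), rfl⟩
  have hB : ∀ (h : X → ℝ) (_ : Continuous h) (_ : HasCompactSupport h) (H : C₀(X, ℂ))
      (_ : ∀ x, H x = h x) (n : M₂) (c : TrivCl X a b),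
      K₂.ract (scalarTriv a b H) (K₂.ract c n) ∈ D.topologicalClosure := by
    intro h hc hs H hH n c
    -- For fixed `n`, the expression is continuous and linear in `c`, so it is enough to treat the
    -- dense span of inner products.
    let φ : TrivCl X a b →ₗ[ℂ] M₂ := K₂.ract (scalarTriv a b H) ∘ₗ K₂.ract.flip n
    have hφ : Continuous φ := AddMonoidHomClass.continuous_of_bound φ
      (‖scalarTriv a b H‖ * ‖n‖) fun c => by
        change ‖K₂.ract (scalarTriv a b H) (K₂.ract c n)‖ ≤ _
        refine (K₂.norm_ract_le _ _).trans ?_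
        rw [mul_assoc, mul_comm ‖n‖]
        gcongr
        exact K₂.norm_ract_le _ _
    have hsub : Submodule.span ℂ (Set.range fun p : M₁ × M₁ => K₁.rinner p.1 p.2) ≤
        D.topologicalClosure.comap φ := by
      rw [Submodule.span_le]
      rintro _ ⟨p, rfl⟩
      exact D.le_topologicalClosure (hA h hc hs H hH n p.1 p.2)
    have hcl : IsClosed ((D.topologicalClosure.comap φ : Submodule ℂ (TrivCl X a b)) :
        Set (TrivCl X a b)) := D.isClosed_topologicalClosure.preimage hφ
    exact hcl.closure_subset_iff.2 hsub (K₁.rinner_full c)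
  intro n
  rw [← Submodule.topologicalClosure_coe]
  refine D.isClosed_topologicalClosure.closure_subset (Metric.mem_closure_iff.2 fun ε hε => ?_)
  -- The cutoff is applied twice: one copy is the compactly supported factor in `hB`, the other is
  -- the element `c`.
  obtain ⟨H, χ, hc, hs, hH, hle⟩ := K₂.exists_cutoff_norm_sub_le n (half_pos hε)
  refine ⟨_, hB χ hc hs H hH n (scalarTriv a b H), ?_⟩
  rw [dist_eq_norm]
  linarith

end Tensor

end

/-! ### The isomorphism for the line bundle of intertwiners. -/

section

section Existence

variable {X : Type*} [TopologicalSpace X] {r : RealStructure X} {E : EquivariantBundle r} {a b : ℕ}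
  {M₁ : Type*} [NormedAddCommGroup M₁] [NormedSpace ℂ M₁] [CompleteSpace M₁]
  {M₂ : Type*} [NormedAddCommGroup M₂] [NormedSpace ℂ M₂] [CompleteSpace M₂]
  [T2Space X] [LocallyCompactSpace X]
  (K₁ : KROrientation E a b M₁) (K₂ : KROrientation E a b M₂)

open Intertwiner

lemma inner_lineFiber (x : X) (v w : LineFiber K₁ K₂ x) :
    inner ℂ v w = star (lineCoord K₁ K₂ x v) * lineCoord K₁ K₂ x w := by
  rw [← (lineCoord K₁ K₂ x).inner_map_map, RCLike.inner_apply, mul_comm]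
  rfl

/-- The line bundle of intertwiners transforms `K₁` into `K₂`. -/
def lineBundleTensorIso : TensorIso (lineBundle K₁ K₂) K₁ K₂ where
  tmul := lineTensor K₁ K₂
  rinner_tmul l l' m m' x := by
    refine ((isTensor_lineMul l m).rinner (isTensor_lineMul l' m') x).trans ?_
    exact congrArg (· • K₁.rinner m m' x) (inner_lineFiber K₁ K₂ x (l.1 x) (l'.1 x)).symm
  dense := dense_lineTensor K₁ K₂
  ract_tmul g l m := (lineMul_eq fun x => by
    have h := K₂.ract_mem_null (isTensor_lineMul l m x) g
    rwa [map_sub, map_smul, ← (frame K₁ K₂ x).map_ract] at h).symm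
  lact_tmul_of_even f hf l m := (lineMul_eq fun x => by
    have h := K₂.lact_mem_null (isTensor_lineMul l m x) f
    have ht : twist (frame K₁ K₂ x).sign f = f := by
      rcases Int.units_eq_one_or (frame K₁ K₂ x).sign with h | h <;> simp [h, hf]
    rwa [map_sub, map_smul, lact_apply, ht] at h).symm
  lact_tmul_of_odd f hf l m := (lineMul_eq fun x => by
    have h := K₂.lact_mem_null (isTensor_lineMul l m x) f
    have ht : K₂.lact f (frame K₁ K₂ x m) =
        (((frame K₁ K₂ x).sign : ℤ) : ℂ) • frame K₁ K₂ x (K₁.lact f m) := by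
      rw [lact_apply]
      rcases Int.units_eq_one_or (frame K₁ K₂ x).sign with h | h <;> simp [h, hf]
    rw [map_sub, map_smul, ht, smul_smul, mul_comm] at h
    exact h).symm
  grade_tmul l m := (lineMul_eq fun x => by
    have h := K₂.grade_mem_null (isTensor_lineMul l m x)
    rw [map_sub, map_smul, grade_apply, smul_smul, mul_comm] at h
    exact h).symm
  conj_tmul l m := (lineMul_eq fun x => by
    have h := K₂.conj_mem_null (isTensor_lineMul l m (r x))
    rw [map_sub, LinearMap.map_smulₛₗ, starRingEnd_apply] at h
    have h1 : K₂.conj (frame K₁ K₂ (r x) m) = (frame K₁ K₂ (r x)).conj (K₁.conj m) := by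
      rw [conj_apply, K₁.conj_conj]
    rw [h1] at h
    have h2 := (K₂.Null x).smul_mem (star (lineCoord K₁ K₂ (r x) (l.1 (r x))))
      (sub_smul_frame_mem_null (frame K₁ K₂ (r x)).conj x (K₁.conj m))
    rw [smul_sub] at h2
    have h3 := add_mem h h2
    rw [sub_add_sub_cancel, smul_smul] at h3
    -- The conjugate section at `x` uses the inverse of the conjugation at `x`. Symmetry of
    -- `conjCoef` under `r` expresses it by the conjugate of the frame over `r x`.
    have h4 : lineCoord K₁ K₂ x (((lineBundle K₁ K₂).conjSection l).1 x) =
        star (lineCoord K₁ K₂ (r x) (l.1 (r x))) *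
          coef (frame K₁ K₂ x) (frame K₁ K₂ (r x)).conj x := by
      change star (star (conjCoef K₁ K₂ x) * lineCoord K₁ K₂ (r x) (l.1 (r x))) = _
      rw [star_mul', star_star, ← conjCoef_apply_apply, conjCoef, r.involutive, mul_comm]
    rw [h4]
    exact h3).symm

end Existence

/-! ### Continuity and coordinates in Hermitian line bundles. -/

section MetricBundle

variable {X : Type*} [TopologicalSpace X]
  {V : X → Type*} [∀ x, NormedAddCommGroup (V x)] [∀ x, InnerProductSpace ℂ (V x)]
  [TopologicalSpace (TotalSpace Unit V)] [IsMetricBundle ℂ V]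

lemma ContinuousSection.inner_snd {s : ∀ x, V x} (hs : ContinuousSection s) :
    Continuous fun p : TotalSpace Unit V => inner ℂ (s p.proj) p.snd := by
  rw [continuous_iff_continuousAt]
  intro p
  obtain ⟨n, e, hx⟩ := IsMetricBundle.exists_triv (𝕜 := ℂ) (V := V) p.proj
  have hproj : Continuous (TotalSpace.proj : TotalSpace Unit V → X) :=
    IsMetricBundle.continuous_proj (𝕜 := ℂ)
  have hopen : IsOpen {p : TotalSpace Unit V | p.proj ∈ e.baseSet} :=
    e.isOpen_baseSet.preimage hproj
  have h1 : Continuous fun p : {p : TotalSpace Unit V // p.proj ∈ e.baseSet} =>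
      e.coord ⟨p.1.proj, p.2⟩ (s p.1.proj) :=
    ((continuousSection_iff ℂ).1 hs n e).comp
      ((hproj.comp continuous_subtype_val).subtype_mk fun p => p.2)
  have h2 : Continuous fun p : {p : TotalSpace Unit V // p.proj ∈ e.baseSet} =>
      inner ℂ (s p.1.proj) p.1.snd := by
    refine (h1.inner (𝕜 := ℂ) e.continuous_coord).congr fun p => ?_
    rw [LinearIsometryEquiv.inner_map_map]
  exact (hopen.isOpenEmbedding_subtypeVal.continuousAt_iff (x := ⟨p, hx⟩)).1 h2.continuousAt

/-- Continuity of `c` is asked at one point only, because `c` will be a quotient whose denominator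
may vanish elsewhere. -/
lemma ContinuousSection.continuousAt_smul {s : ∀ x, V x} (hs : ContinuousSection s)
    {Y : Type*} [TopologicalSpace Y] {f : Y → X} {c : Y → ℂ} {y : Y} (hf : Continuous f)
    (hc : ContinuousAt c y) :
    ContinuousAt (fun y => (⟨f y, c y • s (f y)⟩ : TotalSpace Unit V)) y := by
  obtain ⟨n, e, hx⟩ := IsMetricBundle.exists_triv (𝕜 := ℂ) (V := V) (f y)
  have hopen : IsOpen (f ⁻¹' e.baseSet) := e.isOpen_baseSet.preimage hf
  have hf' : Continuous fun y : f ⁻¹' e.baseSet => (⟨f y, y.2⟩ : e.baseSet) :=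
    (hf.comp continuous_subtype_val).subtype_mk fun y => y.2
  have h1 : Continuous fun y : f ⁻¹' e.baseSet => e.coord ⟨f y, y.2⟩ (s (f y)) :=
    ((continuousSection_iff ℂ).1 hs n e).comp hf'
  have hc' : ContinuousAt (fun y : f ⁻¹' e.baseSet => c y) ⟨y, hx⟩ :=
    ContinuousAt.comp (f := Subtype.val) (g := c) hc continuous_subtype_val.continuousAt
  have h2 := e.continuous_coord_symm.continuousAt.comp
    (hf'.continuousAt.prodMk (hc'.smul h1.continuousAt))
  refine (hopen.isOpenEmbedding_subtypeVal.continuousAt_iff (x := ⟨y, hx⟩)).1 (h2.congr ?_)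
  refine Eventually.of_forall fun y => ?_
  change (⟨f y, (e.coord ⟨f y, y.2⟩).symm (c y • e.coord ⟨f y, y.2⟩ (s (f y)))⟩ :
    TotalSpace Unit V) = ⟨f y, c y • s (f y)⟩
  rw [map_smul, LinearIsometryEquiv.symm_apply_apply]

end MetricBundle

/-- A unit vector in a complex line as an isometry. -/
def unitEquiv {F : Type*} [NormedAddCommGroup F] [InnerProductSpace ℂ F]
    (hF : Module.finrank ℂ F = 1) (v : F) (hv : ‖v‖ = 1) : ℂ ≃ₗᵢ[ℂ] F :=
  haveI : FiniteDimensional ℂ F := Module.finite_of_finrank_eq_succ hF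
  (LinearIsometry.toSpanSingleton ℂ F hv).toLinearIsometryEquiv
    (by rw [hF, Module.finrank_self])

lemma unitEquiv_apply {F : Type*} [NormedAddCommGroup F] [InnerProductSpace ℂ F]
    (hF : Module.finrank ℂ F = 1) (v : F) (hv : ‖v‖ = 1) (z : ℂ) :
    unitEquiv hF v hv z = z • v := rfl

lemma eq_inner_smul_of_finrank_eq_one {F : Type*} [NormedAddCommGroup F] [InnerProductSpace ℂ F]
    (hF : Module.finrank ℂ F = 1) {v : F} (hv : ‖v‖ = 1) (w : F) : w = inner ℂ v w • v := by
  obtain ⟨z, rfl⟩ := (unitEquiv hF v hv).surjective w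
  rw [unitEquiv_apply, inner_smul_right, inner_self_eq_norm_sq_to_K, hv]
  simp

end

/-! ### Uniqueness of the line bundle. -/

section

section Uniqueness

variable {X : Type*} [TopologicalSpace X] {r : RealStructure X} {E : EquivariantBundle r} {a b : ℕ}
  {M₁ : Type*} [NormedAddCommGroup M₁] [NormedSpace ℂ M₁] [CompleteSpace M₁]
  {M₂ : Type*} [NormedAddCommGroup M₂] [NormedSpace ℂ M₂] [CompleteSpace M₂]
  {K₁ : KROrientation E a b M₁} {K₂ : KROrientation E a b M₂}
  {L : RealLineBundle r}

lemma RealLineBundle.gradeSection_gradeSection (l : L.Sections) :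
    L.gradeSection (L.gradeSection l) = l :=
  Subtype.ext (funext fun x => L.grade_grade x (l.1 x))

lemma RealLineBundle.gradeSection_add (l l' : L.Sections) :
    L.gradeSection (l + l') = L.gradeSection l + L.gradeSection l' :=
  Subtype.ext (funext fun x => map_add (L.grade x) (l.1 x) (l'.1 x))

lemma RealLineBundle.gradeSection_smul (z : ℂ) (l : L.Sections) :
    L.gradeSection (z • l) = z • L.gradeSection l :=
  Subtype.ext (funext fun x => map_smul (L.grade x) z (l.1 x))

/-- Split `f` into `(f + grade f) / 2` and `(f - grade f) / 2` and apply the sign rule to each part.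
For a homogeneous section the two cases combine into one twist. -/
lemma TensorIso.lact_tmul (I : TensorIso L K₁ K₂) {l : L.Sections} {ε : ℤˣ}
    (hl : L.gradeSection l = ((ε : ℤ) : ℂ) • l) (f : E.ClSection) (m : M₁) :
    K₂.lact f (I.tmul l m) = I.tmul l (K₁.lact (twist ε f) m) := by
  have h1 := I.lact_tmul_of_even (f + E.gradeCl f)
    (by rw [gradeCl_add, gradeCl_gradeCl, add_comm]) l m
  have h2 := I.lact_tmul_of_odd (f - E.gradeCl f)
    (Subtype.ext (funext fun x => by
      change Cl.grade (f.1 x - Cl.grade (f.1 x)) = -(f.1 x - Cl.grade (f.1 x))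
      rw [map_sub, Cl.grade_grade, neg_sub])) l m
  rw [hl] at h2
  simp only [map_add, map_sub, LinearMap.add_apply, LinearMap.sub_apply, map_smul,
    LinearMap.smul_apply] at h1 h2
  rcases Int.units_eq_one_or ε with rfl | rfl
  · rw [twist_one]
    simp only [Units.val_one, Int.cast_one] at h2
    linear_combination (norm := module) (1 / 2 : ℂ) • h1 + (1 / 2 : ℂ) • h2
  · rw [twist_neg_one]
    simp only [Units.val_neg, Units.val_one, Int.cast_neg, Int.cast_one] at h2
    linear_combination (norm := module) (1 / 2 : ℂ) • h1 + (1 / 2 : ℂ) • h2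

/-- The intertwiner `m ↦ l ⊗ m` for a homogeneous section `l`. -/
def TensorIso.intertwiner (I : TensorIso L K₁ K₂) (l : L.Sections) (ε : ℤˣ)
    (hl : L.gradeSection l = ((ε : ℤ) : ℂ) • l) : Intertwiner K₁ K₂ where
  toFun := I.tmul l
  sign := ε
  map_ract g m := (I.ract_tmul g l m).symm
  map_lact f m := by rw [I.lact_tmul hl, twist_twist]
  map_grade m := by
    rw [I.grade_tmul, hl, map_smul, LinearMap.smul_apply, smul_smul, unit_mul_self_complex,
      one_smul]

variable [T2Space X] [LocallyCompactSpace X]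

open Intertwiner

lemma TensorIso.coef_intertwiner (I : TensorIso L K₁ K₂) {l : L.Sections} {ε : ℤˣ}
    (hl : L.gradeSection l = ((ε : ℤ) : ℂ) • l) (x : X) :
    coef (I.intertwiner l ε hl) (I.intertwiner l ε hl) x = inner ℂ (l.1 x) (l.1 x) :=
  coef_eq fun m n => I.rinner_tmul l l m n x

variable (L) in
/-- There is a homogeneous section that is a unit vector at a given point. -/
lemma RealLineBundle.exists_homogeneous (x : X) : ∃ (l : L.Sections) (ε : ℤˣ),
    L.gradeSection l = ((ε : ℤ) : ℂ) • l ∧ ‖l.1 x‖ = 1 := by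
  have key : ∀ (s : L.Sections) (ε : ℤˣ), L.gradeSection
      (s + ((ε : ℤ) : ℂ) • L.gradeSection s) =
        ((ε : ℤ) : ℂ) • (s + ((ε : ℤ) : ℂ) • L.gradeSection s) := fun s ε => by
    rw [gradeSection_add, gradeSection_smul, gradeSection_gradeSection, smul_add, smul_smul,
      unit_mul_self_complex, one_smul, add_comm]
  have : Nontrivial (L.fiber x) := Module.nontrivial_of_finrank_pos (R := ℂ)
    (by rw [L.finrank_fiber]; exact one_pos)
  obtain ⟨v, hv⟩ := exists_ne (0 : L.fiber x)
  obtain ⟨s, rfl⟩ := exists_section_apply_eq (𝕜 := ℂ) x v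
  -- The even and odd parts of `s`, without the factor `1 / 2`. They add up to `2 s`, so they cannot
  -- both vanish at `x`.
  obtain ⟨ε, hε⟩ : ∃ ε : ℤˣ, (s + ((ε : ℤ) : ℂ) • L.gradeSection s).1 x ≠ 0 := by
    by_contra! h
    have h1 := h 1
    have h2 := h (-1)
    change s.1 x + (((1 : ℤˣ) : ℤ) : ℂ) • L.grade x (s.1 x) = 0 at h1
    change s.1 x + (((-1 : ℤˣ) : ℤ) : ℂ) • L.grade x (s.1 x) = 0 at h2
    simp only [Units.val_neg, Units.val_one, Int.cast_neg, Int.cast_one] at h1 h2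
    apply hv
    linear_combination (norm := module) (1 / 2 : ℂ) • h1 + (1 / 2 : ℂ) • h2
  set t := s + ((ε : ℤ) : ℂ) • L.gradeSection s
  refine ⟨((‖t.1 x‖⁻¹ : ℝ) : ℂ) • t, ε, ?_, ?_⟩
  · rw [gradeSection_smul, key, smul_comm]
  · change ‖((‖t.1 x‖⁻¹ : ℝ) : ℂ) • t.1 x‖ = 1
    rw [norm_smul, Complex.norm_real, norm_inv, norm_norm, inv_mul_cancel₀ (norm_ne_zero_iff.2 hε)]

lemma TensorIso.tmul_mem_null (I : TensorIso L K₁ K₂) {l : L.Sections} {x : X} (hl : l.1 x = 0)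
    (m : M₁) : I.tmul l m ∈ K₂.Null x :=
  K₂.mem_null_of_self (by rw [I.rinner_tmul, hl, inner_zero_left, zero_smul])

/-- Let `S = l ⊗ -` for a homogeneous section `l` with unit vector at `x`. Over `x`, `S` is a
unimodular multiple of the frame, and `w` is `l x` multiplied by the conjugate of this number.
Another section `l'` agrees at `x` with a multiple of `l`, and `l' ⊗ -` is then the same multiple of
`S`. -/
lemma TensorIso.exists_unit (I : TensorIso L K₁ K₂) (x : X) : ∃ w : L.fiber x, ‖w‖ = 1 ∧
    ∀ (l : L.Sections) m,
      I.tmul l m - inner ℂ w (l.1 x) • frame K₁ K₂ x m ∈ K₂.Null x := by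
  obtain ⟨l, ε, hl, hlx⟩ := L.exists_homogeneous x
  set S := I.intertwiner l ε hl with hS
  have hSS : coef S S x = 1 := by
    rw [I.coef_intertwiner, inner_self_eq_norm_sq_to_K, hlx]
    simp
  refine ⟨star (coef (frame K₁ K₂ x) S x) • l.1 x, ?_, fun l' m => ?_⟩
  · rw [norm_smul, hlx, mul_one, norm_star]
    apply norm_eq_one_of_star_mul_self
    rw [← coef_symm, coef_mul_coef_frame, hSS]
  · have h1 : I.tmul l' m - inner ℂ (l.1 x) (l'.1 x) • S m ∈ K₂.Null x := by
      have h2 : (l' - inner ℂ (l.1 x) (l'.1 x) • l).1 x = 0 :=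
        sub_eq_zero.2 (eq_inner_smul_of_finrank_eq_one (L.finrank_fiber x) hlx (l'.1 x))
      have h3 := I.tmul_mem_null h2 m
      rwa [map_sub, map_smul, LinearMap.sub_apply, LinearMap.smul_apply] at h3
    have h2 := (K₂.Null x).smul_mem (inner ℂ (l.1 x) (l'.1 x)) (sub_smul_frame_mem_null S x m)
    rw [smul_sub, smul_smul] at h2
    have h3 := add_mem h1 h2
    rw [sub_add_sub_cancel] at h3
    rw [inner_smul_left, starRingEnd_apply, star_star, mul_comm]
    exact h3

/-- The unit vector that corresponds to `frame K₁ K₂ x`. -/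
def TensorIso.unit (I : TensorIso L K₁ K₂) (x : X) : L.fiber x := (I.exists_unit x).choose

lemma TensorIso.norm_unit (I : TensorIso L K₁ K₂) (x : X) : ‖I.unit x‖ = 1 :=
  (I.exists_unit x).choose_spec.1

lemma TensorIso.tmul_sub_mem_null (I : TensorIso L K₁ K₂) (x : X) (l : L.Sections) (m : M₁) :
    I.tmul l m - inner ℂ (I.unit x) (l.1 x) • frame K₁ K₂ x m ∈ K₂.Null x :=
  (I.exists_unit x).choose_spec.2 l m

lemma TensorIso.eq_inner_smul_unit (I : TensorIso L K₁ K₂) (x : X) (v : L.fiber x) :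
    v = inner ℂ (I.unit x) v • I.unit x :=
  eq_inner_smul_of_finrank_eq_one (L.finrank_fiber x) (I.norm_unit x) v

lemma TensorIso.inner_smul_unit (I : TensorIso L K₁ K₂) (x : X) (z : ℂ) :
    inner ℂ (I.unit x) (z • I.unit x) = z := by
  rw [inner_smul_right, inner_self_eq_norm_sq_to_K, I.norm_unit]
  simp

/-- The coordinate of a vector in the line over `x` is determined by the intertwiner that it
represents. -/
lemma eq_of_sub_smul_frame_mem_null {x : X} {n : M₁ → M₂} {z w : ℂ}
    (hz : ∀ m, n m - z • frame K₁ K₂ x m ∈ K₂.Null x)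
    (hw : ∀ m, n m - w • frame K₁ K₂ x m ∈ K₂.Null x) : z = w := by
  obtain ⟨m, m', hm⟩ := K₁.exists_tr_rinner_ne_zero x
  have h := sub_mem (hw m') (hz m') (frame K₁ K₂ x m)
  rw [sub_sub_sub_cancel_left, ← sub_smul, K₂.rinner_smul_right, rinner_apply, coef_frame,
    one_smul] at h
  have h1 := congrArg Cl.tr h
  rw [map_smul, map_zero, smul_eq_mul] at h1
  exact sub_eq_zero.1 ((mul_eq_zero.1 h1).resolve_right hm)

/-- Apply the grading of `M₂` to `l ⊗ grade m` and compare the coefficients of the frame. -/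
lemma TensorIso.inner_unit_grade (I : TensorIso L K₁ K₂) (x : X) (v : L.fiber x) :
    inner ℂ (I.unit x) (L.grade x v) =
      (((frame K₁ K₂ x).sign : ℤ) : ℂ) * inner ℂ (I.unit x) v := by
  obtain ⟨l, rfl⟩ := exists_section_apply_eq (𝕜 := ℂ) x v
  refine eq_of_sub_smul_frame_mem_null (I.tmul_sub_mem_null x (L.gradeSection l)) fun m => ?_
  have h := K₂.grade_mem_null (I.tmul_sub_mem_null x l (K₁.grade m))
  rwa [map_sub, map_smul, I.grade_tmul, grade_apply, K₁.grade_grade, smul_smul, mul_comm] at h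

/-- Conjugate `l ⊗ conj m` in the fibre over `r x` and expand the conjugate frame over `x`. This
gives the inverse of the asserted relation, and `conjCoef` has modulus one. -/
lemma TensorIso.inner_unit_conj (I : TensorIso L K₁ K₂) (x : X) (v : L.fiber x) :
    inner ℂ (I.unit (r x)) (L.conj x v) = conjCoef K₁ K₂ x * star (inner ℂ (I.unit x) v) := by
  obtain ⟨l, hl⟩ := exists_section_apply_eq (𝕜 := ℂ) (r x) (L.conj x v)
  have h0 : (L.conjSection l).1 x = v := by
    change (L.conj x).symm (l.1 (r x)) = v
    rw [hl, LinearIsometryEquiv.symm_apply_apply]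
  have h1 : inner ℂ (I.unit x) v =
      star (inner ℂ (I.unit (r x)) (L.conj x v)) * conjCoef K₁ K₂ x := by
    rw [← hl]
    conv_lhs => rw [← h0]
    refine eq_of_sub_smul_frame_mem_null (I.tmul_sub_mem_null x (L.conjSection l)) fun m => ?_
    have h := K₂.conj_mem_null (I.tmul_sub_mem_null (r x) l (K₁.conj m))
    rw [map_sub, LinearMap.map_smulₛₗ, starRingEnd_apply, I.conj_tmul, K₁.conj_conj,
      ← conj_apply] at h
    have h2 := (K₂.Null x).smul_mem (star (inner ℂ (I.unit (r x)) (l.1 (r x))))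
      (sub_smul_frame_mem_null (frame K₁ K₂ (r x)).conj x m)
    rw [smul_sub, smul_smul] at h2
    have h3 := add_mem h h2
    rw [sub_add_sub_cancel] at h3
    rw [← conjCoef_apply_apply, conjCoef, r.involutive]
    exact h3
  rw [h1, star_mul', star_star, mul_left_comm, ← starRingEnd_apply, Complex.mul_conj,
    Complex.normSq_eq_norm_sq, norm_conjCoef]
  simp

lemma TensorIso.coef_intertwiner_frame (I : TensorIso L K₁ K₂) {l : L.Sections} {ε : ℤˣ}
    (hl : L.gradeSection l = ((ε : ℤ) : ℂ) • l) (x : X) :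
    coef (frame K₁ K₂ x) (I.intertwiner l ε hl) x = inner ℂ (I.unit x) (l.1 x) :=
  eq_of_sub_smul_frame_mem_null (sub_smul_frame_mem_null (I.intertwiner l ε hl) x)
    (I.tmul_sub_mem_null x l)

lemma TensorIso.inner_eq (I : TensorIso L K₁ K₂) (x : X) (v w : L.fiber x) :
    inner ℂ v w = star (inner ℂ (I.unit x) v) * inner ℂ (I.unit x) w := by
  conv_lhs => rw [I.eq_inner_smul_unit x v, inner_smul_left]
  rfl

/-- The unit vectors are chosen pointwise. Near a given point, the map is nevertheless `p ↦ (⟪S, p⟫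
/ ⟪S, S⟫) l` for a homogeneous section `l` with intertwiner `S`, because `l` and `S` have the same
coordinate with respect to the unit vector and the frame. -/
lemma TensorIso.continuous_smul_unit (I : TensorIso L K₁ K₂) :
    Continuous fun p : TotalSpace Unit (LineFiber K₁ K₂) =>
      (⟨p.proj, lineCoord K₁ K₂ p.proj p.snd • I.unit p.proj⟩ : TotalSpace Unit L.fiber) := by
  have hproj := continuous_lineBundle_proj K₁ K₂
  rw [continuous_iff_continuousAt]
  intro p₀
  obtain ⟨l, ε, hl, hlx⟩ := L.exists_homogeneous p₀.proj
  set S := I.intertwiner l ε hl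
  have hne : coef S S p₀.proj ≠ 0 := by
    rw [I.coef_intertwiner, inner_self_eq_norm_sq_to_K, hlx]
    simp
  have hS : Continuous fun p : TotalSpace Unit (LineFiber K₁ K₂) => coef S S p.proj :=
    (continuous_coef S S).comp hproj
  have h1 := l.2.1.continuousAt_smul hproj
    ((continuous_pairing S).continuousAt.div hS.continuousAt hne)
  refine h1.congr ?_
  filter_upwards [hS.continuousAt.eventually_ne hne] with p hp
  refine congrArg (TotalSpace.mk p.proj) ?_
  change (coef S (frame K₁ K₂ p.proj) p.proj * lineCoord K₁ K₂ p.proj p.snd / coef S S p.proj) •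
    l.1 p.proj = _
  rw [I.coef_intertwiner, I.inner_eq] at hp
  rw [coef_symm, I.coef_intertwiner_frame, I.coef_intertwiner,
    I.inner_eq p.proj (l.1 p.proj) (l.1 p.proj)]
  refine (congrArg (_ • ·) (I.eq_inner_smul_unit p.proj (l.1 p.proj))).trans ?_
  rw [smul_smul]
  refine congrArg (· • I.unit p.proj) ?_
  have h2 := left_ne_zero_of_mul hp
  have h3 := right_ne_zero_of_mul hp
  field_simp

/-- Pairing the image of `v` with an intertwiner `T` gives `⟪T, S⟫ ⟪l, v⟫ / ⟪S, S⟫` near the point,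
with `l` and `S = l ⊗ -` homogeneous. The frame and the chosen unit vectors have disappeared from
this formula. -/
lemma TensorIso.continuous_inner_unit (I : TensorIso L K₁ K₂) :
    Continuous fun p : TotalSpace Unit L.fiber =>
      (⟨p.proj, (lineCoord K₁ K₂ p.proj).symm (inner ℂ (I.unit p.proj) p.snd)⟩ :
        TotalSpace Unit (LineFiber K₁ K₂)) := by
  have hproj : Continuous (TotalSpace.proj : TotalSpace Unit L.fiber → X) :=
    IsMetricBundle.continuous_proj (𝕜 := ℂ)
  rw [continuous_lineBundle_iff]
  refine ⟨hproj, fun T => continuous_iff_continuousAt.2 fun p₀ => ?_⟩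
  obtain ⟨l, ε, hl, hlx⟩ := L.exists_homogeneous p₀.proj
  set S := I.intertwiner l ε hl
  have hne : coef S S p₀.proj ≠ 0 := by
    rw [I.coef_intertwiner, inner_self_eq_norm_sq_to_K, hlx]
    simp
  have hS : Continuous fun p : TotalSpace Unit L.fiber => coef S S p.proj :=
    (continuous_coef S S).comp hproj
  have hT : Continuous fun p : TotalSpace Unit L.fiber => coef T S p.proj :=
    (continuous_coef T S).comp hproj
  have h1 := (hT.mul l.2.1.inner_snd).continuousAt.div hS.continuousAt hne
  refine h1.congr ?_
  filter_upwards [hS.continuousAt.eventually_ne hne] with p hp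
  change coef T S p.proj * inner ℂ (l.1 p.proj) p.snd / coef S S p.proj =
    coef T (frame K₁ K₂ p.proj) p.proj * inner ℂ (I.unit p.proj) p.snd
  rw [I.coef_intertwiner, I.inner_eq] at hp
  rw [← coef_mul_coef_frame, I.coef_intertwiner_frame, I.coef_intertwiner,
    I.inner_eq p.proj (l.1 p.proj) p.snd, I.inner_eq p.proj (l.1 p.proj) (l.1 p.proj)]
  have h2 := left_ne_zero_of_mul hp
  have h3 := right_ne_zero_of_mul hp
  field_simp

/-- A line bundle that transforms `K₁` into `K₂` is isomorphic to the line bundle of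
intertwiners. -/
def TensorIso.lineBundleIso (I : TensorIso L K₁ K₂) :
    RealLineBundle.Iso (lineBundle K₁ K₂) L where
  toFun x := (lineCoord K₁ K₂ x).trans (unitEquiv (L.finrank_fiber x) (I.unit x) (I.norm_unit x))
  continuous_toFun := I.continuous_smul_unit
  continuous_symm := by
    refine I.continuous_inner_unit.congr fun p => congrArg (TotalSpace.mk p.proj) ?_
    exact ((lineCoord K₁ K₂ p.proj).trans (unitEquiv (L.finrank_fiber p.proj) (I.unit p.proj)
      (I.norm_unit p.proj))).eq_symm_apply.2 (I.eq_inner_smul_unit p.proj p.snd).symm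
  map_grade x v := by
    change ((((frame K₁ K₂ x).sign : ℤ) : ℂ) * lineCoord K₁ K₂ x v) • I.unit x =
      L.grade x (lineCoord K₁ K₂ x v • I.unit x)
    conv_rhs => rw [I.eq_inner_smul_unit x (L.grade x _), I.inner_unit_grade, I.inner_smul_unit]
  map_conj x v := by
    change (conjCoef K₁ K₂ x * star (lineCoord K₁ K₂ x v)) • I.unit (r x) =
      L.conj x (lineCoord K₁ K₂ x v • I.unit x)
    conv_rhs => rw [I.eq_inner_smul_unit (r x) (L.conj x _), I.inner_unit_conj, I.inner_smul_unit]

end Uniqueness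

end

end KR

end

theorem mainTheorem8 {X : Type*} [TopologicalSpace X] [T2Space X] [LocallyCompactSpace X]
    (r : KR.RealStructure X) (E : KR.EquivariantBundle r) (a b : ℕ)
    {M₁ : Type*} [NormedAddCommGroup M₁] [NormedSpace ℂ M₁] [CompleteSpace M₁]
    {M₂ : Type*} [NormedAddCommGroup M₂] [NormedSpace ℂ M₂] [CompleteSpace M₂]
    (K₁ : KR.KROrientation E a b M₁) (K₂ : KR.KROrientation E a b M₂) :
    ∃ L : KR.RealLineBundle.{_, 0} r, Nonempty (KR.TensorIso L K₁ K₂) ∧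
      ∀ L' : KR.RealLineBundle r, Nonempty (KR.TensorIso L' K₁ K₂) →
        Nonempty (KR.RealLineBundle.Iso L L') :=
  ⟨KR.lineBundle K₁ K₂, ⟨KR.lineBundleTensorIso K₁ K₂⟩, fun _ ⟨I⟩ => ⟨I.lineBundleIso⟩⟩
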